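/- Let $M$ be a closed connected smooth manifold of dimension $2n$. Let $(U,\eta)$ be a (Hausdorff, second countable, possibly disconnected) symplectic manifold without boundary of the same dimension $2n$, and let $V\subset U$ be compact, for instance a compact $2n$-dimensional submanifold with piecewise smooth boundary. Assume that $H^2(V,\mathbb R)=0$; here $H^2(V,\mathbb R)$ is the de Rham cohomology of $V$: closed $2$-forms on open neighbourhoods of $V$ modulo those that are exact on some (possibly smaller) open neighbourhood of $V$, i.e. $\varinjlim_{W\supset V} H^2_{dR}(W)$. For a symplectic form $\omega$ on $M$ write $\mathrm{Vol}(M,\omega)=\int_M\omega^n$ (with respect to the orientation given by $\omega$) and similarly $\mathrm{Vol}(V,\alpha\eta)=\int_V(\alpha\eta)^n$. Say that $(V,\alpha\eta)$ embeds symplectically into $(M,\omega)$ if there are an open neighbourhood $W$ of $V$ in $U$ and a smooth embedding $f:W\to M$ with $f^*\omega=\alpha\eta$. Define $$\nu(M,\omega,V)=\frac{\sup_\alpha \mathrm{Vol}(V,\alpha\eta)}{\mathrm{Vol}(M,\omega)}\in[-\infty,\infty],$$ where the supremum is over all $\alpha>0$ such that $(V,\alpha\eta)$ embeds symplectically into $(M,\omega)$,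 and $\nu(M,\omega,V)=-\infty$ if there is no such $\alpha$. A symplectic form is called Kähler if it is compatible with some complex structure $J$ on $M$ (that is, $\omega(\cdot,J\cdot)$ is a $J$-invariant Riemannian metric), and hyperkähler if it is one of the three forms of a hyperkähler structure $(I_1,I_2,I_3,\omega_1,\omega_2,\omega_3)$ on $M$: complex structures with the quaternionic relations and symplectic forms $\omega_i$ compatible with $I_i$ such that the three metrics $\omega_i(\cdot,I_i\cdot)$ coincide. Then the function $\omega\mapsto\nu(M,\omega,V)$ is lower semicontinuous, with respect to the $C^\infty$-topology, on the space of Kähler forms $\omega$ on $M$ with $\mathrm{Vol}(M,\omega)=1$; and, likewise, on the space of hyperkähler forms $\omega$ on $M$ with $\mathrm{Vol}(M,\omega)=1$. (In particular this holds for Kähler forms on the torus $T^{2n}$ and for hyperkähler forms on manifolds that admit irreducible holomorphically symplectic hyperkähler structures.) -/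

import Mathlib

open Set MeasureTheory Topology
open scoped Manifold ContDiff ENNReal

noncomputable section

/-- The model space `ℝ²ⁿ`. -/
abbrev Model (n : ℕ) : Type := EuclideanSpace ℝ (Fin (2 * n))

section Forms

variable (n : ℕ) {M : Type*} [TopologicalSpace M] [ChartedSpace (Model n) M]

/-- (Not necessarily smooth) differential `k`-forms on a `2n`-manifold `M`: at each point an
alternating `k`-linear form on the tangent space. -/
abbrev DiffForm (k : ℕ) (M : Type*) [TopologicalSpace M] [ChartedSpace (Model n) M] : Type _ :=
  (x : M) → (TangentSpace 𝓘(ℝ, Model n) x) [⋀^Fin k]→L[ℝ] ℝ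

variable {n} {k : ℕ}

/-- The coordinate expression of a form in the chart around `x₀`, i.e. its pullback to `ℝ²ⁿ` by the
inverse chart. It is meaningful on the (open) chart target. -/
def DiffForm.inChart (x₀ : M) (θ : DiffForm n k M) (y : Model n) :
    (Model n) [⋀^Fin k]→L[ℝ] ℝ :=
  (θ ((extChartAt 𝓘(ℝ, Model n) x₀).symm y)).compContinuousLinearMap
    (mfderiv 𝓘(ℝ, Model n) 𝓘(ℝ, Model n) (extChartAt 𝓘(ℝ, Model n) x₀).symm y)

/-- The part of the target of the chart around `x₀` that corresponds to the subset `W` of `M`. -/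
def chartPart (n : ℕ) {M : Type*} [TopologicalSpace M] [ChartedSpace (Model n) M]
    (x₀ : M) (W : Set M) : Set (Model n) :=
  (extChartAt 𝓘(ℝ, Model n) x₀).target ∩ (extChartAt 𝓘(ℝ, Model n) x₀).symm ⁻¹' W

/-- The form `θ` is smooth on the open set `W`: its coordinate expressions are `C^∞` there. -/
def DiffForm.SmoothOn (θ : DiffForm n k M) (W : Set M) : Prop :=
  ∀ x₀ : M, ContDiffOn ℝ ∞ (θ.inChart x₀) (chartPart n x₀ W)

/-- The exterior derivative, computed at `x` in the chart around `x` (by which the tangent space at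
`x` is identified with `ℝ²ⁿ`). -/
def DiffForm.d (θ : DiffForm n k M) : DiffForm n (k + 1) M :=
  fun x => extDeriv (θ.inChart x) (extChartAt 𝓘(ℝ, Model n) x x)

/-- Pullback of a form by a map. -/
def DiffForm.pullback {N : Type*} [TopologicalSpace N] [ChartedSpace (Model n) N]
    (f : N → M) (θ : DiffForm n k M) : DiffForm n k N :=
  fun x => (θ (f x)).compContinuousLinearMap (mfderiv 𝓘(ℝ, Model n) 𝓘(ℝ, Model n) f x)

lemma DiffForm.inChart_add (x₀ : M) (θ τ : DiffForm n k M) :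
    DiffForm.inChart x₀ (θ + τ) = θ.inChart x₀ + τ.inChart x₀ := rfl

lemma DiffForm.inChart_smul (x₀ : M) (c : ℝ) (θ : DiffForm n k M) :
    DiffForm.inChart x₀ (c • θ) = c • θ.inChart x₀ := rfl

lemma DiffForm.inChart_zero (x₀ : M) :
    DiffForm.inChart x₀ (0 : DiffForm n k M) = 0 := rfl

lemma DiffForm.SmoothOn.mono {θ : DiffForm n k M} {W W' : Set M} (h : θ.SmoothOn W)
    (hW : W' ⊆ W) : θ.SmoothOn W' :=
  fun x₀ => (h x₀).mono (fun _ hy => ⟨hy.1, hW hy.2⟩)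

lemma DiffForm.SmoothOn.add {θ τ : DiffForm n k M} {W : Set M} (h : θ.SmoothOn W)
    (h' : τ.SmoothOn W) : DiffForm.SmoothOn (θ + τ) W := fun x₀ => by
  rw [DiffForm.inChart_add]; exact (h x₀).add (h' x₀)

lemma DiffForm.SmoothOn.smul {θ : DiffForm n k M} {W : Set M} (c : ℝ) (h : θ.SmoothOn W) :
    DiffForm.SmoothOn (c • θ) W := fun x₀ => by
  rw [DiffForm.inChart_smul]; exact (h x₀).const_smul c

lemma DiffForm.smoothOn_zero (W : Set M) : DiffForm.SmoothOn (0 : DiffForm n k M) W := fun x₀ => by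
  rw [DiffForm.inChart_zero]; exact contDiffOn_const

lemma DiffForm.SmoothOn.differentiableAt {θ : DiffForm n k M} {W : Set M} (hW : IsOpen W)
    (h : θ.SmoothOn W) {x : M} (hx : x ∈ W) :
    DifferentiableAt ℝ (θ.inChart x) (extChartAt 𝓘(ℝ, Model n) x x) := by
  have hO : IsOpen (chartPart n x W) :=
    (continuousOn_extChartAt_symm x).isOpen_inter_preimage (isOpen_extChartAt_target x) hW
  have hm : extChartAt 𝓘(ℝ, Model n) x x ∈ chartPart n x W :=
    ⟨mem_extChartAt_target x, by simpa using hx⟩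
  exact ((h x).contDiffAt (hO.mem_nhds hm)).differentiableAt (by simp)

lemma DiffForm.d_add {θ τ : DiffForm n k M} {W : Set M} (hW : IsOpen W) (h : θ.SmoothOn W)
    (h' : τ.SmoothOn W) {x : M} (hx : x ∈ W) : DiffForm.d (θ + τ) x = θ.d x + τ.d x := by
  simp only [DiffForm.d, DiffForm.inChart_add]
  exact extDeriv_add (h.differentiableAt hW hx) (h'.differentiableAt hW hx)

lemma DiffForm.d_smul (c : ℝ) (θ : DiffForm n k M) (x : M) : DiffForm.d (c • θ) x = c • θ.d x := by
  simp only [DiffForm.d, DiffForm.inChart_smul]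
  exact extDeriv_smul c _

lemma DiffForm.d_zero (x : M) : DiffForm.d (0 : DiffForm n k M) x = 0 := by
  have h := DiffForm.d_smul (0 : ℝ) (0 : DiffForm n k M) x
  simpa using h

/-- The forms that are smooth and closed on some open neighbourhood of `V`. -/
def closedNear (n : ℕ) {M : Type*} [TopologicalSpace M] [ChartedSpace (Model n) M]
    (k : ℕ) (V : Set M) : Submodule ℝ (DiffForm n k M) where
  carrier := {β | ∃ W, IsOpen W ∧ V ⊆ W ∧ DiffForm.SmoothOn β W ∧ ∀ x ∈ W, DiffForm.d β x = 0}
  zero_mem' := ⟨univ, isOpen_univ, subset_univ V, DiffForm.smoothOn_zero _,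
    fun x _ => DiffForm.d_zero x⟩
  add_mem' := by
    rintro a b ⟨W, hW, hV, ha, ha'⟩ ⟨W', hW', hV', hb, hb'⟩
    have h1 := ha.mono (inter_subset_left (s := W) (t := W'))
    have h2 := hb.mono (inter_subset_right (s := W) (t := W'))
    refine ⟨W ∩ W', hW.inter hW', subset_inter hV hV', h1.add h2, fun x hx => ?_⟩
    rw [DiffForm.d_add (hW.inter hW') h1 h2 hx, ha' x hx.1, hb' x hx.2, add_zero]
  smul_mem' := by
    rintro c a ⟨W, hW, hV, ha, ha'⟩
    refine ⟨W, hW, hV, ha.smul c, fun x hx => ?_⟩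
    rw [DiffForm.d_smul, ha' x hx, smul_zero]

/-- The forms that have a smooth primitive on some open neighbourhood of `V`. -/
def exactNear (n : ℕ) {M : Type*} [TopologicalSpace M] [ChartedSpace (Model n) M]
    (k : ℕ) (V : Set M) : Submodule ℝ (DiffForm n (k + 1) M) where
  carrier := {β | ∃ W, IsOpen W ∧ V ⊆ W ∧
    ∃ σ : DiffForm n k M, DiffForm.SmoothOn σ W ∧ ∀ x ∈ W, DiffForm.d σ x = β x}
  zero_mem' := ⟨univ, isOpen_univ, subset_univ V, 0, DiffForm.smoothOn_zero _,
    fun x _ => DiffForm.d_zero x⟩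
  add_mem' := by
    rintro a b ⟨W, hW, hV, σ, ha, ha'⟩ ⟨W', hW', hV', τ, hb, hb'⟩
    have h1 := ha.mono (inter_subset_left (s := W) (t := W'))
    have h2 := hb.mono (inter_subset_right (s := W) (t := W'))
    refine ⟨W ∩ W', hW.inter hW', subset_inter hV hV', σ + τ, h1.add h2, fun x hx => ?_⟩
    rw [DiffForm.d_add (hW.inter hW') h1 h2 hx, ha' x hx.1, hb' x hx.2, Pi.add_apply]
  smul_mem' := by
    rintro c a ⟨W, hW, hV, σ, ha, ha'⟩
    refine ⟨W, hW, hV, c • σ, ha.smul c, fun x hx => ?_⟩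
    rw [DiffForm.d_smul, ha' x hx, Pi.smul_apply]

/-- The real (de Rham) cohomology `H^{k+1}(V, ℝ)` of a compact subset `V` of a manifold: closed
forms defined near `V` modulo exact ones. Two forms that agree near `V` have the same class, so this
is the direct limit of the de Rham cohomology of the open neighbourhoods of `V`. -/
def deRhamCohomology (n : ℕ) {M : Type*} [TopologicalSpace M] [ChartedSpace (Model n) M]
    (k : ℕ) (V : Set M) : Type _ :=
  letI : AddCommGroup (closedNear n (k + 1) V) := Submodule.addCommGroup _
  closedNear n (k + 1) V ⧸ (exactNear n k V).submoduleOf (closedNear n (k + 1) V)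

/-- A symplectic form: a smooth, closed and nondegenerate 2-form. -/
structure IsSymplectic (θ : DiffForm n 2 M) : Prop where
  smooth : θ.SmoothOn univ
  closed : ∀ x, θ.d x = 0
  nondegenerate : ∀ (x : M) (v : TangentSpace 𝓘(ℝ, Model n) x), (∀ w, θ x ![v, w] = 0) → v = 0

/-- The value `θⁿ(v₁, …, v₂ₙ)` of the `n`-th exterior power of a 2-form,
`2⁻ⁿ ∑_σ sign σ ∏ᵢ θ(v_{σ(2i-1)}, v_{σ(2i)})`. -/
def topPower (θ : (Model n) [⋀^Fin 2]→L[ℝ] ℝ) (v : Fin (2 * n) → Model n) : ℝ :=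
  (1 / 2 ^ n) * ∑ σ : Equiv.Perm (Fin (2 * n)), ((Equiv.Perm.sign σ : ℤ) : ℝ) *
    ∏ i : Fin n, θ ![v (σ ⟨2 * i, by omega⟩), v (σ ⟨2 * i + 1, by omega⟩)]

/-- The measure `S ↦ |∫_S θⁿ|` for `S` inside the domain of the chart around `x₀`. -/
def chartVolume [MeasurableSpace M] (x₀ : M) (θ : DiffForm n 2 M) : Measure M :=
  ((volume.restrict (extChartAt 𝓘(ℝ, Model n) x₀).target).withDensity fun y =>
    ENNReal.ofReal |topPower (θ.inChart x₀ y) fun i => EuclideanSpace.single i 1|).map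
      (extChartAt 𝓘(ℝ, Model n) x₀).symm

/-- The symplectic volume measure, `Vol(S, θ) = ∫_S θⁿ` with respect to the orientation given
by `θ`. The chart measures agree on overlaps, and the smallest measure that dominates all of them
(their supremum in the lattice of measures) is the measure glued from them. -/
def symplecticVolume [MeasurableSpace M] (θ : DiffForm n 2 M) : Measure M :=
  ⨆ x₀ : M, chartVolume x₀ θ

end Forms

section ComplexStructures

variable {n : ℕ} {M : Type*} [TopologicalSpace M] [ChartedSpace (Model n) M]

/-- Fields of endomorphisms of the tangent spaces. -/
abbrev EndField (n : ℕ) (M : Type*) [TopologicalSpace M] [ChartedSpace (Model n) M] : Type _ :=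
  (x : M) → TangentSpace 𝓘(ℝ, Model n) x →L[ℝ] TangentSpace 𝓘(ℝ, Model n) x

/-- The coordinate expression of an endomorphism field in the chart around `x₀`. -/
def EndField.inChart (x₀ : M) (J : EndField n M) (y : Model n) : Model n →L[ℝ] Model n :=
  (mfderiv 𝓘(ℝ, Model n) 𝓘(ℝ, Model n) (extChartAt 𝓘(ℝ, Model n) x₀)
      ((extChartAt 𝓘(ℝ, Model n) x₀).symm y)).comp
    ((J ((extChartAt 𝓘(ℝ, Model n) x₀).symm y)).comp
      (mfderiv 𝓘(ℝ, Model n) 𝓘(ℝ, Model n) (extChartAt 𝓘(ℝ, Model n) x₀).symm y))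

/-- A complex structure as a tensor: an almost complex structure which is integrable, i.e. near
every point there are holomorphic coordinates, smooth coordinates in `ℂⁿ` whose differential turns
`J` into multiplication by `i`. -/
structure IsComplexStructure (J : EndField n M) : Prop where
  smooth : ∀ x₀ : M, ContDiffOn ℝ ∞ (J.inChart x₀) (extChartAt 𝓘(ℝ, Model n) x₀).target
  sq : ∀ (x : M) (v : TangentSpace 𝓘(ℝ, Model n) x), J x (J x v) = -v
  integrable : ∀ x : M, ∃ e : OpenPartialHomeomorph M (EuclideanSpace ℂ (Fin n)), x ∈ e.source ∧
    ContMDiffOn 𝓘(ℝ, Model n) 𝓘(ℝ, EuclideanSpace ℂ (Fin n)) ∞ e e.source ∧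
    ContMDiffOn 𝓘(ℝ, EuclideanSpace ℂ (Fin n)) 𝓘(ℝ, Model n) ∞ e.symm e.target ∧
    ∀ y ∈ e.source, ∀ v : TangentSpace 𝓘(ℝ, Model n) y,
      (id (mfderiv 𝓘(ℝ, Model n) 𝓘(ℝ, EuclideanSpace ℂ (Fin n)) e y (J y v)) :
        EuclideanSpace ℂ (Fin n)) =
      Complex.I • (id (mfderiv 𝓘(ℝ, Model n) 𝓘(ℝ, EuclideanSpace ℂ (Fin n)) e y v) :
        EuclideanSpace ℂ (Fin n))

/-- `θ` and `J` are compatible: `θ(·, J·)` is a `J`-invariant Riemannian metric. -/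
structure Compatible (θ : DiffForm n 2 M) (J : EndField n M) : Prop where
  symm : ∀ (x : M) (v w : TangentSpace 𝓘(ℝ, Model n) x), θ x ![v, J x w] = θ x ![w, J x v]
  pos : ∀ (x : M) (v : TangentSpace 𝓘(ℝ, Model n) x), v ≠ 0 → 0 < θ x ![v, J x v]
  invariant : ∀ (x : M) (v w : TangentSpace 𝓘(ℝ, Model n) x),
    θ x ![J x v, J x (J x w)] = θ x ![v, J x w]

/-- A Kähler form: a symplectic form compatible with some complex structure. -/
def IsKahlerForm (θ : DiffForm n 2 M) : Prop :=
  IsSymplectic θ ∧ ∃ J : EndField n M, IsComplexStructure J ∧ Compatible θ J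

/-- A hyperkähler structure: three complex structures satisfying the quaternionic relations and
three symplectic forms compatible with them which induce the same Riemannian metric. -/
structure IsHyperkahlerStructure (J : Fin 3 → EndField n M) (θ : Fin 3 → DiffForm n 2 M) :
    Prop where
  complex : ∀ i, IsComplexStructure (J i)
  symplectic : ∀ i, IsSymplectic (θ i)
  compatible : ∀ i, Compatible (θ i) (J i)
  mul : ∀ (x : M) (v : TangentSpace 𝓘(ℝ, Model n) x), J 0 x (J 1 x v) = J 2 x v
  anticomm : ∀ (x : M) (v : TangentSpace 𝓘(ℝ, Model n) x), J 1 x (J 0 x v) = -J 2 x v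
  metric : ∀ (i j : Fin 3) (x : M) (v w : TangentSpace 𝓘(ℝ, Model n) x),
    θ i x ![v, J i x w] = θ j x ![v, J j x w]

/-- A hyperkähler form: a 2-form that appears in some hyperkähler structure. -/
def IsHyperkahlerForm (θ : DiffForm n 2 M) : Prop :=
  ∃ (J : Fin 3 → EndField n M) (Ω : Fin 3 → DiffForm n 2 M),
    IsHyperkahlerStructure J Ω ∧ ∃ i, θ = Ω i

end ComplexStructures

section SmoothForms

/-- Smooth differential `k`-forms on `M`. -/
def SmoothForm (n k : ℕ) (M : Type*) [TopologicalSpace M] [ChartedSpace (Model n) M] : Type _ :=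
  {θ : DiffForm n k M // DiffForm.SmoothOn θ univ}

/-- The `C^∞` topology: uniform convergence of the partial derivatives of all orders of the
coordinate expressions on the compact subsets of the chart targets. -/
instance (n k : ℕ) (M : Type*) [TopologicalSpace M] [ChartedSpace (Model n) M] :
    TopologicalSpace (SmoothForm n k M) :=
  ⨅ (x₀ : M) (m : ℕ), TopologicalSpace.induced
    (fun θ : SmoothForm n k M =>
      UniformOnFun.ofFun {K | IsCompact K ∧ K ⊆ (extChartAt 𝓘(ℝ, Model n) x₀).target}
        (iteratedFDeriv ℝ m (θ.1.inChart x₀)))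
    inferInstance

end SmoothForms

section Packing

variable {n : ℕ} {U : Type*} [TopologicalSpace U] [ChartedSpace (Model n) U]
  {M : Type*} [TopologicalSpace M] [ChartedSpace (Model n) M]

/-- `(V, η)`, where `V ⊆ U`, admits a symplectic embedding into `(M, θ)`: some open neighbourhood
`W` of `V` in `U` has a smooth embedding `f` into `M` with `f^* θ = η`. -/
def SymplecticallyEmbeds (V : Set U) (η : DiffForm n 2 U) (θ : DiffForm n 2 M) : Prop :=
  ∃ (W : Set U) (f : U → M), IsOpen W ∧ V ⊆ W ∧
    ContMDiffOn 𝓘(ℝ, Model n) 𝓘(ℝ, Model n) ∞ f W ∧ IsEmbedding (W.domRestrict f) ∧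
    ∀ x ∈ W, θ.pullback f x = η x

/-- The packing constant `ν(M, θ, V) = sup_α Vol(V, αη) / Vol(M, θ)`, over all `α > 0` such that
`(V, αη)` embeds symplectically into `(M, θ)`; it is `-∞` if there is no such `α`. -/
def packingConstant [MeasurableSpace U] [MeasurableSpace M]
    (θ : DiffForm n 2 M) (η : DiffForm n 2 U) (V : Set U) : EReal :=
  (⨆ α ∈ {α : ℝ | 0 < α ∧ SymplecticallyEmbeds V (α • η) θ},
    (symplecticVolume (α • η) V : EReal)) / (symplecticVolume θ univ : EReal)

end Packing

end

/-! All volumes of the target are 1, so ν(M, ω, V) is a supremum over the admissible α. It is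
therefore enough to show that an admissible α stays admissible for all symplectic forms near a given
ω₀: if Vol(V, αη) exceeds a bound at ω₀, then the same α witnesses the bound nearby.

Let f embed a neighbourhood W₀ of V with f^*ω₀ = αη. For a closed ω near ω₀ the form f^*(ω - ω₀) is
closed and small, and it is exact near V because H²(V) = 0. If it equals dσ with σ small, then f^*ω
= αη + dσ, and Moser's method gives a diffeomorphism Φ of U, close to the identity, with Φ^*(αη +
dσ) = αη near V. Then f ∘ Φ embeds (V, αη) into (M, ω). This is `SymplecticallyEmbeds.eventually`.

The cohomological hypothesis only gives each closed form some primitive on some neighbourhood,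
without estimates. Uniformity comes from Baire category. Choose countably many neighbourhoods W j
that are cofinal among those of V. The pairs (β, σ) with dσ = f^*β on W j form a closed linear
relation between complete metrizable spaces of jets, and the domains of these relations together
exhaust the closed forms on M. The open mapping theorem yields a single j for which small closed
forms have small primitives on W j (`exists_small_primitive`).

Moser's method is carried out one chart at a time. A partition of unity splits σ into 1-forms with
compact support in charts, which are added successively (`exists_homeomorph_pullback_add_d_sum_eq`).
In a chart the path a + sin t · dθ is nondegenerate on the support for all real t, and the
generating field has a small Lipschitz constant. Its flow is obtained by inverting a perturbation of
the identity on a Banach space of paths, which gives smooth dependence on the initial point at once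
(`exists_smooth_flow`, `exists_diffeo_pullback_eq`). -/

section

set_option maxSynthPendingDepth 3

noncomputable section

/-! ### Baire category and the open mapping theorem -/

section OpenMapping

open Filter

/-- In a complete metrizable group, a continuous homomorphism for which the closures of the images
of neighbourhoods of zero are neighbourhoods of zero maps neighbourhoods of zero to neighbourhoods
of zero. -/
theorem AddMonoidHom.image_mem_nhds_zero_of_closure {X Z : Type*} [AddCommGroup X] [UniformSpace X]
    [IsUniformAddGroup X] [CompleteSpace X] [(uniformity X).IsCountablyGenerated]
    [AddCommGroup Z] [UniformSpace Z] [IsUniformAddGroup Z] [T2Space Z]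
    [(uniformity Z).IsCountablyGenerated]
    (T : X →+ Z) (hT : Continuous T) (hcl : ∀ N ∈ 𝓝 (0 : X), closure (T '' N) ∈ 𝓝 (0 : Z))
    {N : Set X} (hN : N ∈ 𝓝 (0 : X)) : T '' N ∈ 𝓝 (0 : Z) := by
  -- The preimage will be a limit of partial sums; closedness of `N'` keeps the limit in `N`.
  obtain ⟨N', hN', hN'c, hN'N⟩ := exists_mem_nhds_isClosed_subset hN
  obtain ⟨u, hu, hadd⟩ := IsTopologicalAddGroup.exists_antitone_basis_nhds_zero X
  obtain ⟨k, hk⟩ := hu.mem_iff.1 hN'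
  obtain ⟨b, hb⟩ := (𝓝 (0 : Z)).exists_antitone_basis
  have huk : ∀ j, u j ∈ 𝓝 (0 : X) := fun j => hu.mem_of_mem trivial
  -- Successive approximation: each `z` in this closure is the image of a convergent series.
  -- Starting at `k + 1` leaves room for the whole sum in `u k`.
  refine mem_of_superset (hcl _ (huk (k + 1))) fun z hz => ?_
  -- The remainder stays in the closure of the next image, so the step can be repeated; the factor
  -- `b (j + 1)` makes the remainders tend to zero.
  have step : ∀ (j : ℕ) (w : Z), w ∈ closure (T '' u j) →
      ∃ x ∈ u j, w - T x ∈ closure (T '' u (j + 1)) ∩ b (j + 1) := by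
    intro j w hw
    have hn : {y | w - y ∈ closure (T '' u (j + 1)) ∩ b (j + 1)} ∈ 𝓝 w := by
      have hc : Tendsto (fun y => w - y) (𝓝 w) (𝓝 0) := by
        have : Continuous fun y => w - y := by fun_prop
        simpa using this.tendsto w
      exact hc (inter_mem (hcl _ (huk _)) (hb.mem_of_mem trivial))
    obtain ⟨_, h1, x, hx, rfl⟩ := mem_closure_iff_nhds.1 hw _ hn
    exact ⟨x, hx, h1⟩
  choose! g hg hg' using step
  let w : ℕ → Z := fun j => Nat.rec z (fun j w => w - T (g (k + 1 + j) w)) j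
  have hw0 : w 0 = z := rfl
  have hws : ∀ j, w (j + 1) = w j - T (g (k + 1 + j) (w j)) := fun j => rfl
  have hw : ∀ j, w j ∈ closure (T '' u (k + 1 + j)) := by
    intro j
    induction j with
    | zero => exact hz
    | succ j ih => rw [hws]; exact (hg' _ _ ih).1
  let x : ℕ → X := fun j => g (k + 1 + j) (w j)
  have hx : ∀ j, x j ∈ u (k + 1 + j) := fun j => hg _ _ (hw j)
  let s : ℕ → X := fun m => ∑ j ∈ Finset.range m, x j
  have hTs : ∀ m, z - T (s m) = w m := by
    intro m
    induction m with
    | zero => simp [s, hw0]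
    | succ m ih =>
      have h : s (m + 1) = s m + g (k + 1 + m) (w m) := Finset.sum_range_succ _ _
      rw [hws, h, map_add, ← sub_sub, ih]
  -- The first term and the sum of the others both lie in `u (k + m + 1)`, and two elements of that
  -- set add up to one of `u (k + m)`.
  have htail : ∀ d m, ∑ j ∈ Finset.range d, x (m + j) ∈ u (k + m) := by
    intro d
    induction d with
    | zero => intro m; simpa using mem_of_mem_nhds (huk _)
    | succ d ih =>
      intro m
      rw [Finset.sum_range_succ']
      have h1 := ih (m + 1)
      have h2 : (∑ j ∈ Finset.range d, x (m + (j + 1))) = ∑ j ∈ Finset.range d, x (m + 1 + j) :=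
        Finset.sum_congr rfl fun j _ => by congr 1; ring
      rw [h2]
      have h3 := hx m
      rw [show k + 1 + m = k + m + 1 by ring] at h3
      exact hadd (k + m) (Set.add_mem_add (by simpa [add_assoc] using h1) (by simpa using h3))
  have hcau : CauchySeq s := by
    have hbas : (uniformity X).HasBasis (fun _ => True)
        fun i => (fun p : X × X => p.1 - p.2) ⁻¹' u i := by
      rw [uniformity_eq_comap_nhds_zero_swapped]
      exact hu.toHasBasis.comap _
    refine hbas.cauchySeq_iff'.2 fun i _ => ⟨i, fun m hm => ?_⟩
    obtain ⟨d, rfl⟩ := Nat.exists_eq_add_of_le hm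
    have h : s (i + d) - s i = ∑ j ∈ Finset.range d, x (i + j) := by
      simp only [s, Finset.sum_range_add, add_sub_cancel_left]
    simp only [mem_preimage, h]
    exact hu.antitone (Nat.le_add_left i k) (htail d i)
  obtain ⟨l, hl⟩ := cauchySeq_tendsto_of_complete hcau
  refine ⟨l, hN'N (hN'c.mem_of_tendsto hl (Eventually.of_forall fun m => ?_)), ?_⟩
  · have := htail m 0
    simp only [zero_add, add_zero] at this
    exact hk this
  · have h1 : Tendsto (fun m => T (s m)) atTop (𝓝 (T l)) := (hT.tendsto l).comp hl
    have h2 : Tendsto w atTop (𝓝 0) := by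
      rw [← tendsto_add_atTop_iff_nat 1]
      refine hb.tendsto fun j => ?_
      rw [hws]
      exact hb.antitone (by omega) (hg' _ _ (hw j)).2
    have h3 : Tendsto (fun m => z - w m) atTop (𝓝 (z - 0)) := tendsto_const_nhds.sub h2
    have h4 : (fun m => z - w m) = fun m => T (s m) := funext fun m => by rw [← hTs]; abel
    rw [h4, sub_zero] at h3
    exact tendsto_nhds_unique h1 h3

/-- Open mapping theorem for countable families of complete metrizable spaces, whose images
together cover a complete metrizable space. -/
theorem exists_forall_image_mem_nhds_zero {κ Z : Type*} [Countable κ] {X : κ → Type*}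
    [∀ k, AddCommGroup (X k)] [∀ k, Module ℝ (X k)] [∀ k, UniformSpace (X k)]
    [∀ k, IsUniformAddGroup (X k)] [∀ k, ContinuousSMul ℝ (X k)] [∀ k, CompleteSpace (X k)]
    [∀ k, (uniformity (X k)).IsCountablyGenerated]
    [AddCommGroup Z] [Module ℝ Z] [UniformSpace Z] [IsUniformAddGroup Z] [ContinuousSMul ℝ Z]
    [CompleteSpace Z] [T2Space Z] [(uniformity Z).IsCountablyGenerated]
    (T : ∀ k, X k →L[ℝ] Z) (hT : ⋃ k, range (T k) = univ) :
    ∃ k, ∀ N ∈ 𝓝 (0 : X k), T k '' N ∈ 𝓝 (0 : Z) := by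
  have : BaireSpace Z := by
    let := UniformSpace.pseudoMetricSpace Z
    infer_instance
  obtain ⟨k, hk⟩ : ∃ k, ¬ IsMeagre (range (T k)) := by
    by_contra! h
    exact not_isMeagre_of_isOpen isOpen_univ ⟨0, trivial⟩ (hT ▸ isMeagre_iUnion h)
  refine ⟨k, fun N hN => (T k).toLinearMap.toAddMonoidHom.image_mem_nhds_zero_of_closure
    (T k).continuous (fun N hN => ?_) hN⟩
  obtain ⟨N', hN', hsub⟩ : ∃ N' ∈ 𝓝 (0 : X k), ∀ v ∈ N', ∀ w ∈ N', v - w ∈ N := by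
    have h : Tendsto (fun p : X k × X k => p.1 - p.2) (𝓝 (0, 0)) (𝓝 0) := by
      have : Continuous fun p : X k × X k => p.1 - p.2 := by fun_prop
      simpa using this.tendsto (0, 0)
    obtain ⟨A, hA, B, hB, h'⟩ := mem_nhds_prod_iff.1 (h hN)
    exact ⟨A ∩ B, inter_mem hA hB, fun v hv w hw => h' (mk_mem_prod hv.1 hw.2)⟩
  have hint : (interior (closure (T k '' N'))).Nonempty := by
    by_contra! h
    -- The dilates of `N'` exhaust `X k`; if the closure of `T k '' N'` had empty interior, the
    -- range would be a countable union of nowhere dense sets.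
    refine hk (IsMeagre.mono (s := ⋃ m : ℕ, (fun z => (m + 1 : ℝ) • z) '' (T k '' N')) ?_
      (isMeagre_iUnion fun m => ?_))
    · rintro _ ⟨x, rfl⟩
      have h1 : Tendsto (fun m : ℕ => (1 / ((m : ℝ) + 1)) • x) atTop (𝓝 ((0 : ℝ) • x)) :=
        tendsto_one_div_add_atTop_nhds_zero_nat.smul_const x
      rw [zero_smul] at h1
      obtain ⟨m, hm⟩ := (h1.eventually_mem hN').exists
      refine mem_iUnion.2 ⟨m, _, ⟨_, hm, rfl⟩, ?_⟩
      have h2 : (m + 1 : ℝ) ≠ 0 := by positivity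
      simp [smul_smul, h2]
    · refine IsNowhereDense.isMeagre ?_
      have h2 : (m + 1 : ℝ) ≠ 0 := by positivity
      change interior (closure (Homeomorph.smulOfNeZero (α := Z) (m + 1 : ℝ) h2 '' (T k '' N'))) = ∅
      rw [← Homeomorph.image_closure, ← Homeomorph.image_interior, h, image_empty]
  obtain ⟨z, hz⟩ := hint
  have h1 : Tendsto (fun y => y + z) (𝓝 0) (𝓝 z) := by
    have : Continuous fun y => y + z := by fun_prop
    simpa using this.tendsto 0
  -- Subtracting the interior point `z` moves it to zero, and differences of elements of `N'` lie in
  -- `N`.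
  filter_upwards [h1 (mem_interior_iff_mem_nhds.1 hz)] with y hy
  have h2 : y + z - z ∈ closure (T k '' N) := by
    refine map_mem_closure₂ (f := fun p q : Z => p - q) (by fun_prop) hy (interior_subset hz) ?_
    rintro _ ⟨v, hv, rfl⟩ _ ⟨w, hw, rfl⟩
    exact ⟨v - w, hsub v hv w hw, by simp⟩
  simpa using h2

end OpenMapping

/-! ### Open mapping for closed linear relations -/

section LinearRelations

lemma Submodule.isUniformAddGroup {X : Type*} [AddCommGroup X] [Module ℝ X] [UniformSpace X]
    [IsUniformAddGroup X] (S : Submodule ℝ X) : IsUniformAddGroup S :=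
  inferInstanceAs (IsUniformAddGroup S.toAddSubgroup)

lemma isCountablyGenerated_uniformity_subtype {X : Type*} [UniformSpace X]
    [(uniformity X).IsCountablyGenerated] (p : X → Prop) :
    (uniformity (Subtype p)).IsCountablyGenerated := by
  rw [uniformity_subtype]
  infer_instance

/-- Open mapping theorem for a countable family of closed linear relations between complete
metrizable spaces, whose domains together cover a closed subspace. -/
theorem exists_forall_nhds_zero_of_closed_relations {κ Z : Type*} [Countable κ] {X : κ → Type*}
    [∀ k, AddCommGroup (X k)] [∀ k, Module ℝ (X k)] [∀ k, UniformSpace (X k)]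
    [∀ k, IsUniformAddGroup (X k)] [∀ k, ContinuousSMul ℝ (X k)] [∀ k, CompleteSpace (X k)]
    [∀ k, (uniformity (X k)).IsCountablyGenerated]
    [AddCommGroup Z] [Module ℝ Z] [UniformSpace Z] [IsUniformAddGroup Z] [ContinuousSMul ℝ Z]
    [CompleteSpace Z] [T2Space Z] [(uniformity Z).IsCountablyGenerated]
    (S : Submodule ℝ Z) (hS : IsClosed (S : Set Z)) (R : ∀ k, Submodule ℝ (Z × X k))
    (hR : ∀ k, IsClosed (R k : Set (Z × X k))) (hRS : ∀ k, ∀ p ∈ R k, p.1 ∈ S)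
    (hSR : ∀ z ∈ S, ∃ k, ∃ x, (z, x) ∈ R k) :
    ∃ k, ∀ N ∈ 𝓝 (0 : X k), ∃ N' ∈ 𝓝 (0 : Z), ∀ z ∈ S, z ∈ N' → ∃ x ∈ N, (z, x) ∈ R k := by
  have := S.isUniformAddGroup
  have := fun k => (R k).isUniformAddGroup
  have : (uniformity S).IsCountablyGenerated := isCountablyGenerated_uniformity_subtype _
  have : ∀ k, (uniformity (R k)).IsCountablyGenerated := fun k => by
    have : (uniformity (Z × X k)).IsCountablyGenerated := by
      rw [uniformity_prod]; infer_instance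
    exact isCountablyGenerated_uniformity_subtype _
  have : CompleteSpace S := hS.completeSpace_coe
  have : ∀ k, CompleteSpace (R k) := fun k => (hR k).completeSpace_coe
  -- The relation becomes a map: the projection of its graph to the first factor. Graph and target
  -- are complete because they are closed.
  let T : ∀ k, R k →L[ℝ] S := fun k =>
    ((ContinuousLinearMap.fst ℝ Z (X k)).comp (R k).subtypeL).codRestrict S
      fun p => hRS k p p.2
  obtain ⟨k, hk⟩ := exists_forall_image_mem_nhds_zero T (by
    refine eq_univ_of_forall fun z => ?_
    obtain ⟨k, x, hx⟩ := hSR z z.2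
    exact mem_iUnion.2 ⟨k, ⟨(z, x), hx⟩, rfl⟩)
  refine ⟨k, fun N hN => ?_⟩
  have h1 : (fun p : R k => (p : Z × X k).2) ⁻¹' N ∈ 𝓝 (0 : R k) := by
    have hc : Continuous fun p : R k => (p : Z × X k).2 := by fun_prop
    exact hc.continuousAt (x := (0 : R k)) hN
  obtain ⟨N', hN', hsub⟩ := mem_nhds_subtype (S : Set Z) 0 _ |>.1 (hk _ h1)
  refine ⟨N', hN', fun z hz hzN => ?_⟩
  obtain ⟨⟨⟨z', x⟩, hp⟩, hx, hpz⟩ := hsub (show (⟨z, hz⟩ : S) ∈ _ from hzN)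
  have : z' = z := congrArg Subtype.val hpz
  subst this
  exact ⟨x, hx, hp⟩

end LinearRelations

/-! ### Complete metrizable spaces of continuous functions -/

section JetSpaces

open TopologicalSpace

/-- The uniformity is induced from uniform convergence on compact sets, where subtraction is
uniformly continuous. -/
lemma ContinuousMap.isUniformAddGroup {X G : Type*} [TopologicalSpace X] [AddCommGroup G]
    [UniformSpace G] [IsUniformAddGroup G] : IsUniformAddGroup C(X, G) := by
  refine ⟨?_⟩
  have hi := (ContinuousMap.isUniformEmbedding_toUniformOnFunIsCompact
    (α := X) (β := G)).isUniformInducing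
  rw [hi.uniformContinuous_iff]
  exact (hi.uniformContinuous.comp uniformContinuous_fst).sub
    (hi.uniformContinuous.comp uniformContinuous_snd)

variable {E : Type*} [NormedAddCommGroup E] [NormedSpace ℝ E] [FiniteDimensional ℝ E]

/-- Countable products of spaces of continuous functions on open subsets of a finite-dimensional
space. -/
abbrev ContProd {E : Type*} [NormedAddCommGroup E] {ι : Type*} (O : ι → Opens E) (G : ℕ → Type*)
    [∀ m, NormedAddCommGroup (G m)] : Type _ :=
  (i : ι) → (m : ℕ) → C(O i, G m)

/-- Local compactness and σ-compactness of `O` are what makes `C(O, G)` complete with a countably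
generated uniformity. -/
instance TopologicalSpace.Opens.locallyCompactSpace' (O : Opens E) : LocallyCompactSpace O :=
  have := FiniteDimensional.proper ℝ E
  O.isOpen.locallyCompactSpace

instance TopologicalSpace.Opens.sigmaCompactSpace' (O : Opens E) : SigmaCompactSpace O :=
  have := FiniteDimensional.proper ℝ E
  have : SecondCountableTopology O := inferInstanceAs (SecondCountableTopology (O : Set E))
  inferInstance

variable {ι : Type*} (O : ι → Opens E) (G : ℕ → Type*)
    [∀ m, NormedAddCommGroup (G m)] [∀ m, NormedSpace ℝ (G m)]

instance ContProd.isUniformAddGroup : IsUniformAddGroup (ContProd O G) :=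
  have : ∀ i m, IsUniformAddGroup C(O i, G m) := fun _ _ => ContinuousMap.isUniformAddGroup
  inferInstance

instance ContProd.isCountablyGenerated [Countable ι] :
    (uniformity (ContProd O G)).IsCountablyGenerated := by
  infer_instance

instance ContProd.completeSpace [∀ m, CompleteSpace (G m)] : CompleteSpace (ContProd O G) := by
  infer_instance

instance ContProd.t2Space : T2Space (ContProd O G) := by
  infer_instance

instance ContProd.continuousSMul : ContinuousSMul ℝ (ContProd O G) := by
  infer_instance

end JetSpaces

/-! ### Smoothness of superposition operators -/

section Superposition

universe u

variable {X : Type*} {G F : Type u} [TopologicalSpace X] [CompactSpace X] [NormedAddCommGroup G]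
  [NormedSpace ℝ G] [NormedAddCommGroup F] [NormedSpace ℝ F]

/-- Pointwise application of a continuous family of linear maps to a continuous function. -/
def ContinuousMap.clmApplyL (X : Type*) (G F : Type u) [TopologicalSpace X] [CompactSpace X]
    [NormedAddCommGroup G] [NormedSpace ℝ G] [NormedAddCommGroup F] [NormedSpace ℝ F] :
    C(X, G →L[ℝ] F) →L[ℝ] C(X, G) →L[ℝ] C(X, F) :=
  LinearMap.mkContinuous₂ (LinearMap.mk₂ ℝ
    (fun (A : C(X, G →L[ℝ] F)) (h : C(X, G)) => (⟨fun x => A x (h x), by fun_prop⟩ : C(X, F)))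
    (fun A B h => by ext x; simp) (fun c A h => by ext x; simp)
    (fun A h k => by ext x; simp) (fun c A h => by ext x; simp)) 1 (fun A h => by
      rw [one_mul, ContinuousMap.norm_le _ (by positivity)]
      exact fun x => (A x).le_of_opNorm_le_of_le (A.norm_coe_le_norm x) (h.norm_coe_le_norm x))

@[simp] lemma ContinuousMap.clmApplyL_apply (A : C(X, G →L[ℝ] F)) (h : C(X, G)) (x : X) :
    ContinuousMap.clmApplyL X G F A h x = A x (h x) := rfl

/-- The derivative of the superposition operator `γ ↦ v ∘ γ`. -/
lemma ContinuousMap.hasFDerivAt_comp {v : G → F} (hv : ContDiff ℝ 1 v) (γ : C(X, G)) :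
    HasFDerivAt (fun γ : C(X, G) => (⟨v, hv.continuous⟩ : C(G, F)).comp γ)
      (ContinuousMap.clmApplyL X G F
        ((⟨fderiv ℝ v, hv.continuous_fderiv one_ne_zero⟩ : C(G, G →L[ℝ] F)).comp γ)) γ := by
  set D : C(G, G →L[ℝ] F) := ⟨fderiv ℝ v, hv.continuous_fderiv one_ne_zero⟩
  have hcont : ContinuousAt (fun γ : C(X, G) => D.comp γ) γ :=
    (ContinuousMap.continuous_postcomp D).continuousAt
  rw [hasFDerivAt_iff_isLittleO_nhds_zero, Asymptotics.isLittleO_iff]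
  intro c hc
  obtain ⟨δ, hδ, h⟩ : ∃ δ > 0, ∀ ⦃γ' : C(X, G)⦄, dist γ' γ < δ →
      dist (D.comp γ') (D.comp γ) < c := by
    refine Metric.continuousAt_iff.1 ?_ c hc
    exact hcont
  filter_upwards [Metric.ball_mem_nhds (0 : C(X, G)) hδ] with k hk
  rw [ContinuousMap.norm_le _ (by positivity)]
  intro x
  have hk' : ‖k‖ < δ := by simpa using hk
  -- Comparing `γ` with its translate by the constant `z - γ x` turns continuity of composition in
  -- the sup norm into a bound on the ball around `γ x`, with `δ` independent of `x`. The space `G`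
  -- need not be locally compact for this.
  have hder : ∀ z ∈ Metric.ball (γ x) δ, ‖fderiv ℝ v z - fderiv ℝ v (γ x)‖ ≤ c := by
    intro z hz
    have h1 : dist (γ + ContinuousMap.const X (z - γ x)) γ < δ := by
      rw [dist_eq_norm, add_sub_cancel_left]
      refine lt_of_le_of_lt ((ContinuousMap.norm_le _ (norm_nonneg (z - γ x))).2 fun _ => le_rfl) ?_
      simpa [dist_eq_norm] using hz
    have h2 := (ContinuousMap.dist_apply_le_dist x).trans (h h1).le
    simpa [D, dist_eq_norm] using h2
  have hmem : γ x + k x ∈ Metric.ball (γ x) δ := by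
    simpa [dist_eq_norm] using (k.norm_coe_le_norm x).trans_lt hk'
  have h3 := (convex_ball (γ x) δ).norm_image_sub_le_of_norm_hasFDerivWithin_le'
    (fun z _ => ((hv.differentiable one_ne_zero) z).hasFDerivAt.hasFDerivWithinAt) hder
    (Metric.mem_ball_self hδ) hmem
  simp only [add_sub_cancel_left] at h3
  exact h3.trans (mul_le_mul_of_nonneg_left (k.norm_coe_le_norm x) hc.le)

/-- The superposition operator of a smooth map is smooth. -/
theorem ContinuousMap.contDiff_comp {v : G → F} (hv : ContDiff ℝ ∞ v) :
    ContDiff ℝ ∞ (fun γ : C(X, G) => (⟨v, hv.continuous⟩ : C(G, F)).comp γ) := by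
  refine contDiff_infty.2 fun m => ?_
  -- The derivative is the superposition operator of `fderiv ℝ v` followed by a bounded linear map.
  -- Its target is `G →L[ℝ] F`, so `F` has to vary, and it must do so within one universe.
  induction m generalizing F with
  | zero => exact contDiff_zero.2 (ContinuousMap.continuous_postcomp _)
  | succ m ih =>
    have h1 : ContDiff ℝ 1 v := hv.of_le (by simp)
    have h2 : ContDiff ℝ ∞ (fderiv ℝ v) := hv.fderiv_right (by simp)
    rw [Nat.cast_succ, contDiff_succ_iff_hasFDerivAt]
    refine ⟨_, ?_, fun γ => ContinuousMap.hasFDerivAt_comp h1 γ⟩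
    exact (ContinuousMap.clmApplyL X G F).contDiff.comp (ih h2)

end Superposition

/-! ### Contractive perturbations of the identity -/

section Perturbation

variable {F : Type*} [NormedAddCommGroup F] [NormedSpace ℝ F] [CompleteSpace F]

/-- A smooth map whose difference with the identity is a contraction is a diffeomorphism. -/
theorem exists_homeomorph_of_lipschitzWith_sub_id {g : F → F} (hg : ContDiff ℝ ∞ g)
    (hl : LipschitzWith (1 / 2) fun x => g x - x) :
    ∃ Ψ : F ≃ₜ F, ⇑Ψ = g ∧ ContDiff ℝ ∞ Ψ.symm := by
  have happ : ApproximatesLinearOn g ((ContinuousLinearEquiv.refl ℝ F : F ≃L[ℝ] F) : F →L[ℝ] F)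
      univ (1 / 2) := by
    rw [ApproximatesLinearOn.approximatesLinearOn_iff_lipschitzOnWith, lipschitzOnWith_univ]
    exact hl
  have hc : Subsingleton F ∨ (1 / 2 : NNReal) <
      ‖((ContinuousLinearEquiv.refl ℝ F).symm : F →L[ℝ] F)‖₊⁻¹ := by
    rcases subsingleton_or_nontrivial F with h | h
    · exact Or.inl h
    · right
      have : ‖((ContinuousLinearEquiv.refl ℝ F).symm : F →L[ℝ] F)‖₊ = 1 :=
        ContinuousLinearMap.nnnorm_id
      rw [this, inv_one]
      norm_num
  refine ⟨happ.toHomeomorph g hc, rfl, ?_⟩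
  have hnorm : ∀ x, ‖fderiv ℝ (fun x => g x - x) x‖ < 1 := fun x =>
    (norm_fderiv_le_of_lipschitz ℝ hl).trans_lt (by norm_num)
  have hfd : ∀ x, HasFDerivAt g
      (((1 : F →L[ℝ] F) - (-(fderiv ℝ (fun x => g x - x) x))) : F →L[ℝ] F) x := by
    intro x
    have h0 : DifferentiableAt ℝ g x := (hg.differentiable (by simp)) x
    have h1 : HasFDerivAt (fun x => g x - x) (fderiv ℝ (fun x => g x - x) x) x :=
      (h0.sub differentiableAt_id).hasFDerivAt
    have h2 := h1.add (hasFDerivAt_id x)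
    have h3 : ((fun x => g x - x) + id : F → F) = g := by ext y; simp
    rw [h3] at h2
    rw [sub_neg_eq_add, add_comm]
    exact h2
  -- The derivative differs from the identity by an operator of norm less than one, hence is
  -- invertible by the Neumann series.
  refine Homeomorph.contDiff_symm (happ.toHomeomorph g hc)
    (f₀' := fun x => ContinuousLinearEquiv.unitsEquiv ℝ F
      (Units.oneSub (-(fderiv ℝ (fun x => g x - x) x)) (by rw [norm_neg]; exact hnorm x))) ?_ hg
  intro x
  exact hfd x

end Perturbation

/-! ### Flows as solutions of a Volterra equation -/

section Flow

universe u

variable {E : Type u} [NormedAddCommGroup E] [NormedSpace ℝ E]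

/-- The time interval on which flows are considered. -/
abbrev TimeInterval : Type := Icc (0 : ℝ) 2

/-- The projection of the real line to the time interval. -/
def timeProj (s : ℝ) : TimeInterval := projIcc 0 2 zero_le_two s

lemma continuous_timeProj : Continuous timeProj :=
  continuous_projIcc (h := zero_le_two)

lemma timeProj_of_mem {t : ℝ} (ht : t ∈ Icc (0 : ℝ) 2) : (timeProj t : ℝ) = t :=
  congrArg Subtype.val (projIcc_of_mem zero_le_two ht)

omit [NormedSpace ℝ E] in
lemma intervalIntegrable_comp_timeProj (u : C(TimeInterval, E)) (a b : ℝ) :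
    IntervalIntegrable (fun s => u (timeProj s)) volume a b :=
  (u.continuous.comp continuous_timeProj).intervalIntegrable a b

/-- The Volterra operator `u ↦ (t ↦ ∫₀ᵗ u)`. -/
def volterra (E : Type u) [NormedAddCommGroup E] [NormedSpace ℝ E] :
    C(TimeInterval, E) →L[ℝ] C(TimeInterval, E) :=
  LinearMap.mkContinuous
    { toFun := fun u => ⟨fun t => ∫ s in (0 : ℝ)..t, u (timeProj s), by
        have h := intervalIntegral.continuous_primitive
          (fun a b => intervalIntegrable_comp_timeProj u a b) 0
        exact h.comp continuous_subtype_val⟩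
      map_add' := fun u w => by
        ext t
        exact intervalIntegral.integral_add (intervalIntegrable_comp_timeProj u _ _)
          (intervalIntegrable_comp_timeProj w _ _)
      map_smul' := fun c u => by
        ext t
        exact intervalIntegral.integral_smul c _ } 2 (fun u => by
      rw [ContinuousMap.norm_le _ (by positivity)]
      intro t
      refine (intervalIntegral.norm_integral_le_of_norm_le_const
        (fun s _ => u.norm_coe_le_norm (timeProj s))).trans ?_
      rw [sub_zero, abs_of_nonneg t.2.1, mul_comm]
      exact mul_le_mul_of_nonneg_right t.2.2 (norm_nonneg _))

lemma volterra_apply (u : C(TimeInterval, E)) (t : TimeInterval) :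
    volterra E u t = ∫ s in (0 : ℝ)..t, u (timeProj s) := rfl

lemma norm_volterra_le (u : C(TimeInterval, E)) : ‖volterra E u‖ ≤ 2 * ‖u‖ :=
  (LinearMap.mkContinuous_norm_le _ zero_le_two _ |> fun h => (volterra E).le_of_opNorm_le h u)

/-- The graph `t ↦ (t, γ t)` of a path. -/
def pathGraph (γ : C(TimeInterval, E)) : C(TimeInterval, ℝ × E) :=
  ⟨fun t => ((t : ℝ), γ t), by fun_prop⟩

/-- The linear part of `pathGraph`. -/
def pathGraphL (E : Type u) [NormedAddCommGroup E] [NormedSpace ℝ E] :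
    C(TimeInterval, E) →L[ℝ] C(TimeInterval, ℝ × E) :=
  (ContinuousLinearMap.inr ℝ ℝ E).compLeftContinuous ℝ TimeInterval

lemma pathGraph_eq : (pathGraph : C(TimeInterval, E) → _) =
    fun γ => pathGraph 0 + pathGraphL E γ := by
  ext γ t <;> simp [pathGraph, pathGraphL]

/-- The velocity along a path: `t ↦ v (t, γ t)`. -/
def velocity {v : ℝ × E → E} (hv : Continuous v) (γ : C(TimeInterval, E)) : C(TimeInterval, E) :=
  (⟨v, hv⟩ : C(ℝ × E, E)).comp (pathGraph γ)

lemma contDiff_velocity {v : ℝ × E → E} (hv : ContDiff ℝ ∞ v) :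
    ContDiff ℝ ∞ (velocity hv.continuous) := by
  refine (ContinuousMap.contDiff_comp hv).comp ?_
  rw [pathGraph_eq]
  exact contDiff_const.add (pathGraphL E).contDiff

lemma fderiv_velocity_apply {v : ℝ × E → E} (hv : ContDiff ℝ ∞ v) (γ h : C(TimeInterval, E))
    (t : TimeInterval) : fderiv ℝ (velocity hv.continuous) γ h t
      = fderiv ℝ v ((t : ℝ), γ t) (0, h t) := by
  have h1 : HasFDerivAt (pathGraph : C(TimeInterval, E) → _) (pathGraphL E) γ := by
    rw [pathGraph_eq]
    exact (pathGraphL E).hasFDerivAt.const_add _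
  have h2 := (ContinuousMap.hasFDerivAt_comp (hv.of_le (by simp)) (pathGraph γ)).comp γ h1
  have h3 : HasFDerivAt (velocity hv.continuous) _ γ := h2
  rw [h3.fderiv]
  rfl

omit [NormedSpace ℝ E] in
lemma norm_velocity_sub_le {v : ℝ × E → E} (hv : Continuous v) {C : ℝ} (hC : 0 ≤ C)
    (hl : ∀ t x y, ‖v (t, x) - v (t, y)‖ ≤ C * ‖x - y‖) (γ κ : C(TimeInterval, E)) :
    ‖velocity hv γ - velocity hv κ‖ ≤ C * ‖γ - κ‖ := by
  rw [ContinuousMap.norm_le _ (by positivity)]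
  intro t
  exact (hl t (γ t) (κ t)).trans
    (mul_le_mul_of_nonneg_left ((γ - κ).norm_coe_le_norm t) hC)

/-- The flow of a smooth time-dependent vector field with small Lipschitz constant depends smoothly
on the initial point. -/
theorem exists_smooth_flow [CompleteSpace E] {v : ℝ × E → E} (hv : ContDiff ℝ ∞ v)
    (hl : ∀ t x y, ‖v (t, x) - v (t, y)‖ ≤ 1 / 8 * ‖x - y‖) :
    ∃ Φ : E → C(TimeInterval, E), ContDiff ℝ ∞ Φ ∧
      (∀ x γ, γ = ContinuousMap.const _ x + volterra E (velocity hv.continuous γ) ↔ γ = Φ x) ∧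
      (∀ x h, fderiv ℝ Φ x h = ContinuousMap.const _ h +
        volterra E (fderiv ℝ (velocity hv.continuous) (Φ x) (fderiv ℝ Φ x h))) ∧
      ∀ t, LipschitzWith (1 / 2) fun x => Φ x t - x := by
  set N := velocity hv.continuous with hN
  have hNs : ContDiff ℝ ∞ N := contDiff_velocity hv
  have hNl := norm_velocity_sub_le hv.continuous (by norm_num) hl
  -- Integral curves from `x` are exactly the solutions of `g γ = const x`, so the flow is the
  -- inverse of `g` restricted to constant paths.
  let g : C(TimeInterval, E) → C(TimeInterval, E) := fun γ => γ - volterra E (N γ)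
  have hg : ContDiff ℝ ∞ g := contDiff_id.sub ((volterra E).contDiff.comp hNs)
  -- The Volterra operator has norm at most 2, so the Lipschitz constant 1/8 becomes 1/4.
  have hVN : ∀ γ κ, ‖volterra E (N γ) - volterra E (N κ)‖ ≤ 1 / 4 * ‖γ - κ‖ := by
    intro γ κ
    rw [← map_sub]
    have h1 := norm_volterra_le (N γ - N κ)
    have h2 := hNl γ κ
    rw [← hN] at h2
    linarith
  have hgl : LipschitzWith (1 / 2) fun γ => g γ - γ := by
    refine LipschitzWith.of_dist_le_mul fun γ κ => ?_
    have h1 := hVN γ κ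
    have h2 : g γ - γ - (g κ - κ) = -(volterra E (N γ) - volterra E (N κ)) := by
      simp only [g]; abel
    rw [dist_eq_norm, dist_eq_norm, h2, norm_neg]
    refine h1.trans (mul_le_mul_of_nonneg_right ?_ (norm_nonneg _))
    norm_num
  obtain ⟨Ψ, hΨ, hΨs⟩ := exists_homeomorph_of_lipschitzWith_sub_id hg hgl
  let cst : E →L[ℝ] C(TimeInterval, E) := ContinuousLinearMap.const ℝ TimeInterval
  let Φ : E → C(TimeInterval, E) := fun x => Ψ.symm (cst x)
  have hΦs : ContDiff ℝ ∞ Φ := hΨs.comp cst.contDiff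
  have hiff : ∀ x γ, γ = ContinuousMap.const _ x + volterra E (N γ) ↔ γ = Φ x := by
    intro x γ
    rw [← sub_eq_iff_eq_add]
    change g γ = cst x ↔ _
    rw [← hΨ]
    exact (Ψ.eq_symm_apply).symm
  have hΦ : ∀ x, Φ x = cst x + volterra E (N (Φ x)) := fun x => (hiff x (Φ x)).2 rfl
  refine ⟨Φ, hΦs, hiff, fun x h => ?_, fun t => ?_⟩
  -- Differentiating the fixed point equation in the initial value gives the linearized equation.
  · have hd : HasFDerivAt Φ (fderiv ℝ Φ x) x := ((hΦs.differentiable (by simp)) x).hasFDerivAt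
    have hdN : HasFDerivAt N (fderiv ℝ N (Φ x)) (Φ x) :=
      ((hNs.differentiable (by simp)) _).hasFDerivAt
    have h1 : HasFDerivAt (fun x => cst x + volterra E (N (Φ x)))
        (cst + (volterra E).comp ((fderiv ℝ N (Φ x)).comp (fderiv ℝ Φ x))) x :=
      cst.hasFDerivAt.add ((volterra E).hasFDerivAt.comp x (hdN.comp x hd))
    have h2 : (fun x => cst x + volterra E (N (Φ x))) = Φ := funext fun x => (hΦ x).symm
    rw [h2] at h1
    exact congrArg (fun A => A h) (hd.unique h1)
  · refine LipschitzWith.of_dist_le_mul fun x y => ?_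
    have hx := hΦ x
    have hy := hΦ y
    have h1 := hVN (Φ x) (Φ y)
    have h2 : ‖Φ x - Φ y‖ ≤ ‖x - y‖ + 1 / 4 * ‖Φ x - Φ y‖ := by
      calc ‖Φ x - Φ y‖ = ‖cst (x - y) + (volterra E (N (Φ x)) - volterra E (N (Φ y)))‖ := by
            conv_lhs => rw [hx, hy]
            rw [map_sub]; congr 1; abel
        _ ≤ ‖cst (x - y)‖ + 1 / 4 * ‖Φ x - Φ y‖ := (norm_add_le _ _).trans (by gcongr)
        _ ≤ _ := by
            gcongr
            exact (ContinuousMap.norm_le _ (norm_nonneg _)).2 fun _ => le_rfl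
    -- By `h2` the flow is 4/3-Lipschitz, so the integral term is Lipschitz with constant 1/4 · 4/3
    -- = 1/3.
    have h3 : Φ x t - x - (Φ y t - y) = (volterra E (N (Φ x)) - volterra E (N (Φ y))) t := by
      conv_lhs => rw [hx, hy]
      simp [cst]
    rw [dist_eq_norm, dist_eq_norm, h3]
    refine (ContinuousMap.norm_coe_le_norm _ t).trans (h1.trans ?_)
    push_cast
    linarith [norm_nonneg (x - y)]

end Flow

/-! ### Smooth solution of linear equations with parameters -/

section MoserField

universe u

variable {E : Type u} [NormedAddCommGroup E] [NormedSpace ℝ E] [FiniteDimensional ℝ E]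

/-- A continuous family of nondegenerate bilinear forms is uniformly nondegenerate on compact
sets. -/
lemma exists_forall_mul_norm_le_of_nondegenerate {K : Set E} (hK : IsCompact K)
    {B : E → E →L[ℝ] E →L[ℝ] ℝ} (hB : ContinuousOn B K)
    (hnd : ∀ y ∈ K, ∀ v, B y v = 0 → v = 0) :
    ∃ c > 0, ∀ y ∈ K, ∀ v, c * ‖v‖ ≤ ‖B y v‖ := by
  have hS : IsCompact (K ×ˢ Metric.sphere (0 : E) 1) := hK.prod (isCompact_sphere 0 1)
  have hc : ContinuousOn (fun p : E × E => ‖B p.1 p.2‖) (K ×ˢ Metric.sphere (0 : E) 1) := by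
    refine ContinuousOn.norm (ContinuousOn.clm_apply ?_ continuousOn_snd)
    exact hB.comp continuousOn_fst fun p hp => hp.1
  obtain ⟨c, hc0, hc⟩ : ∃ c > 0, ∀ p ∈ K ×ˢ Metric.sphere (0 : E) 1, c ≤ ‖B p.1 p.2‖ := by
    rcases (K ×ˢ Metric.sphere (0 : E) 1).eq_empty_or_nonempty with h | h
    · exact ⟨1, one_pos, by simp [h]⟩
    · obtain ⟨p, hp, hmin⟩ := hS.exists_isMinOn h hc
      refine ⟨_, norm_pos_iff.2 fun h0 => ?_, fun q hq => hmin hq⟩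
      have := hnd p.1 hp.1 p.2 h0
      have h1 := hp.2
      simp [this] at h1
  refine ⟨c, hc0, fun y hy v => ?_⟩
  rcases eq_or_ne v 0 with rfl | hv
  · simp
  have hv' : 0 < ‖v‖ := norm_pos_iff.2 hv
  have h1 := hc (y, ‖v‖⁻¹ • v) ⟨hy, by simp [norm_smul, hv'.ne']⟩
  simp only [map_smul, norm_smul, norm_inv, norm_norm] at h1
  rwa [le_inv_mul_iff₀ hv', mul_comm] at h1

/-- A bilinear form that is bounded below is invertible. -/
lemma exists_continuousLinearEquiv_of_mul_norm_le {B : E →L[ℝ] E →L[ℝ] ℝ} {c : ℝ} (hc : 0 < c)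
    (h : ∀ v, c * ‖v‖ ≤ ‖B v‖) : ∃ e : E ≃L[ℝ] (E →L[ℝ] ℝ), (e : E →L[ℝ] E →L[ℝ] ℝ) = B := by
  have hinj : Function.Injective B.toLinearMap := by
    rw [← LinearMap.ker_eq_bot, LinearMap.ker_eq_bot']
    intro v hv
    have h1 := h v
    have h2 : B v = 0 := hv
    rw [h2, norm_zero] at h1
    exact norm_eq_zero.1 (le_antisymm (nonpos_of_mul_nonpos_right h1 hc) (norm_nonneg v))
  have hfin : Module.finrank ℝ E = Module.finrank ℝ (E →L[ℝ] ℝ) := by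
    rw [(LinearMap.toContinuousLinearMap : (E →ₗ[ℝ] ℝ) ≃ₗ[ℝ] (E →L[ℝ] ℝ)).symm.finrank_eq]
    exact (Subspace.dual_finrank_eq (K := ℝ) (V := E)).symm
  refine ⟨(LinearEquiv.ofInjectiveOfFinrankEq B.toLinearMap hinj hfin).toContinuousLinearEquiv, ?_⟩
  ext v w
  rfl

/-- The solution `v` of the linear equation `B v = ρ` depends smoothly on the parameters. -/
theorem contDiff_inverse_apply {P : Type*} [NormedAddCommGroup P] [NormedSpace ℝ P]
    {S O : Set P} (hS : IsClosed S) (hO : IsOpen O) (hSO : S ⊆ O) {B : P → E →L[ℝ] E →L[ℝ] ℝ}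
    (hB : ContDiffOn ℝ ∞ B O) {c : ℝ} (hc : 0 < c) (hBc : ∀ p ∈ S, ∀ v, c * ‖v‖ ≤ ‖B p v‖)
    {r : P → E →L[ℝ] ℝ} (hr : ContDiff ℝ ∞ r) (hr0 : ∀ p ∉ S, r p = 0) :
    ContDiff ℝ ∞ (fun p => (B p).inverse (r p)) ∧
    ∀ p ∈ S, B p ((B p).inverse (r p)) = r p ∧ ∀ h, fderiv ℝ B p h ((B p).inverse (r p)) +
      B p (fderiv ℝ (fun p => (B p).inverse (r p)) p h) = fderiv ℝ r p h := by
  have hat : ∀ p ∈ S, ContDiffAt ℝ ∞ (fun p => (B p).inverse (r p)) p := by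
    intro p hp
    obtain ⟨e, he⟩ := exists_continuousLinearEquiv_of_mul_norm_le hc (hBc p hp)
    have h1 : ContDiffAt ℝ ∞ B p := hB.contDiffAt (hO.mem_nhds (hSO hp))
    have h2 : ContDiffAt ℝ ∞ ContinuousLinearMap.inverse (B p) := he ▸ contDiffAt_map_inverse e
    exact (h2.comp p h1).clm_apply hr.contDiffAt
  refine ⟨contDiff_iff_contDiffAt.2 fun p => ?_, fun p hp => ?_⟩
  · by_cases hp : p ∈ S
    · exact hat p hp
    -- The right hand side vanishes near a point outside the closed set `S`. As `inverse` is linear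
    -- even when `B q` is not invertible, the solution is zero there.
    · refine (contDiffAt_const (c := (0 : E))).congr_of_eventuallyEq ?_
      filter_upwards [hS.isOpen_compl.mem_nhds hp] with q hq
      rw [hr0 q hq, map_zero]
  · obtain ⟨e, he⟩ := exists_continuousLinearEquiv_of_mul_norm_le hc (hBc p hp)
    have h1 : ContDiffAt ℝ ∞ B p := hB.contDiffAt (hO.mem_nhds (hSO hp))
    -- Invertibility is an open condition, so the equation holds in a neighbourhood of `p` and may
    -- be differentiated.
    have hev : ∀ᶠ q in 𝓝 p, B q ((B q).inverse (r q)) = r q := by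
      have h2 : range ((↑) : (E ≃L[ℝ] (E →L[ℝ] ℝ)) → E →L[ℝ] E →L[ℝ] ℝ) ∈ 𝓝 (B p) :=
        he ▸ ContinuousLinearEquiv.nhds e
      filter_upwards [h1.continuousAt h2] with q hq
      obtain ⟨e', he'⟩ := hq
      rw [← he', ContinuousLinearMap.inverse_equiv]
      simp
    refine ⟨hev.self_of_nhds, fun h => ?_⟩
    have hdB : HasFDerivAt B (fderiv ℝ B p) p := (h1.differentiableAt (by simp)).hasFDerivAt
    have hdv := ((hat p hp).differentiableAt (by simp)).hasFDerivAt
    have h3 := hdB.clm_apply hdv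
    have h4 := (h3.congr_of_eventuallyEq (hev.mono fun q hq => hq.symm)).fderiv
    rw [h4]
    simp [add_comm]

end MoserField

/-! ### The infinitesimal form of Moser's argument -/

section MoserEuclidean

universe u

variable {E : Type u} [NormedAddCommGroup E] [NormedSpace ℝ E]

/-- The antisymmetrization `A ↦ A(p, q) - A(q, p)` of bilinear forms. -/
def antisymmL (E : Type u) [NormedAddCommGroup E] [NormedSpace ℝ E] :
    (E →L[ℝ] E →L[ℝ] ℝ) →L[ℝ] (E →L[ℝ] E →L[ℝ] ℝ) :=
  ContinuousLinearMap.id ℝ _ -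
    ((ContinuousLinearMap.flipₗᵢ ℝ E E ℝ).toContinuousLinearEquiv :
      (E →L[ℝ] E →L[ℝ] ℝ) →L[ℝ] (E →L[ℝ] E →L[ℝ] ℝ))

@[simp] lemma antisymmL_apply (A : E →L[ℝ] E →L[ℝ] ℝ) (p q : E) :
    antisymmL E A p q = A p q - A q p := rfl

lemma norm_antisymmL_le (A : E →L[ℝ] E →L[ℝ] ℝ) : ‖antisymmL E A‖ ≤ 2 * ‖A‖ := by
  have h : antisymmL E A = A - A.flip := rfl
  rw [h]
  refine (norm_sub_le A A.flip).trans ?_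
  rw [ContinuousLinearMap.opNorm_flip]
  linarith

/-- The exterior derivative of a 1-form, as a bilinear form. -/
def extDerivOne (θ : E → E →L[ℝ] ℝ) (y : E) : E →L[ℝ] E →L[ℝ] ℝ := antisymmL E (fderiv ℝ θ y)

lemma contDiff_extDerivOne {θ : E → E →L[ℝ] ℝ} (hθ : ContDiff ℝ ∞ θ) :
    ContDiff ℝ ∞ (extDerivOne θ) :=
  (antisymmL E).contDiff.comp (hθ.fderiv_right (m := ∞) (by simp))

lemma fderiv_extDerivOne {θ : E → E →L[ℝ] ℝ} (hθ : ContDiff ℝ ∞ θ) (y : E) :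
    fderiv ℝ (extDerivOne θ) y = (antisymmL E).comp (fderiv ℝ (fderiv ℝ θ) y) := by
  have h : ContDiff ℝ ∞ (fderiv ℝ θ) := hθ.fderiv_right (by simp)
  have h1 : HasFDerivAt (antisymmL E) (antisymmL E) (fderiv ℝ θ y) := (antisymmL E).hasFDerivAt
  exact (HasFDerivAt.comp y h1 (h.differentiable (by simp) y).hasFDerivAt).fderiv

/-- The exterior derivative of a 1-form is closed. -/
lemma fderiv_extDerivOne_cyclic {θ : E → E →L[ℝ] ℝ} (hθ : ContDiff ℝ ∞ θ) (y u p q : E) :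
    fderiv ℝ (extDerivOne θ) y u p q + fderiv ℝ (extDerivOne θ) y p q u +
      fderiv ℝ (extDerivOne θ) y q u p = 0 := by
  have hs : IsSymmSndFDerivAt ℝ θ y := hθ.contDiffAt.isSymmSndFDerivAt
    (by rw [minSmoothness_of_isRCLikeNormedField]; exact ENat.LEInfty.out)
  simp only [fderiv_extDerivOne hθ, ContinuousLinearMap.comp_apply, antisymmL_apply]
  rw [hs u p, hs p q, hs q u]
  ring

/-- The path `t ↦ a + sin t · dθ` of 2-forms. -/
def moserPath (a : E → E →L[ℝ] E →L[ℝ] ℝ) (θ : E → E →L[ℝ] ℝ) (p : ℝ × E) : E →L[ℝ] E →L[ℝ] ℝ :=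
  a p.2 + Real.sin p.1 • extDerivOne θ p.2

/-- The right hand side of the equation for the vector field that generates the isotopy. -/
def moserRhs (θ : E → E →L[ℝ] ℝ) (p : ℝ × E) : E →L[ℝ] ℝ := -Real.cos p.1 • θ p.2

/-- The vector field that generates the isotopy. -/
def moserField (a : E → E →L[ℝ] E →L[ℝ] ℝ) (θ : E → E →L[ℝ] ℝ) (p : ℝ × E) : E :=
  (moserPath a θ p).inverse (moserRhs θ p)

lemma hasFDerivAt_moserPath {a : E → E →L[ℝ] E →L[ℝ] ℝ} {θ : E → E →L[ℝ] ℝ} {p : ℝ × E}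
    (ha : DifferentiableAt ℝ a p.2) (hθ : ContDiff ℝ ∞ θ) :
    HasFDerivAt (moserPath a θ) ((fderiv ℝ a p.2).comp (ContinuousLinearMap.snd ℝ ℝ E) +
      (Real.sin p.1 • (fderiv ℝ (extDerivOne θ) p.2).comp (ContinuousLinearMap.snd ℝ ℝ E) +
        (Real.cos p.1 • ContinuousLinearMap.fst ℝ ℝ E).smulRight (extDerivOne θ p.2))) p := by
  have h1 : HasFDerivAt (fun p : ℝ × E => a p.2)
      ((fderiv ℝ a p.2).comp (ContinuousLinearMap.snd ℝ ℝ E)) p :=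
    HasFDerivAt.comp (g := a) (f := Prod.snd) p ha.hasFDerivAt hasFDerivAt_snd
  have h2 : HasFDerivAt (fun p : ℝ × E => extDerivOne θ p.2) _ p :=
    (((contDiff_extDerivOne hθ).differentiable (by simp)) p.2).hasFDerivAt.comp p hasFDerivAt_snd
  have h3 : HasFDerivAt (fun p : ℝ × E => Real.sin p.1) (Real.cos p.1 •
      ContinuousLinearMap.fst ℝ ℝ E) p := (hasFDerivAt_fst (p := p)).sin
  exact h1.add (h3.smul h2)

lemma hasFDerivAt_moserRhs {θ : E → E →L[ℝ] ℝ} (hθ : ContDiff ℝ ∞ θ) (p : ℝ × E) :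
    HasFDerivAt (moserRhs θ) (-Real.cos p.1 • (fderiv ℝ θ p.2).comp (ContinuousLinearMap.snd ℝ ℝ E) +
        (Real.sin p.1 • ContinuousLinearMap.fst ℝ ℝ E).smulRight (θ p.2)) p := by
  have h2 : HasFDerivAt (fun p : ℝ × E => θ p.2) _ p :=
    ((hθ.differentiable (by simp)) p.2).hasFDerivAt.comp p hasFDerivAt_snd
  have h3 : HasFDerivAt (fun p : ℝ × E => -Real.cos p.1) (Real.sin p.1 •
      ContinuousLinearMap.fst ℝ ℝ E) p := by
    have h4 : HasFDerivAt (fun p : ℝ × E => -Real.cos p.1) _ p :=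
      (hasFDerivAt_fst (𝕜 := ℝ) (p := p)).cos.neg
    rwa [neg_smul (Real.sin p.1), neg_neg] at h4
  exact h3.smul h2

variable [FiniteDimensional ℝ E]

/-- The pointwise identity behind the invariance of the path of forms under the flow: `dω/dt + L_v ω = 0`. -/
lemma moser_identity {K O : Set E} (hK : IsCompact K) (hO : IsOpen O) (hKO : K ⊆ O)
    {a : E → E →L[ℝ] E →L[ℝ] ℝ} (ha : ContDiffOn ℝ ∞ a O)
    (hskew : ∀ y ∈ O, ∀ p q, a y p q = -a y q p)
    (hclosed : ∀ y ∈ O, ∀ u p q,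
      fderiv ℝ a y u p q + fderiv ℝ a y p q u + fderiv ℝ a y q u p = 0)
    {θ : E → E →L[ℝ] ℝ} (hθ : ContDiff ℝ ∞ θ) (hθ0 : ∀ y ∉ K, θ y = 0)
    {c : ℝ} (hc : 0 < c) (hB : ∀ t, ∀ y ∈ K, ∀ w, c * ‖w‖ ≤ ‖moserPath a θ (t, y) w‖) :
    ContDiff ℝ ∞ (moserField a θ) ∧ ∀ t, ∀ y ∈ K,
      moserPath a θ (t, y) (moserField a θ (t, y)) = moserRhs θ (t, y) ∧
      (∀ h, moserPath a θ (t, y) (fderiv ℝ (moserField a θ) (t, y) (0, h)) =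
        -Real.cos t • fderiv ℝ θ y h - (fderiv ℝ a y h + Real.sin t • fderiv ℝ (extDerivOne θ) y h)
          (moserField a θ (t, y))) ∧
      ∀ p q, fderiv ℝ (moserPath a θ) (t, y) (1, moserField a θ (t, y)) p q +
        moserPath a θ (t, y) (fderiv ℝ (moserField a θ) (t, y) (0, p)) q +
        moserPath a θ (t, y) p (fderiv ℝ (moserField a θ) (t, y) (0, q)) = 0 := by
  have hPath : ContDiffOn ℝ ∞ (moserPath a θ) (univ ×ˢ O) := by
    refine ContDiffOn.add (ha.comp contDiffOn_snd fun p hp => hp.2) (ContDiff.contDiffOn ?_)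
    have h1 : ContDiff ℝ ∞ fun p : ℝ × E => Real.sin p.1 := Real.contDiff_sin.comp contDiff_fst
    have h2 : ContDiff ℝ ∞ fun p : ℝ × E => extDerivOne θ p.2 :=
      (contDiff_extDerivOne hθ).comp contDiff_snd
    exact h1.smul h2
  have hRhs : ContDiff ℝ ∞ (moserRhs θ) :=
    (Real.contDiff_cos.comp contDiff_fst).neg.smul (hθ.comp contDiff_snd)
  obtain ⟨hs, hpt⟩ := contDiff_inverse_apply (S := univ ×ˢ K) (O := univ ×ˢ O)
    (isClosed_univ.prod hK.isClosed) (isOpen_univ.prod hO) (prod_mono subset_rfl hKO) hPath hc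
    (fun p hp => hB p.1 p.2 hp.2) hRhs (fun p hp => by
      have : p.2 ∉ K := fun h => hp ⟨trivial, h⟩
      simp [moserRhs, hθ0 _ this])
  change ContDiff ℝ ∞ (moserField a θ) at hs
  refine ⟨hs, fun t y hy => ?_⟩
  obtain ⟨h1, h2⟩ := hpt (t, y) ⟨trivial, hy⟩
  have hd := hasFDerivAt_moserPath (p := (t, y))
    ((ha.contDiffAt (hO.mem_nhds (hKO hy))).differentiableAt (by simp)) hθ
  have hdr := hasFDerivAt_moserRhs hθ (t, y)
  have h3 : ∀ h, moserPath a θ (t, y) (fderiv ℝ (moserField a θ) (t, y) (0, h)) =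
        -Real.cos t • fderiv ℝ θ y h - (fderiv ℝ a y h + Real.sin t • fderiv ℝ (extDerivOne θ) y h)
          (moserField a θ (t, y)) := by
    intro h
    have h4 : fderiv ℝ (moserPath a θ) (t, y) (0, h) (moserField a θ (t, y)) +
        moserPath a θ (t, y) (fderiv ℝ (moserField a θ) (t, y) (0, h)) =
          fderiv ℝ (moserRhs θ) (t, y) (0, h) := h2 (0, h)
    rw [hd.fderiv, hdr.fderiv] at h4
    rw [eq_sub_iff_add_eq, add_comm]
    simpa using h4
  refine ⟨h1, h3, fun p q => ?_⟩
  set w := moserField a θ (t, y) with hw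
  have hsk : ∀ p q, moserPath a θ (t, y) p q = -moserPath a θ (t, y) q p := by
    intro p q
    have h5 := hskew y (hKO hy) p q
    simp only [moserPath, extDerivOne, _root_.add_apply,
      _root_.smul_apply, antisymmL_apply, smul_eq_mul]
    rw [h5]; ring
  -- All derivatives of the field are eliminated by `h3`. The terms with `cos t` cancel by the
  -- definition of dθ; the others are the cyclic sums expressing that `a` and dθ are closed,
  -- evaluated on `w, p, q`.
  rw [hsk p, h3 p, h3 q, hd.fderiv]
  have hcl := hclosed y (hKO hy) w p q
  have hcl' := fderiv_extDerivOne_cyclic hθ y w p q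
  have hsa : ∀ u p q, fderiv ℝ a y u p q = -fderiv ℝ a y u q p := by
    intro u p q
    have hda := ((ha.contDiffAt (hO.mem_nhds (hKO hy))).differentiableAt (by simp)).hasFDerivAt
    have hz : ∀ᶠ z in 𝓝 y, a z p q = -a z q p :=
      Filter.eventually_of_mem (hO.mem_nhds (hKO hy)) fun z hz => hskew z hz p q
    have e1 := ((hda.clm_apply (hasFDerivAt_const p y)).clm_apply (hasFDerivAt_const q y))
    have e2 := ((hda.clm_apply (hasFDerivAt_const q y)).clm_apply (hasFDerivAt_const p y)).neg
    have e3 := e1.unique (e2.congr_of_eventuallyEq hz)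
    have e4 := congrArg (fun A => A u) e3
    simpa using e4
  have hsb : ∀ u p q, fderiv ℝ (extDerivOne θ) y u p q = -fderiv ℝ (extDerivOne θ) y u q p := by
    intro u p q
    simp only [fderiv_extDerivOne hθ, ContinuousLinearMap.comp_apply, antisymmL_apply]
    ring
  rw [hsa p q w] at hcl
  rw [hsb p q w] at hcl'
  simp only [_root_.add_apply, _root_.smul_apply,
    ContinuousLinearMap.comp_apply, ContinuousLinearMap.smulRight_apply,
    ContinuousLinearMap.coe_fst', ContinuousLinearMap.coe_snd', smul_eq_mul,
    _root_.sub_apply, extDerivOne, antisymmL_apply, mul_one] at hcl hcl' ⊢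
  linear_combination hcl + Real.sin t * hcl'

end MoserEuclidean

/-! ### Moser's isotopy in Euclidean space -/

section MoserIsotopy

universe u

variable {E : Type u} [NormedAddCommGroup E] [NormedSpace ℝ E] [FiniteDimensional ℝ E]

/-- Moser's isotopy in a chart, under explicit bounds: there is a diffeomorphism, supported in `K`,
that pulls back `a + dθ` to `a`. -/
theorem exists_diffeo_pullback_eq_of_bounds {K O : Set E} (hK : IsCompact K) (hO : IsOpen O)
    (hKO : K ⊆ O) {a : E → E →L[ℝ] E →L[ℝ] ℝ} (ha : ContDiffOn ℝ ∞ a O)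
    (hskew : ∀ y ∈ O, ∀ p q, a y p q = -a y q p)
    (hclosed : ∀ y ∈ O, ∀ u p q,
      fderiv ℝ a y u p q + fderiv ℝ a y p q u + fderiv ℝ a y q u p = 0)
    {θ : E → E →L[ℝ] ℝ} (hθ : ContDiff ℝ ∞ θ) (hθ0 : ∀ y ∉ K, θ y = 0)
    {c M δ : ℝ} (hc : 0 < c) (hM : 0 ≤ M) (hδ : 0 ≤ δ)
    (hB : ∀ t, ∀ y ∈ K, ∀ w, c * ‖w‖ ≤ ‖moserPath a θ (t, y) w‖)
    (hBM : ∀ t : ℝ, ∀ y ∈ K, ‖fderiv ℝ a y + Real.sin t • fderiv ℝ (extDerivOne θ) y‖ ≤ M)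
    (hθδ : ∀ y ∈ K, ‖θ y‖ ≤ δ ∧ ‖fderiv ℝ θ y‖ ≤ δ) (hsmall : (1 + M / c) * δ / c ≤ 1 / 8) :
    ∃ φ : E ≃ₜ E, ContDiff ℝ ∞ φ ∧ (∀ y ∉ K, φ y = y) ∧ (∀ y, ‖φ y - y‖ ≤ 2 * (δ / c)) ∧
      ∀ y ∈ O, ∀ p q, a (φ y) (fderiv ℝ φ y p) (fderiv ℝ φ y q) +
        extDerivOne θ (φ y) (fderiv ℝ φ y p) (fderiv ℝ φ y q) = a y p q := by
  obtain ⟨hvs, hid⟩ := moser_identity hK hO hKO ha hskew hclosed hθ hθ0 hc hB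
  set v := moserField a θ with hv
  have hv0 : ∀ t, ∀ y ∉ K, v (t, y) = 0 := fun t y hy => by
    simp [hv, moserField, moserRhs, hθ0 y hy]
  have hvb : ∀ t y, ‖v (t, y)‖ ≤ δ / c := by
    intro t y
    by_cases hy : y ∈ K
    · rw [le_div_iff₀' hc]
      refine (hB t y hy _).trans ?_
      rw [(hid t y hy).1, moserRhs, norm_smul]
      have h1 : ‖-Real.cos t‖ ≤ 1 := by simpa using Real.abs_cos_le_one t
      calc ‖-Real.cos t‖ * ‖θ y‖ ≤ 1 * δ := by gcongr; exact (hθδ y hy).1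
        _ = δ := one_mul _
    · rw [hv0 t y hy, norm_zero]; positivity
  -- By the differentiated equation, `c` times the norm of the derivative in direction `h` is at
  -- most `(δ + M · δ / c) ‖h‖`.
  have hvd : ∀ t y, ‖(fderiv ℝ v (t, y)).comp (ContinuousLinearMap.inr ℝ ℝ E)‖ ≤ 1 / 8 := by
    intro t y
    by_cases hy : y ∈ K
    · refine ContinuousLinearMap.opNorm_le_bound _ (by norm_num) fun h => ?_
      have h2 := (hid t y hy).2.1 h
      have h3 := hB t y hy (fderiv ℝ v (t, y) (0, h))
      rw [h2] at h3
      have h4 : ‖-Real.cos t • fderiv ℝ θ y h‖ ≤ δ * ‖h‖ := by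
        rw [norm_smul]
        have h1 : ‖-Real.cos t‖ ≤ 1 := by simpa using Real.abs_cos_le_one t
        calc ‖-Real.cos t‖ * ‖fderiv ℝ θ y h‖ ≤ 1 * (δ * ‖h‖) := by
              gcongr; exact (fderiv ℝ θ y).le_of_opNorm_le (hθδ y hy).2 h
          _ = _ := one_mul _
      have h5 : ‖(fderiv ℝ a y h + Real.sin t • fderiv ℝ (extDerivOne θ) y h) (v (t, y))‖ ≤
          M * ‖h‖ * (δ / c) := by
        have h6 : ‖fderiv ℝ a y h + Real.sin t • fderiv ℝ (extDerivOne θ) y h‖ ≤ M * ‖h‖ :=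
          (fderiv ℝ a y + Real.sin t • fderiv ℝ (extDerivOne θ) y).le_of_opNorm_le (hBM t y hy) h
        exact ContinuousLinearMap.le_of_opNorm_le_of_le _ h6 (hvb t y)
      have h7 := h3.trans ((norm_sub_le _ _).trans (add_le_add h4 h5))
      have h8 : ‖fderiv ℝ v (t, y) (0, h)‖ ≤ (1 + M / c) * δ / c * ‖h‖ := by
        rw [← le_div_iff₀' hc] at h7
        refine h7.trans (le_of_eq ?_)
        field_simp
      exact h8.trans (mul_le_mul_of_nonneg_right hsmall (norm_nonneg h))
    · have h1 : HasFDerivAt (fun z => v (t, z))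
          ((fderiv ℝ v (t, y)).comp (ContinuousLinearMap.inr ℝ ℝ E)) y :=
        HasFDerivAt.comp (g := v) y ((hvs.differentiable (by simp)) (t, y)).hasFDerivAt
          (hasFDerivAt_prodMk_right t y)
      have h2 : (fun z => v (t, z)) =ᶠ[𝓝 y] fun _ => 0 := by
        filter_upwards [hK.isClosed.isOpen_compl.mem_nhds hy] with z hz using hv0 t z hz
      have h3 := h1.unique ((hasFDerivAt_const (0 : E) y).congr_of_eventuallyEq h2)
      rw [h3, norm_zero]
      norm_num
  have hl : ∀ t x y, ‖v (t, x) - v (t, y)‖ ≤ 1 / 8 * ‖x - y‖ := by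
    intro t x y
    have h1 : ∀ z ∈ (univ : Set E), HasFDerivWithinAt (fun z => v (t, z))
        ((fderiv ℝ v (t, z)).comp (ContinuousLinearMap.inr ℝ ℝ E)) univ z := fun z _ =>
      (HasFDerivAt.comp (g := v) z ((hvs.differentiable (by simp)) (t, z)).hasFDerivAt
          (hasFDerivAt_prodMk_right t z)).hasFDerivWithinAt
    exact convex_univ.norm_image_sub_le_of_norm_hasFDerivWithin_le h1 (fun z _ => hvd t z)
      (mem_univ y) (mem_univ x)
  obtain ⟨Φ, hΦs, hΦ, hdΦ, hΦl⟩ := exists_smooth_flow hvs hl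
  have hflow : ∀ x t, Φ x t = x + ∫ s in (0 : ℝ)..t, v (timeProj s, Φ x (timeProj s)) := by
    intro x t
    have h := (hΦ x (Φ x)).2 rfl
    conv_lhs => rw [h]
    rfl
  have hdflow : ∀ x h t, fderiv ℝ Φ x h t = h + ∫ s in (0 : ℝ)..t,
      fderiv ℝ v (timeProj s, Φ x (timeProj s)) (0, fderiv ℝ Φ x h (timeProj s)) := by
    intro x h t
    have h1 := hdΦ x h
    conv_lhs => rw [h1]
    change h + _ = _
    rw [volterra_apply]
    congr 1
    refine intervalIntegral.integral_congr fun s _ => ?_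
    exact fderiv_velocity_apply hvs _ _ _
  have hfix : ∀ x ∉ K, Φ x = ContinuousMap.const _ x := by
    intro x hx
    refine ((hΦ x _).1 ?_).symm
    ext t
    change x = x + volterra E _ t
    rw [volterra_apply]
    have : ∀ s, velocity hvs.continuous (ContinuousMap.const _ x) (timeProj s) = 0 :=
      fun s => hv0 _ x hx
    simp [this]
  -- The time-`t` map differs from the identity by a 1/2-Lipschitz map, so two points with the same
  -- image have distance at most half their distance.
  have hinj : ∀ t, Function.Injective fun x => Φ x t := by
    intro t x y hxy
    have h1 := (hΦl t).dist_le_mul x y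
    simp only [dist_eq_norm] at hxy h1
    rw [hxy, show Φ y t - x - (Φ y t - y) = -(x - y) by abel, norm_neg] at h1
    push_cast at h1
    exact sub_eq_zero.1 (norm_eq_zero.1 (by linarith [norm_nonneg (x - y)]))
  -- Points outside `K` are fixed. If `Φ x t` were outside, `x` and `Φ x t` would have the same
  -- image at time `t`, against injectivity.
  have hstay : ∀ x ∈ K, ∀ t, Φ x t ∈ K := by
    intro x hx t
    by_contra h
    have h1 : Φ (Φ x t) t = Φ x t := by rw [hfix _ h]; rfl
    exact h (by rw [hinj t h1]; exact hx)
  -- The isotopy ends at π/2, where the sine is 1 and the path of forms reaches `a + dθ`; the time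
  -- interval [0, 2] is chosen to contain it.
  have hpi2 : Real.pi / 2 ∈ Icc (0 : ℝ) 2 :=
    ⟨by positivity, by linarith [Real.pi_le_four]⟩
  let T : TimeInterval := ⟨Real.pi / 2, hpi2⟩
  let ev : C(TimeInterval, E) →L[ℝ] E := ContinuousMap.evalCLM ℝ T
  have hφs : ContDiff ℝ ∞ fun x => Φ x T := ev.contDiff.comp hΦs
  obtain ⟨φ, hφ, -⟩ := exists_homeomorph_of_lipschitzWith_sub_id hφs (hΦl T)
  have hφd : ∀ x h, fderiv ℝ φ x h = fderiv ℝ Φ x h T := by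
    intro x h
    have h1 : HasFDerivAt (fun x => Φ x T) (ev.comp (fderiv ℝ Φ x)) x :=
      HasFDerivAt.comp (g := ev) x ev.hasFDerivAt ((hΦs.differentiable (by simp)) x).hasFDerivAt
    rw [hφ, h1.fderiv]
    rfl
  refine ⟨φ, hφ ▸ hφs, fun y hy => ?_, fun y => ?_, fun y hy p q => ?_⟩
  · rw [hφ]
    change Φ y T = y
    rw [hfix y hy]; rfl
  · rw [hφ]
    change ‖Φ y T - y‖ ≤ _
    rw [hflow y T, add_sub_cancel_left]
    refine (intervalIntegral.norm_integral_le_of_norm_le_const (fun s _ => hvb _ _)).trans ?_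
    rw [sub_zero, abs_of_nonneg hpi2.1, mul_comm]
    exact mul_le_mul_of_nonneg_right hpi2.2 (by positivity)
  · by_cases hyK : y ∈ K
    -- The integral formulas extend the trajectory and its variations to all real times, so that
    -- derivatives are two-sided also at the ends of the time interval.
    · let γ : ℝ → E := fun t => y + ∫ s in (0 : ℝ)..t, v (timeProj s, Φ y (timeProj s))
      let ξ : E → ℝ → E := fun h t => h + ∫ s in (0 : ℝ)..t,
        fderiv ℝ v (timeProj s, Φ y (timeProj s)) (0, fderiv ℝ Φ y h (timeProj s))
      have hγ : ∀ t, HasDerivAt γ (v (timeProj t, Φ y (timeProj t))) t := by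
        intro t
        have hcont : Continuous fun s => v (timeProj s, Φ y (timeProj s)) :=
          (velocity hvs.continuous (Φ y)).continuous.comp continuous_timeProj
        exact (hcont.integral_hasStrictDerivAt 0 t).hasDerivAt.const_add y
      have hξ : ∀ h t, HasDerivAt (ξ h)
          (fderiv ℝ v (timeProj t, Φ y (timeProj t)) (0, fderiv ℝ Φ y h (timeProj t))) t := by
        intro h t
        have hcont : Continuous fun s =>
            fderiv ℝ v (timeProj s, Φ y (timeProj s)) (0, fderiv ℝ Φ y h (timeProj s)) := by
          have h1 := (fderiv ℝ (velocity hvs.continuous) (Φ y) (fderiv ℝ Φ y h)).continuous.comp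
            continuous_timeProj
          refine h1.congr fun s => ?_
          exact fderiv_velocity_apply hvs _ _ _
        exact (hcont.integral_hasStrictDerivAt 0 t).hasDerivAt.const_add h
      have hγt : ∀ t : TimeInterval, γ t = Φ y t := fun t => (hflow y t).symm
      have hξt : ∀ h (t : TimeInterval), ξ h t = fderiv ℝ Φ y h t := fun h t => (hdflow y h t).symm
      -- The pulled back path of forms, evaluated on `p, q`: it starts at `a y p q`, ends at the
      -- pullback of `a + dθ`, and is constant by the infinitesimal identity.
      let f : ℝ → ℝ := fun t => moserPath a θ (t, γ t) (ξ p t) (ξ q t)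
      have hf : ∀ t ∈ Icc (0 : ℝ) 2, HasDerivAt f 0 t := by
        intro t ht
        have hp1 : (timeProj t : ℝ) = t := timeProj_of_mem ht
        have hp2 : Φ y (timeProj t) = γ t := by rw [← hγt, hp1]
        have hp3 : ∀ h, fderiv ℝ Φ y h (timeProj t) = ξ h t := fun h => by rw [← hξt, hp1]
        have hmem : γ t ∈ K := hp2 ▸ hstay y hyK _
        have hd : HasFDerivAt (moserPath a θ) (fderiv ℝ (moserPath a θ) (t, γ t)) (t, γ t) :=
          (hasFDerivAt_moserPath (p := (t, γ t))
            ((ha.contDiffAt (hO.mem_nhds (hKO hmem))).differentiableAt (by simp))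
            hθ).differentiableAt.hasFDerivAt
        have h1 := hγ t
        have h2 := hξ p t
        have h3 := hξ q t
        rw [hp1, hp2] at h1
        rw [hp1, hp2, hp3] at h2 h3
        have h4 : HasDerivAt (fun t => moserPath a θ (t, γ t))
            (fderiv ℝ (moserPath a θ) (t, γ t) (1, v (t, γ t))) t :=
          HasFDerivAt.comp_hasDerivAt (f := fun t => (t, γ t)) t hd
            ((hasDerivAt_id' t).prodMk h1)
        have h5 := (h4.clm_apply h2).clm_apply h3
        rw [_root_.add_apply, (hid t (γ t) hmem).2.2] at h5
        exact h5
      have hconst := constant_of_has_deriv_right_zero (f := f) (a := 0) (b := 2)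
        (fun t ht => (hf t ht).continuousAt.continuousWithinAt)
        (fun t ht => (hf t ⟨ht.1, ht.2.le⟩).hasDerivWithinAt) (Real.pi / 2) hpi2
      have hf0 : f 0 = a y p q := by simp [f, γ, ξ, moserPath]
      have hf1 : f (Real.pi / 2) = a (φ y) (fderiv ℝ φ y p) (fderiv ℝ φ y q) +
          extDerivOne θ (φ y) (fderiv ℝ φ y p) (fderiv ℝ φ y q) := by
        have e1 : γ (Real.pi / 2) = φ y := by rw [hφ]; exact hγt T
        have e2 : ∀ h, ξ h (Real.pi / 2) = fderiv ℝ φ y h := fun h => by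
          rw [hφd]; exact hξt h T
        simp [f, e1, e2, moserPath]
      rw [← hf1, hconst, hf0]
    -- Near a point outside `K` the diffeomorphism is the identity and `θ` vanishes.
    · have hφy : ∀ᶠ z in 𝓝 y, φ z = z := by
        filter_upwards [hK.isClosed.isOpen_compl.mem_nhds hyK] with z hz
        rw [hφ]
        change Φ z T = z
        rw [hfix z hz]; rfl
      have h1 : fderiv ℝ φ y = ContinuousLinearMap.id ℝ E :=
        ((hasFDerivAt_id y).congr_of_eventuallyEq hφy).fderiv
      have h2 : extDerivOne θ y = 0 := by
        have h3 : θ =ᶠ[𝓝 y] fun _ => 0 := by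
          filter_upwards [hK.isClosed.isOpen_compl.mem_nhds hyK] with z hz using hθ0 z hz
        have h4 : fderiv ℝ θ y = 0 := ((hasFDerivAt_const (𝕜 := ℝ) (0 : E →L[ℝ] ℝ) y).congr_of_eventuallyEq h3).fderiv
        rw [extDerivOne, h4]
        exact map_zero (antisymmL E)
      rw [h1, hφy.self_of_nhds, h2]
      simp

/-- Moser's isotopy in a chart: if `a` is `C¹`-close to a given nondegenerate form on the compact
set `K`, and the 1-form `θ`, supported in `K`, is `C²`-small, then there is a diffeomorphism,
supported in `K` and `C⁰`-close to the identity, that pulls back `a + dθ` to `a`. -/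
theorem exists_diffeo_pullback_eq {K O : Set E} (hK : IsCompact K) (hO : IsOpen O)
    (hKO : K ⊆ O) {η : E → E →L[ℝ] E →L[ℝ] ℝ} (hη : ContDiffOn ℝ ∞ η O)
    (hnd : ∀ y ∈ K, ∀ p, η y p = 0 → p = 0) {ε : ℝ} (hε : 0 < ε) :
    ∃ δ > 0, ∀ a : E → E →L[ℝ] E →L[ℝ] ℝ, ContDiffOn ℝ ∞ a O →
      (∀ y ∈ O, ∀ p q, a y p q = -a y q p) →
      (∀ y ∈ O, ∀ u p q,
        fderiv ℝ a y u p q + fderiv ℝ a y p q u + fderiv ℝ a y q u p = 0) →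
      (∀ y ∈ K, ‖a y - η y‖ ≤ δ ∧ ‖fderiv ℝ a y - fderiv ℝ η y‖ ≤ δ) →
      ∀ θ : E → E →L[ℝ] ℝ, ContDiff ℝ ∞ θ → (∀ y ∉ K, θ y = 0) →
      (∀ y ∈ K, ‖θ y‖ ≤ δ ∧ ‖fderiv ℝ θ y‖ ≤ δ ∧ ‖fderiv ℝ (fderiv ℝ θ) y‖ ≤ δ) →
      ∃ φ : E ≃ₜ E, ContDiff ℝ ∞ φ ∧ (∀ y ∉ K, φ y = y) ∧ (∀ y, ‖φ y - y‖ ≤ ε) ∧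
        ∀ y ∈ O, ∀ p q, a (φ y) (fderiv ℝ φ y p) (fderiv ℝ φ y q) +
          extDerivOne θ (φ y) (fderiv ℝ φ y p) (fderiv ℝ φ y q) = a y p q := by
  obtain ⟨c, hc, hcB⟩ := exists_forall_mul_norm_le_of_nondegenerate hK
    (hη.continuousOn.mono hKO) hnd
  obtain ⟨M, hM⟩ := hK.exists_bound_of_continuousOn
    ((hη.continuousOn_fderiv_of_isOpen hO (by simp)).mono hKO)
  set M' : ℝ := |M| + 3 with hM'
  have hM'0 : 0 ≤ M' := by positivity
  set k : ℝ := (1 + M' / (c / 2)) / (c / 2) with hk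
  have hk0 : 0 < k := by positivity
  -- The bound `1` keeps the first derivatives of the path below `|M| + 3`; `c / 6` keeps the path
  -- within `3 δ ≤ c / 2` of `η`, so that half of the lower bound `c` survives; `1 / 8 / k` makes
  -- the Lipschitz constant 1/8; the last bound makes the displacement `2 δ / (c / 2)` at most `ε`.
  refine ⟨min (min 1 (c / 6)) (min (1 / 8 / k) (ε / 2 * (c / 2))), by positivity,
    fun a ha hskew hcl hclose θ hθ hθ0 hθs => ?_⟩
  set δ := min (min 1 (c / 6)) (min (1 / 8 / k) (ε / 2 * (c / 2))) with hδ
  have hδ0 : 0 < δ := by positivity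
  have hδ1 : δ ≤ 1 := (min_le_left _ _).trans (min_le_left _ _)
  have hδ2 : δ ≤ c / 6 := (min_le_left _ _).trans (min_le_right _ _)
  have hδ3 : δ ≤ 1 / 8 / k := (min_le_right _ _).trans (min_le_left _ _)
  have hδ4 : δ ≤ ε / 2 * (c / 2) := (min_le_right _ _).trans (min_le_right _ _)
  -- As the sine is bounded on the whole line, the path stays near `η` for all real times and the
  -- field needs no cutoff in time.
  have hsin : ∀ t : ℝ, ‖Real.sin t‖ ≤ 1 := fun t => by simpa using Real.abs_sin_le_one t
  have key := exists_diffeo_pullback_eq_of_bounds hK hO hKO ha hskew hcl hθ hθ0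
    (c := c / 2) (M := M') (δ := δ) (by positivity) hM'0 hδ0.le
  obtain ⟨φ, h1, h2, h3, h4⟩ := key (by
    intro t y hy w
    have e1 : ‖moserPath a θ (t, y) - η y‖ ≤ c / 2 := by
      have : moserPath a θ (t, y) - η y = (a y - η y) + Real.sin t • extDerivOne θ y := by
        simp only [moserPath]; abel
      rw [this]
      refine (norm_add_le _ _).trans ?_
      have e2 : ‖Real.sin t • extDerivOne θ y‖ ≤ 1 * (2 * δ) := by
        rw [norm_smul]
        gcongr
        · exact hsin t
        · exact (norm_antisymmL_le _).trans (by gcongr; exact (hθs y hy).2.1)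
      linarith [(hclose y hy).1]
    have e3 := hcB y hy w
    have e4 : ‖η y w‖ ≤ ‖moserPath a θ (t, y) w‖ + c / 2 * ‖w‖ := by
      have e5 := ContinuousLinearMap.le_of_opNorm_le _ e1 w
      have e6 : η y w = moserPath a θ (t, y) w - (moserPath a θ (t, y) - η y) w := by simp
      rw [e6]
      exact (norm_sub_le _ _).trans (by gcongr)
    linarith) (by
    intro t y hy
    have e1 : fderiv ℝ a y + Real.sin t • fderiv ℝ (extDerivOne θ) y =
      fderiv ℝ η y + ((fderiv ℝ a y - fderiv ℝ η y) +
        Real.sin t • fderiv ℝ (extDerivOne θ) y) := by abel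
    have e2 : ‖Real.sin t • fderiv ℝ (extDerivOne θ) y‖ ≤ 1 * (2 * δ) := by
      rw [norm_smul]
      gcongr
      · exact hsin t
      · rw [fderiv_extDerivOne hθ]
        refine ContinuousLinearMap.opNorm_le_bound _ (by positivity) fun h => ?_
        refine (norm_antisymmL_le _).trans ?_
        rw [mul_assoc]
        gcongr
        exact ContinuousLinearMap.le_of_opNorm_le _ (hθs y hy).2.2 h
    rw [e1]
    refine (norm_add_le _ _).trans ?_
    have e3 := norm_add_le (fderiv ℝ a y - fderiv ℝ η y) (Real.sin t • fderiv ℝ (extDerivOne θ) y)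
    linarith [hM y hy, le_abs_self M, (hclose y hy).2]) (fun y hy => ⟨(hθs y hy).1, (hθs y hy).2.1⟩) (by
    have e1 : (1 + M' / (c / 2)) * δ / (c / 2) = k * δ := by rw [hk]; ring
    rw [e1, mul_comm]
    exact (le_div_iff₀ hk0).1 hδ3)
  refine ⟨φ, h1, h2, fun y => (h3 y).trans ?_, h4⟩
  have : δ / (c / 2) ≤ ε / 2 := (div_le_iff₀ (by positivity)).2 hδ4
  linarith

end MoserIsotopy

/-! ### Smoothness of the pullback of alternating maps -/

section AlternatingMaps

variable {E F : Type*} [NormedAddCommGroup E] [NormedSpace ℝ E] [NormedAddCommGroup F]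
  [NormedSpace ℝ F] {k : ℕ}

instance ContinuousMultilinearMap.finiteDimensional [FiniteDimensional ℝ E] :
    FiniteDimensional ℝ (ContinuousMultilinearMap ℝ (fun _ : Fin k => E) ℝ) := by
  let L : ContinuousMultilinearMap ℝ (fun _ : Fin k => E) ℝ →ₗ[ℝ]
      MultilinearMap ℝ (fun _ : Fin k => E) ℝ :=
    { toFun := fun f => f.toMultilinearMap
      map_add' := fun _ _ => rfl
      map_smul' := fun _ _ => rfl }
  refine FiniteDimensional.of_injective L fun f g h => ?_
  ext v
  exact congrArg (fun m : MultilinearMap ℝ (fun _ : Fin k => E) ℝ => m v) h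

instance ContinuousAlternatingMap.finiteDimensional [FiniteDimensional ℝ E] :
    FiniteDimensional ℝ (E [⋀^Fin k]→L[ℝ] ℝ) := by
  let L : (E [⋀^Fin k]→L[ℝ] ℝ) →ₗ[ℝ] MultilinearMap ℝ (fun _ : Fin k => E) ℝ :=
    { toFun := fun f => f.toContinuousMultilinearMap.toMultilinearMap
      map_add' := fun _ _ => rfl
      map_smul' := fun _ _ => rfl }
  refine FiniteDimensional.of_injective L fun f g h => ?_
  ext v
  exact congrArg (fun m : MultilinearMap ℝ (fun _ : Fin k => E) ℝ => m v) h

/-- Pullback of alternating maps by linear maps depends smoothly on both arguments. -/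
theorem ContDiffAt.continuousAlternatingMapCompContinuousLinearMap [FiniteDimensional ℝ E]
    {P : Type*} [NormedAddCommGroup P] [NormedSpace ℝ P] {g : P → F [⋀^Fin k]→L[ℝ] ℝ}
    {A : P → E →L[ℝ] F} {x : P} {m : WithTop ℕ∞} (hg : ContDiffAt ℝ m g x)
    (hA : ContDiffAt ℝ m A x) :
    ContDiffAt ℝ m (fun y => (g y).compContinuousLinearMap (A y)) x := by
  -- In finite dimension the inclusion of alternating into multilinear maps has a continuous left
  -- inverse, through which smoothness is transferred back.
  obtain ⟨r, hr⟩ := ContinuousLinearMap.HasLeftInverse.of_injective_of_finiteDimensional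
    (f := (ContinuousAlternatingMap.toContinuousMultilinearMapLI (𝕜 := ℝ) (E := E) (F := ℝ)
      (ι := Fin k)).toContinuousLinearMap) (LinearIsometry.injective _)
  have h1 : ContDiffAt ℝ m (fun y =>
      ContinuousMultilinearMap.compContinuousLinearMapContinuousMultilinear ℝ (fun _ : Fin k => E) (fun _ => F) ℝ (fun _ => A y)
      (g y).toContinuousMultilinearMap) x := by
    refine ContDiffAt.clm_apply ?_ ?_
    · exact (ContinuousMultilinearMap.contDiff _).contDiffAt.comp x
        (contDiffAt_pi.2 fun _ => hA)
    · exact (ContinuousAlternatingMap.toContinuousMultilinearMapLI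
        (𝕜 := ℝ) (E := F) (F := ℝ) (ι := Fin k)).contDiff.contDiffAt.comp x hg
  have h2 := r.contDiff.contDiffAt.comp x h1
  refine h2.congr_of_eventuallyEq (Filter.Eventually.of_forall fun y => ?_)
  exact (hr _).symm

end AlternatingMaps

/-! ### Differential forms in coordinates -/

section Charts

variable {n k : ℕ} {M : Type*} [TopologicalSpace M] [ChartedSpace (Model n) M]
  {N : Type*} [TopologicalSpace N] [ChartedSpace (Model n) N]

/-- The coordinate expression of a map in the charts around `x₀` and `x₁`. -/
def chartMap (n : ℕ) {M : Type*} [TopologicalSpace M] [ChartedSpace (Model n) M]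
    {N : Type*} [TopologicalSpace N] [ChartedSpace (Model n) N] (f : N → M) (x₀ : N) (x₁ : M) :
    Model n → Model n :=
  extChartAt 𝓘(ℝ, Model n) x₁ ∘ f ∘ (extChartAt 𝓘(ℝ, Model n) x₀).symm

lemma isOpen_chartPart (x₀ : M) {W : Set M} (hW : IsOpen W) : IsOpen (chartPart n x₀ W) :=
  (continuousOn_extChartAt_symm x₀).isOpen_inter_preimage (isOpen_extChartAt_target x₀) hW

lemma extChartAt_mem_chartPart {x₀ x : M} {W : Set M} (hx : x ∈ (extChartAt 𝓘(ℝ, Model n) x₀).source)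
    (hxW : x ∈ W) : extChartAt 𝓘(ℝ, Model n) x₀ x ∈ chartPart n x₀ W :=
  ⟨(extChartAt _ x₀).map_source hx, by
    rw [mem_preimage, (extChartAt _ x₀).left_inv hx]; exact hxW⟩

variable [IsManifold 𝓘(ℝ, Model n) ∞ M] [IsManifold 𝓘(ℝ, Model n) ∞ N]

omit [IsManifold 𝓘(ℝ, Model n) ∞ M] in
lemma contMDiffAt_extChartAt_symm_of_mem {x₀ : N} {y : Model n}
    (hy : y ∈ (extChartAt 𝓘(ℝ, Model n) x₀).target) :
    ContMDiffAt 𝓘(ℝ, Model n) 𝓘(ℝ, Model n) ∞ (extChartAt 𝓘(ℝ, Model n) x₀).symm y :=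
  (contMDiffOn_extChartAt_symm x₀).contMDiffAt ((isOpen_extChartAt_target x₀).mem_nhds hy)

lemma contDiffAt_chartMap {f : N → M} {x₀ : N} {x₁ : M} {y : Model n}
    (hy : y ∈ (extChartAt 𝓘(ℝ, Model n) x₀).target)
    (hf : ContMDiffAt 𝓘(ℝ, Model n) 𝓘(ℝ, Model n) ∞ f ((extChartAt 𝓘(ℝ, Model n) x₀).symm y))
    (hfy : f ((extChartAt 𝓘(ℝ, Model n) x₀).symm y) ∈ (extChartAt 𝓘(ℝ, Model n) x₁).source) :
    ContDiffAt ℝ ∞ (chartMap n f x₀ x₁) y := by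
  rw [← contMDiffAt_iff_contDiffAt]
  rw [extChartAt_source] at hfy
  exact (contMDiffAt_extChartAt' hfy).comp y (hf.comp y (contMDiffAt_extChartAt_symm_of_mem hy))

omit [IsManifold 𝓘(ℝ, Model n) ∞ M] in
-- Tangent spaces at different points are all the model space by definition, yet `θ p` and `θ q`
-- have different types. This transports along an equality of base points while comparing the linear
-- maps in the model space.
lemma DiffForm.compContinuousLinearMap_congr (θ : DiffForm n k M) {p q : M} (h : p = q)
    {A : Model n →L[ℝ] TangentSpace 𝓘(ℝ, Model n) p}
    {B : Model n →L[ℝ] TangentSpace 𝓘(ℝ, Model n) q}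
    (hAB : (A : Model n →L[ℝ] Model n) = (B : Model n →L[ℝ] Model n)) :
    (θ p).compContinuousLinearMap A = (θ q).compContinuousLinearMap B := by
  subst h
  have h : A = B := hAB
  rw [h]

/-- The pullback of a form in coordinates. -/
theorem DiffForm.inChart_pullback (θ : DiffForm n k M) {f : N → M} {x₀ : N} {x₁ : M} {y : Model n}
    (hy : y ∈ (extChartAt 𝓘(ℝ, Model n) x₀).target)
    (hf : ContMDiffAt 𝓘(ℝ, Model n) 𝓘(ℝ, Model n) ∞ f ((extChartAt 𝓘(ℝ, Model n) x₀).symm y))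
    (hfy : f ((extChartAt 𝓘(ℝ, Model n) x₀).symm y) ∈ (extChartAt 𝓘(ℝ, Model n) x₁).source) :
    (θ.pullback f).inChart x₀ y =
      (θ.inChart x₁ (chartMap n f x₀ x₁ y)).compContinuousLinearMap
        (fderiv ℝ (chartMap n f x₀ x₁) y) := by
  set p := (extChartAt 𝓘(ℝ, Model n) x₀).symm y with hp
  have hF : chartMap n f x₀ x₁ y = extChartAt 𝓘(ℝ, Model n) x₁ (f p) := rfl
  have hFt : chartMap n f x₀ x₁ y ∈ (extChartAt 𝓘(ℝ, Model n) x₁).target :=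
    (extChartAt _ x₁).map_source hfy
  have h1 : (extChartAt 𝓘(ℝ, Model n) x₁).symm (chartMap n f x₀ x₁ y) = f p :=
    (extChartAt _ x₁).left_inv hfy
  have hs0 := contMDiffAt_extChartAt_symm_of_mem (n := n) hy
  have hs1 := contMDiffAt_extChartAt_symm_of_mem (n := n) hFt
  have hFd := contDiffAt_chartMap hy hf hfy
  have e1 : mfderiv 𝓘(ℝ, Model n) 𝓘(ℝ, Model n)
      ((extChartAt 𝓘(ℝ, Model n) x₁).symm ∘ chartMap n f x₀ x₁) y =
      (mfderiv 𝓘(ℝ, Model n) 𝓘(ℝ, Model n) (extChartAt 𝓘(ℝ, Model n) x₁).symm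
        (chartMap n f x₀ x₁ y)).comp (mfderiv 𝓘(ℝ, Model n) 𝓘(ℝ, Model n) (chartMap n f x₀ x₁) y) :=
    mfderiv_comp y (hs1.mdifferentiableAt (by simp))
      ((contMDiffAt_iff_contDiffAt.2 hFd).mdifferentiableAt (by simp))
  have e2 : mfderiv 𝓘(ℝ, Model n) 𝓘(ℝ, Model n) (f ∘ (extChartAt 𝓘(ℝ, Model n) x₀).symm) y =
      (mfderiv 𝓘(ℝ, Model n) 𝓘(ℝ, Model n) f p).comp
        (mfderiv 𝓘(ℝ, Model n) 𝓘(ℝ, Model n) (extChartAt 𝓘(ℝ, Model n) x₀).symm y) :=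
    mfderiv_comp y (hf.mdifferentiableAt (by simp)) (hs0.mdifferentiableAt (by simp))
  -- Differentiating this local identity at `y` and applying the chain rule to both sides gives the
  -- transformation law.
  have hev : (extChartAt 𝓘(ℝ, Model n) x₁).symm ∘ chartMap n f x₀ x₁ =ᶠ[𝓝 y]
      f ∘ (extChartAt 𝓘(ℝ, Model n) x₀).symm := by
    have hc : ContinuousAt (f ∘ (extChartAt 𝓘(ℝ, Model n) x₀).symm) y :=
      hf.continuousAt.comp hs0.continuousAt
    filter_upwards [hc ((isOpen_extChartAt_source x₁).mem_nhds hfy)] with z hz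
    exact (extChartAt _ x₁).left_inv hz
  have e3 := hev.mfderiv_eq (I := 𝓘(ℝ, Model n)) (I' := 𝓘(ℝ, Model n))
  rw [mfderiv_eq_fderiv] at e1
  have e4 : (mfderiv 𝓘(ℝ, Model n) 𝓘(ℝ, Model n) f p : Model n →L[ℝ] Model n).comp
        (mfderiv 𝓘(ℝ, Model n) 𝓘(ℝ, Model n) (extChartAt 𝓘(ℝ, Model n) x₀).symm y :
          Model n →L[ℝ] Model n) =
      (mfderiv 𝓘(ℝ, Model n) 𝓘(ℝ, Model n) (extChartAt 𝓘(ℝ, Model n) x₁).symm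
        (chartMap n f x₀ x₁ y) : Model n →L[ℝ] Model n).comp (fderiv ℝ (chartMap n f x₀ x₁) y) :=
    e2.symm.trans (e3.symm.trans e1)
  exact DiffForm.compContinuousLinearMap_congr θ h1.symm e4

omit [IsManifold 𝓘(ℝ, Model n) ∞ M] in
lemma DiffForm.pullback_id (θ : DiffForm n k M) : θ.pullback id = θ := by
  funext x
  ext v
  simp [DiffForm.pullback]

/-- Pullbacks of forms that are smooth near a point, in coordinates. -/
theorem DiffForm.contDiffAt_inChart_pullback {θ : DiffForm n k M} {f : N → M} {x₀ : N} {x₁ : M}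
    {y : Model n} (hy : y ∈ (extChartAt 𝓘(ℝ, Model n) x₀).target)
    (hf : ∀ᶠ z in 𝓝 ((extChartAt 𝓘(ℝ, Model n) x₀).symm y),
      ContMDiffAt 𝓘(ℝ, Model n) 𝓘(ℝ, Model n) ∞ f z)
    (hfy : f ((extChartAt 𝓘(ℝ, Model n) x₀).symm y) ∈ (extChartAt 𝓘(ℝ, Model n) x₁).source)
    (hθ : ContDiffAt ℝ ∞ (θ.inChart x₁) (chartMap n f x₀ x₁ y)) :
    (θ.pullback f).inChart x₀ =ᶠ[𝓝 y] (fun z => (θ.inChart x₁ (chartMap n f x₀ x₁ z)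
      ).compContinuousLinearMap (fderiv ℝ (chartMap n f x₀ x₁) z)) ∧
    ContDiffAt ℝ ∞ ((θ.pullback f).inChart x₀) y := by
  have hs0 := contMDiffAt_extChartAt_symm_of_mem (n := n) hy
  have hc : ContinuousAt (f ∘ (extChartAt 𝓘(ℝ, Model n) x₀).symm) y :=
    hf.self_of_nhds.continuousAt.comp hs0.continuousAt
  have hev : (θ.pullback f).inChart x₀ =ᶠ[𝓝 y] (fun z => (θ.inChart x₁ (chartMap n f x₀ x₁ z)
      ).compContinuousLinearMap (fderiv ℝ (chartMap n f x₀ x₁) z)) := by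
    filter_upwards [hc ((isOpen_extChartAt_source x₁).mem_nhds hfy),
      (isOpen_extChartAt_target x₀).mem_nhds hy, hs0.continuousAt.eventually hf] with z h1 h2 h3
    exact θ.inChart_pullback h2 h3 h1
  refine ⟨hev, ContDiffAt.congr_of_eventuallyEq ?_ hev⟩
  have hF := contDiffAt_chartMap hy hf.self_of_nhds hfy
  exact (hθ.comp y hF).continuousAlternatingMapCompContinuousLinearMap
    (hF.fderiv_right (m := ∞) (by simp))

end Charts

/-! ### Naturality of the exterior derivative -/

section ExteriorDerivative

variable {n k : ℕ} {M : Type*} [TopologicalSpace M] [ChartedSpace (Model n) M]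
  {N : Type*} [TopologicalSpace N] [ChartedSpace (Model n) N]

lemma mfderiv_eq_fderiv_chartMap {f : N → M} {p : N}
    (hf : MDifferentiableAt 𝓘(ℝ, Model n) 𝓘(ℝ, Model n) f p) :
    (mfderiv 𝓘(ℝ, Model n) 𝓘(ℝ, Model n) f p : Model n →L[ℝ] Model n) =
      fderiv ℝ (chartMap n f p (f p)) (extChartAt 𝓘(ℝ, Model n) p p) := by
  refine hf.mfderiv.trans ?_
  change fderivWithin ℝ (chartMap n f p (f p)) (range (id : Model n → Model n)) _ = _
  rw [range_id, fderivWithin_univ]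

lemma mfderiv_extChartAt_symm_eq_fderiv [IsManifold 𝓘(ℝ, Model n) ∞ M] {x₀ : M} {y : Model n}
    (hy : y ∈ (extChartAt 𝓘(ℝ, Model n) x₀).target) :
    (mfderiv 𝓘(ℝ, Model n) 𝓘(ℝ, Model n) (extChartAt 𝓘(ℝ, Model n) x₀).symm y :
      Model n →L[ℝ] Model n) =
      fderiv ℝ (chartMap n id x₀ ((extChartAt 𝓘(ℝ, Model n) x₀).symm y)) y := by
  refine ((contMDiffAt_extChartAt_symm_of_mem hy).mdifferentiableAt (by simp)).mfderiv.trans ?_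
  change fderivWithin ℝ (chartMap n id x₀ _) (range (id : Model n → Model n)) y = _
  rw [range_id, fderivWithin_univ]

lemma two_le_infty : (2 : WithTop ℕ∞) ≤ (∞ : WithTop ℕ∞) := ENat.LEInfty.out

lemma minSmoothness_two_le_infty : minSmoothness ℝ 2 ≤ (∞ : WithTop ℕ∞) := by
  rw [minSmoothness_of_isRCLikeNormedField]
  exact two_le_infty

lemma DiffForm.SmoothOn.contDiffAt {θ : DiffForm n k M} {W : Set M} (hW : IsOpen W)
    (h : θ.SmoothOn W) {x₀ : M} {y : Model n} (hy : y ∈ chartPart n x₀ W) :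
    ContDiffAt ℝ ∞ (θ.inChart x₀) y :=
  (h x₀).contDiffAt ((isOpen_chartPart x₀ hW).mem_nhds hy)

lemma DiffForm.d_congr {θ τ : DiffForm n k M} {x : M} (h : ∀ᶠ z in 𝓝 x, θ z = τ z) :
    θ.d x = τ.d x := by
  have hc : ContinuousAt (extChartAt 𝓘(ℝ, Model n) x).symm (extChartAt 𝓘(ℝ, Model n) x x) :=
    continuousAt_extChartAt_symm x
  have hx : (extChartAt 𝓘(ℝ, Model n) x).symm (extChartAt 𝓘(ℝ, Model n) x x) = x :=
    extChartAt_to_inv x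
  have h1 : ∀ᶠ y in 𝓝 (extChartAt 𝓘(ℝ, Model n) x x), θ.inChart x y = τ.inChart x y := by
    have h2 := hc.tendsto
    rw [hx] at h2
    filter_upwards [h2.eventually h] with y hy
    simp only [DiffForm.inChart, hy]
  exact Filter.EventuallyEq.extDeriv_eq h1

variable [IsManifold 𝓘(ℝ, Model n) ∞ M] [IsManifold 𝓘(ℝ, Model n) ∞ N]

omit [IsManifold 𝓘(ℝ, Model n) ∞ N] in
/-- The exterior derivative in coordinates. -/
theorem DiffForm.inChart_d {θ : DiffForm n k M} {W : Set M} (hW : IsOpen W) (h : θ.SmoothOn W)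
    {x₀ : M} {y : Model n} (hy : y ∈ chartPart n x₀ W) :
    θ.d.inChart x₀ y = extDeriv (θ.inChart x₀) y := by
  set p := (extChartAt 𝓘(ℝ, Model n) x₀).symm y with hp
  have hpm : p ∈ (extChartAt 𝓘(ℝ, Model n) p).source := mem_extChartAt_source p
  have hsm : ContDiffAt ℝ ∞ (θ.inChart p) (chartMap n id x₀ p y) :=
    h.contDiffAt hW (extChartAt_mem_chartPart hpm hy.2)
  -- The pullback by the identity, read in two charts, is the transition formula between them.
  obtain ⟨hev, -⟩ := DiffForm.contDiffAt_inChart_pullback (f := id) (x₁ := p) hy.1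
    (Filter.Eventually.of_forall fun z => contMDiffAt_id) hpm hsm
  rw [DiffForm.pullback_id] at hev
  have hT := contDiffAt_chartMap (f := id) (x₁ := p) hy.1 contMDiffAt_id hpm
  rw [hev.extDeriv_eq, extDeriv_pullback (hsm.differentiableAt (by simp)) hT
    minSmoothness_two_le_infty, ← mfderiv_extChartAt_symm_eq_fderiv hy.1]
  rfl

/-- Smoothness of a form can be checked in any charts. -/
theorem DiffForm.smoothOn_of_forall_exists {θ : DiffForm n k M} {W : Set M}
    (h : ∀ x ∈ W, ∃ x₁ : M, x ∈ (extChartAt 𝓘(ℝ, Model n) x₁).source ∧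
      ContDiffAt ℝ ∞ (θ.inChart x₁) (extChartAt 𝓘(ℝ, Model n) x₁ x)) : θ.SmoothOn W := by
  intro x₀ y hy
  obtain ⟨x₁, hx₁, hs⟩ := h _ hy.2
  obtain ⟨-, h1⟩ := DiffForm.contDiffAt_inChart_pullback (f := id) (x₁ := x₁) hy.1
    (Filter.Eventually.of_forall fun z => contMDiffAt_id) hx₁ hs
  rw [DiffForm.pullback_id] at h1
  exact h1.contDiffWithinAt

theorem DiffForm.SmoothOn.pullback {θ : DiffForm n k M} {W' : Set M} (hW' : IsOpen W')
    (hθ : θ.SmoothOn W') {f : N → M} {W : Set N} (hW : IsOpen W)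
    (hf : ContMDiffOn 𝓘(ℝ, Model n) 𝓘(ℝ, Model n) ∞ f W) (hfW : MapsTo f W W') :
    (θ.pullback f).SmoothOn W := by
  intro x₀ y hy
  have hfm := mem_extChartAt_source (I := 𝓘(ℝ, Model n))
    (f ((extChartAt 𝓘(ℝ, Model n) x₀).symm y))
  exact (DiffForm.contDiffAt_inChart_pullback hy.1
    (Filter.eventually_of_mem (hW.mem_nhds hy.2) fun z hz => hf.contMDiffAt (hW.mem_nhds hz)) hfm
    (hθ.contDiffAt hW' (extChartAt_mem_chartPart hfm (hfW hy.2)))).2.contDiffWithinAt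

/-- The exterior derivative commutes with pullbacks. -/
theorem DiffForm.d_pullback {θ : DiffForm n k M} {W' : Set M} (hW' : IsOpen W')
    (hθ : θ.SmoothOn W') {f : N → M} {W : Set N} (hW : IsOpen W)
    (hf : ContMDiffOn 𝓘(ℝ, Model n) 𝓘(ℝ, Model n) ∞ f W) (hfW : MapsTo f W W') {x : N}
    (hx : x ∈ W) : (θ.pullback f).d x = θ.d.pullback f x := by
  have hxx : (extChartAt 𝓘(ℝ, Model n) x).symm (extChartAt 𝓘(ℝ, Model n) x x) = x :=
    extChartAt_to_inv x
  have hfm : f ((extChartAt 𝓘(ℝ, Model n) x).symm (extChartAt 𝓘(ℝ, Model n) x x)) ∈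
      (extChartAt 𝓘(ℝ, Model n) (f x)).source := by
    rw [hxx]; exact mem_extChartAt_source _
  have hsm : ContDiffAt ℝ ∞ (θ.inChart (f x))
      (chartMap n f x (f x) (extChartAt 𝓘(ℝ, Model n) x x)) := by
    refine hθ.contDiffAt hW' ?_
    exact extChartAt_mem_chartPart hfm (by rw [Function.comp_apply, hxx]; exact hfW hx)
  have hfs : ContMDiffAt 𝓘(ℝ, Model n) 𝓘(ℝ, Model n) ∞ f x := hf.contMDiffAt (hW.mem_nhds hx)
  obtain ⟨hev, -⟩ := DiffForm.contDiffAt_inChart_pullback (mem_extChartAt_target x)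
    (by
      rw [hxx]
      exact Filter.eventually_of_mem (hW.mem_nhds hx) fun z hz => hf.contMDiffAt (hW.mem_nhds hz))
    hfm hsm
  have hT := contDiffAt_chartMap (mem_extChartAt_target x) (by rw [hxx]; exact hfs) hfm
  rw [DiffForm.d, hev.extDeriv_eq, extDeriv_pullback (hsm.differentiableAt (by simp)) hT
    minSmoothness_two_le_infty, ← mfderiv_eq_fderiv_chartMap (hfs.mdifferentiableAt (by simp))]
  have h1 : chartMap n f x (f x) (extChartAt 𝓘(ℝ, Model n) x x) =
      extChartAt 𝓘(ℝ, Model n) (f x) (f x) := by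
    simp only [chartMap, Function.comp_apply, hxx]
  rw [h1]
  rfl

omit [IsManifold 𝓘(ℝ, Model n) ∞ N] in
theorem DiffForm.SmoothOn.d {θ : DiffForm n k M} {W : Set M} (hW : IsOpen W) (h : θ.SmoothOn W) :
    θ.d.SmoothOn W := by
  intro x₀
  have h1 : ContDiffOn ℝ ∞ (fun y => extDeriv (θ.inChart x₀) y) (chartPart n x₀ W) := by
    have h2 := (h x₀).fderiv_of_isOpen (m := ∞) (isOpen_chartPart x₀ hW) (by simp)
    exact (ContinuousAlternatingMap.alternatizeUncurryFinCLM ℝ (Model n) ℝ).contDiff.comp_contDiffOn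
      h2
  exact h1.congr fun y hy => DiffForm.inChart_d hW h hy

omit [IsManifold 𝓘(ℝ, Model n) ∞ N] in
theorem DiffForm.d_d {θ : DiffForm n k M} {W : Set M} (hW : IsOpen W) (h : θ.SmoothOn W) {x : M}
    (hx : x ∈ W) : θ.d.d x = 0 := by
  have hy := extChartAt_mem_chartPart (n := n) (mem_extChartAt_source x) hx
  have hev : θ.d.inChart x =ᶠ[𝓝 (extChartAt 𝓘(ℝ, Model n) x x)] extDeriv (θ.inChart x) :=
    Filter.eventually_of_mem ((isOpen_chartPart x hW).mem_nhds hy)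
      fun z hz => DiffForm.inChart_d hW h hz
  rw [DiffForm.d, hev.extDeriv_eq]
  exact extDeriv_extDeriv_apply (h.contDiffAt hW hy) minSmoothness_two_le_infty

/-- Multiplication of a form by a function. -/
def DiffForm.smulFun (χ : M → ℝ) (θ : DiffForm n k M) : DiffForm n k M := fun x => χ x • θ x

omit [IsManifold 𝓘(ℝ, Model n) ∞ N] [IsManifold 𝓘(ℝ, Model n) ∞ M] in
lemma DiffForm.inChart_smulFun (χ : M → ℝ) (θ : DiffForm n k M) (x₀ : M) (y : Model n) :
    (θ.smulFun χ).inChart x₀ y =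
      χ ((extChartAt 𝓘(ℝ, Model n) x₀).symm y) • θ.inChart x₀ y := rfl

omit [IsManifold 𝓘(ℝ, Model n) ∞ N] in
lemma contDiffOn_comp_extChartAt_symm {χ : M → ℝ}
    (hχ : ContMDiff 𝓘(ℝ, Model n) 𝓘(ℝ, ℝ) ∞ χ) (x₀ : M) :
    ContDiffOn ℝ ∞ (fun y => χ ((extChartAt 𝓘(ℝ, Model n) x₀).symm y))
      (extChartAt 𝓘(ℝ, Model n) x₀).target := by
  rw [← contMDiffOn_iff_contDiffOn]
  exact hχ.comp_contMDiffOn (contMDiffOn_extChartAt_symm x₀)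

omit [IsManifold 𝓘(ℝ, Model n) ∞ N] in
lemma DiffForm.SmoothOn.smulFun {χ : M → ℝ} (hχ : ContMDiff 𝓘(ℝ, Model n) 𝓘(ℝ, ℝ) ∞ χ)
    {θ : DiffForm n k M} {W : Set M} (h : θ.SmoothOn W) : (θ.smulFun χ).SmoothOn W := fun x₀ =>
  ((contDiffOn_comp_extChartAt_symm hχ x₀).mono fun _ hy => hy.1).smul (h x₀)

omit [IsManifold 𝓘(ℝ, Model n) ∞ M] [IsManifold 𝓘(ℝ, Model n) ∞ N] in
lemma DiffForm.pullback_comp (θ : DiffForm n k M) {P : Type*} [TopologicalSpace P]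
    [ChartedSpace (Model n) P] {f : N → M} {g : P → N} {x : P}
    (hf : MDifferentiableAt 𝓘(ℝ, Model n) 𝓘(ℝ, Model n) f (g x))
    (hg : MDifferentiableAt 𝓘(ℝ, Model n) 𝓘(ℝ, Model n) g x) :
    θ.pullback (f ∘ g) x = (θ.pullback f).pullback g x := by
  simp only [DiffForm.pullback, mfderiv_comp x hf hg]
  rfl

end ExteriorDerivative

/-! ### Infinite jets of forms and their limits -/

section LimitsOfJets

open Filter

variable {E F : Type*} [NormedAddCommGroup E] [NormedSpace ℝ E] [NormedAddCommGroup F]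
  [NormedSpace ℝ F]

lemma natCast_le_infty (m : ℕ) : (m : WithTop ℕ∞) ≤ (∞ : WithTop ℕ∞) := ENat.LEInfty.out

lemma natCast_lt_infty (m : ℕ) : (m : WithTop ℕ∞) < (∞ : WithTop ℕ∞) := by
  exact_mod_cast ENat.natCast_lt_top m

/-- If all the derivatives of a sequence of smooth functions converge locally uniformly, then the
limit is smooth and its derivatives are the limits. -/
theorem contDiffOn_of_tendstoLocallyUniformlyOn_iteratedFDeriv {O : Set E} (hO : IsOpen O)
    {u : ℕ → E → F} (hu : ∀ j, ContDiffOn ℝ ∞ (u j) O) {g : E → F}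
    {G : ∀ m : ℕ, E → ContinuousMultilinearMap ℝ (fun _ : Fin m => E) F}
    (hG : ∀ m, TendstoLocallyUniformlyOn (fun j => iteratedFDeriv ℝ m (u j)) (G m) atTop O)
    (hg : ∀ y ∈ O, (G 0 y).curry0 = g y) :
    ContDiffOn ℝ ∞ g O ∧ ∀ m, ∀ y ∈ O, iteratedFDeriv ℝ m g y = G m y := by
  -- Locally uniform convergence of the derivatives lets differentiation pass to the limit, so the
  -- `G m` form a Taylor series of `g`.
  have hder : ∀ m : ℕ, ∀ y ∈ O, HasFDerivAt (G m) (G (m + 1) y).curryLeft y := by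
    intro m y hy
    let L := continuousMultilinearCurryLeftEquiv ℝ (fun _ : Fin (m + 1) => E) F
    have h1 : TendstoLocallyUniformlyOn (fun j => L ∘ iteratedFDeriv ℝ (m + 1) (u j))
        (L ∘ G (m + 1)) atTop O :=
      L.isometry.uniformContinuous.comp_tendstoLocallyUniformlyOn (hG (m + 1))
    refine hasFDerivAt_of_tendstoLocallyUniformlyOn (f := fun j => iteratedFDeriv ℝ m (u j)) (g' := L ∘ G (m + 1)) hO h1 ?_ ?_ hy
    · intro j x hx
      have h2 := ((hu j).contDiffAt (hO.mem_nhds hx)).differentiableAt_iteratedFDeriv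
        (natCast_lt_infty m)
      have h3 := h2.hasFDerivAt
      rw [fderiv_iteratedFDeriv] at h3
      exact h3
    · intro x hx
      exact (hG m).tendsto_at hx
  have hT : HasFTaylorSeriesUpToOn ∞ g (fun y m => G m y) O :=
    ⟨hg, fun m _ y hy => (hder m y hy).hasFDerivWithinAt,
      fun m _ y hy => (hder m y hy).continuousAt.continuousWithinAt⟩
  refine ⟨hT.contDiffOn, fun m y hy => ?_⟩
  rw [← iteratedFDerivWithin_of_isOpen m hO hy]
  exact (hT.eq_iteratedFDerivWithin_of_uniqueDiffOn (natCast_le_infty m) hO.uniqueDiffOn hy).symm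

end LimitsOfJets

section Jets

open Filter TopologicalSpace

variable {n k : ℕ} {M : Type*} [TopologicalSpace M] [ChartedSpace (Model n) M]

/-- The differentials of a chart and of its inverse compose to the identity, so a form is recovered
from its expression in any chart around the point. -/
lemma DiffForm.eq_inChart_compContinuousLinearMap [IsManifold 𝓘(ℝ, Model n) ∞ M]
    (θ : DiffForm n k M) {x₀ x : M} (hx : x ∈ (extChartAt 𝓘(ℝ, Model n) x₀).source) :
    θ x = (θ.inChart x₀ (extChartAt 𝓘(ℝ, Model n) x₀ x)).compContinuousLinearMap
      (mfderiv 𝓘(ℝ, Model n) 𝓘(ℝ, Model n) (extChartAt 𝓘(ℝ, Model n) x₀) x) := by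
  have h1 : IsManifold 𝓘(ℝ, Model n) 1 M := .of_le (natCast_le_infty 1)
  have h2 := mfderivWithin_extChartAt_symm_comp_mfderiv_extChartAt' (I := 𝓘(ℝ, Model n)) hx
  rw [ModelWithCorners.range_eq_univ, mfderivWithin_univ] at h2
  have h3 : (extChartAt 𝓘(ℝ, Model n) x₀).symm (extChartAt 𝓘(ℝ, Model n) x₀ x) = x :=
    (extChartAt _ x₀).left_inv hx
  have h4 := θ.compContinuousLinearMap_congr h3.symm (A := ContinuousLinearMap.id ℝ _) h2.symm
  exact h4

/-- The parts of the targets of the charts around the points `c i` that correspond to `W`. -/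
def chartOpens (n : ℕ) {M : Type*} [TopologicalSpace M] [ChartedSpace (Model n) M]
    {ι : Type*} (c : ι → M) (W : Opens M) : ι → Opens (Model n) := fun i =>
  ⟨chartPart n (c i) W, isOpen_chartPart _ W.isOpen⟩

/-- Jets of infinite order, in the charts around the points `c i`, of `k`-forms on `W`. -/
abbrev JetSpace (n k : ℕ) {M : Type*} [TopologicalSpace M] [ChartedSpace (Model n) M]
    {ι : Type*} (c : ι → M) (W : Opens M) : Type _ :=
  ContProd (chartOpens n c W)
    (fun m : ℕ => ContinuousMultilinearMap ℝ (fun _ : Fin m => Model n) (Model n [⋀^Fin k]→L[ℝ] ℝ))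

variable {ι : Type*} {c : ι → M} {W : Opens M}

/-- `z` is the infinite jet of the smooth form `θ`. -/
def DiffForm.IsJet (θ : DiffForm n k M) (z : JetSpace n k c W) : Prop :=
  θ.SmoothOn (W : Set M) ∧ ∀ i m y, z i m y = iteratedFDeriv ℝ m (θ.inChart (c i)) y

lemma DiffForm.SmoothOn.exists_isJet {θ : DiffForm n k M} (h : θ.SmoothOn (W : Set M)) :
    ∃ z : JetSpace n k c W, θ.IsJet z := by
  refine ⟨fun i m => ⟨fun y => iteratedFDeriv ℝ m (θ.inChart (c i)) y, ?_⟩, h, fun i m y => rfl⟩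
  rw [continuous_iff_continuousAt]
  intro y
  exact (((h.contDiffAt W.isOpen y.2).iteratedFDeriv_right (m := 0)
    (i := m) (by rw [zero_add]; exact natCast_le_infty m)).continuousAt).comp
      continuous_subtype_val.continuousAt

lemma DiffForm.IsJet.zero : (0 : DiffForm n k M).IsJet (0 : JetSpace n k c W) := by
  refine ⟨DiffForm.smoothOn_zero _, fun i m y => ?_⟩
  rw [DiffForm.inChart_zero]
  exact (congrFun (iteratedFDeriv_fun_zero (𝕜 := ℝ) (n := m)) _).symm

lemma DiffForm.IsJet.add {θ τ : DiffForm n k M} {z w : JetSpace n k c W} (h : θ.IsJet z)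
    (h' : τ.IsJet w) : DiffForm.IsJet (θ + τ) (z + w) := by
  refine ⟨h.1.add h'.1, fun i m y => ?_⟩
  rw [DiffForm.inChart_add, iteratedFDeriv_add_apply
    ((h.1.contDiffAt W.isOpen y.2).of_le (natCast_le_infty m))
    ((h'.1.contDiffAt W.isOpen y.2).of_le (natCast_le_infty m)), ← h.2, ← h'.2]
  rfl

lemma DiffForm.IsJet.smul (r : ℝ) {θ : DiffForm n k M} {z : JetSpace n k c W} (h : θ.IsJet z) :
    DiffForm.IsJet (r • θ) (r • z) := by
  refine ⟨h.1.smul r, fun i m y => ?_⟩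
  rw [DiffForm.inChart_smul, iteratedFDeriv_const_smul_apply
    ((h.1.contDiffAt W.isOpen y.2).of_le (natCast_le_infty m)), ← h.2]
  rfl

variable [IsManifold 𝓘(ℝ, Model n) ∞ M]

/-- Limits of jets of smooth forms are jets of smooth forms. -/
theorem DiffForm.exists_isJet_of_tendsto (hc : ∀ x ∈ W, ∃ i, x ∈ (extChartAt 𝓘(ℝ, Model n) (c i)).source)
    {θ : ℕ → DiffForm n k M} {z : ℕ → JetSpace n k c W} (h : ∀ j, (θ j).IsJet (z j))
    {w : JetSpace n k c W} (hw : Tendsto z atTop (𝓝 w)) :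
    ∃ τ : DiffForm n k M, τ.IsJet w ∧ (∀ x ∈ W, Tendsto (fun j => θ j x) atTop (𝓝 (τ x))) ∧
      ∀ x ∈ W, Tendsto (fun j => (θ j).d x) atTop (𝓝 (τ.d x)) := by
  have hpt : ∀ i m y, Tendsto (fun j => z j i m y) atTop (𝓝 (w i m y)) := fun i m y => by
    have h1 := (tendsto_pi_nhds.1 ((tendsto_pi_nhds.1 hw) i)) m
    exact ((ContinuousEvalConst.continuous_eval_const y).tendsto _).comp h1
  have h0 : ∀ i (y : chartOpens n c W i),
      Tendsto (fun j => (θ j).inChart (c i) y) atTop (𝓝 ((w i 0 y).curry0)) := fun i y => by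
    have h1 := ((continuousMultilinearCurryFin0 ℝ (Model n)
      (Model n [⋀^Fin k]→L[ℝ] ℝ)).continuous.tendsto _).comp (hpt i 0 y)
    refine h1.congr fun j => ?_
    rw [Function.comp_apply, (h j).2]
    rfl
  have hlim : ∀ x : M, ∃ L : (TangentSpace 𝓘(ℝ, Model n) x) [⋀^Fin k]→L[ℝ] ℝ, x ∈ W →
      Tendsto (fun j => θ j x) atTop (𝓝 L) := by
    intro x
    by_cases hx : x ∈ W
    · obtain ⟨i, hi⟩ := hc x hx
      have h1 := h0 i ⟨_, extChartAt_mem_chartPart hi hx⟩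
      have h2 := ((ContinuousAlternatingMap.compContinuousLinearMapCLM (ι := Fin k) (𝕜 := ℝ) (F := ℝ)
        (mfderiv 𝓘(ℝ, Model n) 𝓘(ℝ, Model n) (extChartAt 𝓘(ℝ, Model n) (c i)) x)).continuous.tendsto _).comp h1
      exact ⟨_, fun _ => h2.congr fun j => ((θ j).eq_inChart_compContinuousLinearMap hi).symm⟩
    · exact ⟨0, fun h => absurd h hx⟩
  choose τ hτ using hlim
  have hin : ∀ i (y : chartOpens n c W i), (w i 0 y).curry0 = DiffForm.inChart (c i) τ y := by
    intro i y
    refine tendsto_nhds_unique (h0 i y) ?_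
    exact ((ContinuousAlternatingMap.compContinuousLinearMapCLM (ι := Fin k) (𝕜 := ℝ) (F := ℝ)
      (mfderiv 𝓘(ℝ, Model n) 𝓘(ℝ, Model n) (extChartAt 𝓘(ℝ, Model n) (c i)).symm
        (y : Model n))).continuous.tendsto _).comp (hτ _ y.2.2)
  have hE : ∀ i, ContDiffOn ℝ ∞ (DiffForm.inChart (c i) τ) (chartPart n (c i) W) ∧
      ∀ m, ∀ y (hy : y ∈ chartPart n (c i) (W : Set M)),
        iteratedFDeriv ℝ m (DiffForm.inChart (c i) τ) y = w i m ⟨y, hy⟩ := by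
    intro i
    classical
    let G : ∀ m : ℕ, Model n → ContinuousMultilinearMap ℝ (fun _ : Fin m => Model n)
        (Model n [⋀^Fin k]→L[ℝ] ℝ) := fun m y =>
      if hy : y ∈ chartPart n (c i) (W : Set M) then w i m ⟨y, hy⟩ else 0
    have hGy : ∀ m y (hy : y ∈ chartPart n (c i) (W : Set M)), G m y = w i m ⟨y, hy⟩ :=
      fun m y hy => dif_pos hy
    have h1 := contDiffOn_of_tendstoLocallyUniformlyOn_iteratedFDeriv
      (isOpen_chartPart (n := n) (c i) W.isOpen) (u := fun j => (θ j).inChart (c i))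
      (g := DiffForm.inChart (c i) τ) (G := G) (fun j => (h j).1 (c i)) (fun m => by
        rw [tendstoLocallyUniformlyOn_iff_tendstoLocallyUniformly_comp_coe]
        have h1 := (tendsto_pi_nhds.1 ((tendsto_pi_nhds.1 hw) i)) m
        rw [ContinuousMap.tendsto_iff_tendstoLocallyUniformly] at h1
        have e1 : (fun (j : ℕ) (y : chartPart n (c i) (W : Set M)) =>
            iteratedFDeriv ℝ m ((θ j).inChart (c i)) y) = fun j y => z j i m y := by
          funext j y; exact ((h j).2 i m y).symm
        have e2 : (G m ∘ Subtype.val : chartPart n (c i) (W : Set M) → _) = fun y => w i m y := by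
          funext y; exact hGy m y y.2
        exact (congrArg₂ (fun p q => TendstoLocallyUniformly p q atTop) e1 e2).mpr h1) (fun y hy => by rw [hGy 0 y hy]; exact hin i ⟨y, hy⟩)
    exact ⟨h1.1, fun m y hy => (h1.2 m y hy).trans (hGy m y hy)⟩
  have hτs : DiffForm.SmoothOn τ (W : Set M) := by
    refine DiffForm.smoothOn_of_forall_exists fun x hx => ?_
    obtain ⟨i, hi⟩ := hc x hx
    exact ⟨c i, hi, (hE i).1.contDiffAt ((isOpen_chartPart _ W.isOpen).mem_nhds
      (extChartAt_mem_chartPart hi hx))⟩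
  refine ⟨τ, ⟨hτs, fun i m y => ((hE i).2 m y y.2).symm⟩, fun x hx => hτ x hx, fun x hx => ?_⟩
  obtain ⟨i, hi⟩ := hc x hx
  have hy := extChartAt_mem_chartPart (n := n) hi hx
  have h1 := hpt i 1 ⟨_, hy⟩
  have hfd : ∀ σ : DiffForm n k M, fderiv ℝ (σ.inChart (c i)) (extChartAt 𝓘(ℝ, Model n) (c i) x) =
      continuousMultilinearCurryFin1 ℝ (Model n) (Model n [⋀^Fin k]→L[ℝ] ℝ)
        (iteratedFDeriv ℝ 1 (σ.inChart (c i)) (extChartAt 𝓘(ℝ, Model n) (c i) x)) := fun σ => by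
    ext v w
    simp [iteratedFDeriv_one_apply]
  have h2 : Tendsto (fun j => fderiv ℝ ((θ j).inChart (c i)) (extChartAt 𝓘(ℝ, Model n) (c i) x)) atTop
      (𝓝 (fderiv ℝ (DiffForm.inChart (c i) τ) (extChartAt 𝓘(ℝ, Model n) (c i) x))) := by
    rw [hfd τ, (hE i).2 1 _ hy]
    refine (((continuousMultilinearCurryFin1 ℝ (Model n)
      (Model n [⋀^Fin k]→L[ℝ] ℝ)).continuous.tendsto _).comp h1).congr fun j => ?_
    rw [Function.comp_apply, (h j).2, hfd]
  have h3 := ((ContinuousAlternatingMap.compContinuousLinearMapCLM (ι := Fin (k + 1)) (𝕜 := ℝ) (F := ℝ)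
        (mfderiv 𝓘(ℝ, Model n) 𝓘(ℝ, Model n) (extChartAt 𝓘(ℝ, Model n) (c i)) x)).continuous.tendsto _).comp
    (((ContinuousAlternatingMap.alternatizeUncurryFinCLM ℝ (Model n) ℝ).continuous.tendsto _).comp h2)
  -- At `x` the exterior derivative is a continuous linear function of the first derivative in one
  -- chart, so it follows the convergence of jets.
  have hd : ∀ σ : DiffForm n k M, σ.SmoothOn (W : Set M) → σ.d x =
      (ContinuousAlternatingMap.compContinuousLinearMapCLM (ι := Fin (k + 1)) (𝕜 := ℝ) (F := ℝ)
        (mfderiv 𝓘(ℝ, Model n) 𝓘(ℝ, Model n) (extChartAt 𝓘(ℝ, Model n) (c i)) x))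
      (extDeriv (σ.inChart (c i)) (extChartAt 𝓘(ℝ, Model n) (c i) x)) := fun σ hσ => by
    rw [σ.d.eq_inChart_compContinuousLinearMap hi, DiffForm.inChart_d W.isOpen hσ hy]
    rfl
  rw [hd τ hτs]
  refine h3.congr fun j => ?_
  rw [hd _ (h j).1]
  rfl

end Jets

/-! ### Small primitives by the open mapping theorem -/

section SmallPrimitives

open Filter TopologicalSpace

variable {n k : ℕ} {M : Type*} [TopologicalSpace M] [ChartedSpace (Model n) M]

instance JetSpace.addCommGroup {ι : Type*} (c : ι → M) (W : Opens M) :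
    AddCommGroup (JetSpace n k c W) := inferInstance

instance JetSpace.module {ι : Type*} (c : ι → M) (W : Opens M) :
    Module ℝ (JetSpace n k c W) := inferInstance

instance JetSpace.isUniformAddGroup {ι : Type*} (c : ι → M) (W : Opens M) :
    IsUniformAddGroup (JetSpace n k c W) := ContProd.isUniformAddGroup _ _

instance JetSpace.continuousSMul {ι : Type*} (c : ι → M) (W : Opens M) :
    ContinuousSMul ℝ (JetSpace n k c W) := ContProd.continuousSMul _ _

instance JetSpace.completeSpace {ι : Type*} (c : ι → M) (W : Opens M) :
    CompleteSpace (JetSpace n k c W) := ContProd.completeSpace _ _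

instance JetSpace.t2Space {ι : Type*} (c : ι → M) (W : Opens M) :
    T2Space (JetSpace n k c W) := ContProd.t2Space _ _

instance JetSpace.isCountablyGenerated {ι : Type*} [Countable ι] (c : ι → M) (W : Opens M) :
    (uniformity (JetSpace n k c W)).IsCountablyGenerated := ContProd.isCountablyGenerated _ _

instance JetSpace.firstCountableTopology {ι : Type*} [Countable ι] (c : ι → M) (W : Opens M) :
    FirstCountableTopology (JetSpace n k c W) := UniformSpace.firstCountableTopology _

instance JetSpace.sequentialSpace_prod {N : Type*} [TopologicalSpace N] [ChartedSpace (Model n) N]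
    {ι ι' : Type*} [Countable ι] [Countable ι'] (c : ι → M) (W : Opens M) (c' : ι' → N)
    (W' : Opens N) {k' : ℕ} : SequentialSpace (JetSpace n k c W × JetSpace n k' c' W') :=
  have : FirstCountableTopology (JetSpace n k c W × JetSpace n k' c' W') := inferInstance
  inferInstance

lemma DiffForm.IsJet.sub {ι : Type*} {c : ι → M} {W : Opens M} {θ τ : DiffForm n k M}
    {z w : JetSpace n k c W} (h : θ.IsJet z) (h' : τ.IsJet w) :
    DiffForm.IsJet (θ - τ) (z - w) := by
  have h1 := h.add (h'.smul (-1))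
  rwa [neg_one_smul, neg_one_smul, ← sub_eq_add_neg, ← sub_eq_add_neg] at h1

/-- Jets depend continuously on the form. -/
theorem tendsto_jet_sub {ι : Type*} (c : ι → M) (θ₀ : SmoothForm n k M)
    (z : SmoothForm n k M → JetSpace n k c ⊤)
    (hz : ∀ θ : SmoothForm n k M, DiffForm.IsJet (θ.1 - θ₀.1) (z θ)) :
    Tendsto z (𝓝 θ₀) (𝓝 0) := by
  rw [tendsto_pi_nhds]
  intro i
  rw [tendsto_pi_nhds]
  intro m
  rw [ContinuousMap.tendsto_iff_forall_isCompact_tendstoUniformlyOn]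
  intro K hK
  have hsub : Subtype.val '' K ⊆ (extChartAt 𝓘(ℝ, Model n) (c i)).target := by
    rintro _ ⟨y, -, rfl⟩
    exact y.2.1
  have h1 : Tendsto (fun θ : SmoothForm n k M =>
      UniformOnFun.ofFun {K | IsCompact K ∧ K ⊆ (extChartAt 𝓘(ℝ, Model n) (c i)).target}
        (iteratedFDeriv ℝ m (θ.1.inChart (c i)))) (𝓝 θ₀) (𝓝 (UniformOnFun.ofFun
        {K | IsCompact K ∧ K ⊆ (extChartAt 𝓘(ℝ, Model n) (c i)).target}
        (iteratedFDeriv ℝ m (θ₀.1.inChart (c i))))) := by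
    have h2 : Continuous (fun θ : SmoothForm n k M =>
      UniformOnFun.ofFun {K | IsCompact K ∧ K ⊆ (extChartAt 𝓘(ℝ, Model n) (c i)).target}
        (iteratedFDeriv ℝ m (θ.1.inChart (c i)))) :=
      continuous_iff_le_induced.2 ((iInf_le _ (c i)).trans (iInf_le _ m))
    exact h2.tendsto θ₀
  rw [UniformOnFun.tendsto_iff_tendstoUniformlyOn] at h1
  have h2 := h1 _ ⟨hK.image continuous_subtype_val, hsub⟩
  rw [Metric.tendstoUniformlyOn_iff] at h2 ⊢
  intro ε hε
  filter_upwards [h2 ε hε] with θ hθ y hy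
  have h3 := hθ y ⟨y, hy, rfl⟩
  have h4 : z θ i m y = iteratedFDeriv ℝ m (θ.1.inChart (c i)) y -
      iteratedFDeriv ℝ m (θ₀.1.inChart (c i)) y := by
    obtain ⟨a, ha⟩ := DiffForm.SmoothOn.exists_isJet (c := c) (W := ⊤) (θ := θ.1) θ.2
    obtain ⟨b, hb⟩ := DiffForm.SmoothOn.exists_isJet (c := c) (W := ⊤) (θ := θ₀.1) θ₀.2
    rw [(hz θ).2, ← (ha.sub hb).2, ← ha.2, ← hb.2]
    rfl
  rw [h4]
  rw [dist_comm, dist_eq_norm] at h3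
  change dist (0 : ContinuousMultilinearMap ℝ (fun _ : Fin m => Model n)
    (Model n [⋀^Fin k]→L[ℝ] ℝ)) _ < ε
  rwa [dist_zero_left]

lemma DiffForm.pullback_sub {N : Type*} [TopologicalSpace N] [ChartedSpace (Model n) N]
    (f : N → M) (θ τ : DiffForm n k M) :
    DiffForm.pullback f (θ - τ) = θ.pullback f - τ.pullback f := by
  funext x
  ext v
  simp [DiffForm.pullback]

variable [IsManifold 𝓘(ℝ, Model n) ∞ M] [CompactSpace M]
  {U : Type*} [TopologicalSpace U] [ChartedSpace (Model n) U] [IsManifold 𝓘(ℝ, Model n) ∞ U]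

/-- If the pullbacks of all closed forms have primitives on members of a countable family of open
sets, then one member suffices for all small forms, with small primitives. -/
theorem exists_small_primitive {ι κ : Type*} [Countable ι] [Countable κ] (c : ι → U)
    (hc : ∀ x, ∃ i, x ∈ (extChartAt 𝓘(ℝ, Model n) (c i)).source) (W : κ → Opens U) (f : U → M)
    (H : ∀ β : DiffForm n (k + 1) M, β.SmoothOn univ → (∀ x, β.d x = 0) →
      ∃ j, ∃ σ : DiffForm n k U, σ.SmoothOn (W j : Set U) ∧ ∀ x ∈ W j, σ.d x = β.pullback f x) :
    ∃ j, ∀ (s : Finset ι) (K : ι → Set (Model n)),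
      (∀ i ∈ s, IsCompact (K i) ∧ K i ⊆ chartPart n (c i) (W j : Set U)) → ∀ ε > 0,
      ∀ θ₀ : SmoothForm n (k + 1) M, (∀ x, θ₀.1.d x = 0) → ∀ᶠ θ in 𝓝 θ₀, (∀ x, θ.1.d x = 0) →
      ∃ σ : DiffForm n k U, σ.SmoothOn (W j : Set U) ∧
        (∀ x ∈ W j, σ.d x = θ.1.pullback f x - θ₀.1.pullback f x) ∧
        ∀ i ∈ s, ∀ m ≤ 2, ∀ y ∈ K i, ‖iteratedFDeriv ℝ m (σ.inChart (c i)) y‖ ≤ ε := by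
  obtain ⟨t, ht⟩ := CompactSpace.elim_nhds_subcover
    (fun x : M => (extChartAt 𝓘(ℝ, Model n) x).source) fun x => extChartAt_source_mem_nhds x
  let b : t → M := Subtype.val
  have hb : ∀ x ∈ (⊤ : Opens M), ∃ i, x ∈ (extChartAt 𝓘(ℝ, Model n) (b i)).source := by
    intro x _
    have hx : x ∈ ⋃ x ∈ t, (extChartAt 𝓘(ℝ, Model n) x).source := by rw [ht]; trivial
    obtain ⟨i, hi, hxi⟩ := mem_iUnion₂.1 hx
    exact ⟨⟨i, hi⟩, hxi⟩
  have hdadd : ∀ {β γ : DiffForm n (k + 1) M}, β.SmoothOn univ → γ.SmoothOn univ →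
      ∀ x, DiffForm.d (β + γ) x = β.d x + γ.d x := fun h h' x =>
    DiffForm.d_add isOpen_univ h h' (mem_univ x)
  -- The closed forms on M, represented by their jets in order to lie in a complete metrizable
  -- space.
  let S : Submodule ℝ (JetSpace n (k + 1) b ⊤) :=
    { carrier := {z | ∃ β : DiffForm n (k + 1) M, β.IsJet z ∧ ∀ x, β.d x = 0}
      zero_mem' := ⟨0, .zero, DiffForm.d_zero⟩
      add_mem' := by
        rintro z w ⟨β, hβ, h⟩ ⟨γ, hγ, h'⟩
        exact ⟨β + γ, hβ.add hγ, fun x => by rw [hdadd hβ.1 hγ.1, h, h', add_zero]⟩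
      smul_mem' := by
        rintro r z ⟨β, hβ, h⟩
        exact ⟨r • β, hβ.smul r, fun x => by rw [DiffForm.d_smul, h, smul_zero]⟩ }
  -- The domain of this relation consists of the closed forms whose pullback has a primitive on `W
  -- j`.
  let R : ∀ j, Submodule ℝ (JetSpace n (k + 1) b ⊤ × JetSpace n k c (W j)) := fun j =>
    { carrier := {p | ∃ β : DiffForm n (k + 1) M, ∃ σ : DiffForm n k U, β.IsJet p.1 ∧ σ.IsJet p.2 ∧
        (∀ x, β.d x = 0) ∧ ∀ x ∈ W j, σ.d x = β.pullback f x}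
      zero_mem' := ⟨0, 0, .zero, .zero, DiffForm.d_zero, fun x _ => by
        rw [DiffForm.d_zero]; ext v; simp [DiffForm.pullback]⟩
      add_mem' := by
        rintro p q ⟨β, σ, hβ, hσ, h, hh⟩ ⟨γ, τ, hγ, hτ, h', hh'⟩
        refine ⟨β + γ, σ + τ, hβ.add hγ, hσ.add hτ,
          fun x => by rw [hdadd hβ.1 hγ.1, h, h', add_zero], fun x hx => ?_⟩
        rw [DiffForm.d_add (W j).isOpen hσ.1 hτ.1 hx, hh x hx, hh' x hx]
        rfl
      smul_mem' := by
        rintro r p ⟨β, σ, hβ, hσ, h, hh⟩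
        refine ⟨r • β, r • σ, hβ.smul r, hσ.smul r,
          fun x => by rw [DiffForm.d_smul, h, smul_zero], fun x hx => ?_⟩
        rw [DiffForm.d_smul, hh x hx]
        rfl }
  -- Convergence of jets implies pointwise convergence of the forms and of their exterior
  -- derivatives, so equations between these pass to the limit.
  have hS : IsClosed (S : Set (JetSpace n (k + 1) b ⊤)) := by
    refine IsSeqClosed.isClosed fun z w hz hw => ?_
    choose β hβ h using hz
    obtain ⟨γ, hγ, -, hd⟩ := DiffForm.exists_isJet_of_tendsto hb hβ hw
    refine ⟨γ, hγ, fun x => tendsto_nhds_unique (hd x trivial) ?_⟩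
    simp only [h]
    exact tendsto_const_nhds
  have hR : ∀ j, IsClosed (R j : Set (JetSpace n (k + 1) b ⊤ × JetSpace n k c (W j))) := by
    intro j
    refine IsSeqClosed.isClosed fun z w hz hw => ?_
    choose β σ hβ hσ h hh using hz
    obtain ⟨γ, hγ, hp, hd⟩ := DiffForm.exists_isJet_of_tendsto hb hβ
      ((continuous_fst.tendsto w).comp hw)
    obtain ⟨τ, hτ, -, hd'⟩ := DiffForm.exists_isJet_of_tendsto (fun x _ => hc x) hσ
      ((continuous_snd.tendsto w).comp hw)
    refine ⟨γ, τ, hγ, hτ, fun x => tendsto_nhds_unique (hd x trivial) ?_,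
      fun x hx => tendsto_nhds_unique (hd' x hx) ?_⟩
    · simp only [h]
      exact tendsto_const_nhds
    · simp only [hh _ x hx]
      exact ((ContinuousAlternatingMap.compContinuousLinearMapCLM (ι := Fin (k + 1)) (𝕜 := ℝ)
        (F := ℝ) (mfderiv 𝓘(ℝ, Model n) 𝓘(ℝ, Model n) f x)).continuous.tendsto _).comp
          (hp (f x) trivial)
  obtain ⟨j, hj⟩ := exists_forall_nhds_zero_of_closed_relations S hS R hR
    (by
      rintro j p ⟨β, σ, hβ, -, h, -⟩
      exact ⟨β, hβ, h⟩)
    (by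
      rintro z ⟨β, hβ, h⟩
      obtain ⟨j, σ, hσ, hd⟩ := H β hβ.1 h
      obtain ⟨x, hx⟩ := hσ.exists_isJet (c := c)
      exact ⟨j, x, β, σ, hβ, hx, h, hd⟩)
  refine ⟨j, fun s K hK ε hε θ₀ hθ₀ => ?_⟩
  -- Bounds on the derivatives of orders 0, 1, 2 on finitely many compact sets define a
  -- neighbourhood of zero in the space of jets.
  let N : Set (JetSpace n k c (W j)) := {x | ∀ i ∈ s, ∀ m ∈ Finset.range 3,
    ∀ y ∈ (Subtype.val ⁻¹' K i : Set (chartOpens n c (W j) i)), ‖x i m y‖ ≤ ε}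
  have hN : N ∈ 𝓝 (0 : JetSpace n k c (W j)) := by
    have h1 : ∀ᶠ x in 𝓝 (0 : JetSpace n k c (W j)), ∀ i ∈ s, ∀ m ∈ Finset.range 3,
        ∀ y ∈ (Subtype.val ⁻¹' K i : Set (chartOpens n c (W j) i)), ‖x i m y‖ ≤ ε := by
      rw [Filter.eventually_all_finset]
      intro i hi
      rw [Filter.eventually_all_finset]
      intro m _
      have hKc : IsCompact (Subtype.val ⁻¹' K i : Set (chartOpens n c (W j) i)) := by
        have h2 : (Subtype.val '' (Subtype.val ⁻¹' K i : Set (chartOpens n c (W j) i))) = K i := by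
          refine (Subtype.image_preimage_coe _ _).trans (inter_eq_right.2 (hK i hi).2)
        rw [Subtype.isCompact_iff, h2]
        exact (hK i hi).1
      have h2 : Tendsto (fun x : JetSpace n k c (W j) => x i m) (𝓝 0) (𝓝 0) :=
        ((continuous_apply m).comp (continuous_apply i)).tendsto (0 : JetSpace n k c (W j))
      rw [ContinuousMap.tendsto_iff_forall_isCompact_tendstoUniformlyOn] at h2
      have h3 := Metric.tendstoUniformlyOn_iff.1 (h2 _ hKc) ε hε
      filter_upwards [h3] with x hx y hy
      have h4 := (hx y hy).le
      rw [dist_comm] at h4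
      change dist _ (0 : ContinuousMultilinearMap ℝ (fun _ : Fin m => Model n)
        (Model n [⋀^Fin k]→L[ℝ] ℝ)) ≤ ε at h4
      rwa [dist_zero_right] at h4
    exact h1
  obtain ⟨N', hN', hsub⟩ := hj N hN
  have hex : ∀ θ : SmoothForm n (k + 1) M, ∃ z : JetSpace n (k + 1) b ⊤,
      DiffForm.IsJet (θ.1 - θ₀.1) z := fun θ => by
    have h1 : DiffForm.SmoothOn (θ.1 - θ₀.1) univ := by
      have h2 := DiffForm.SmoothOn.add θ.2 (DiffForm.SmoothOn.smul (-1) θ₀.2)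
      rwa [neg_one_smul, ← sub_eq_add_neg] at h2
    exact DiffForm.SmoothOn.exists_isJet h1
  choose z hz using hex
  filter_upwards [(tendsto_jet_sub b θ₀ z hz) hN'] with θ hθ hcl
  have hzS : z θ ∈ S := by
    refine ⟨θ.1 - θ₀.1, hz θ, fun x => ?_⟩
    have h1 := hdadd θ.2 (DiffForm.SmoothOn.smul (-1) θ₀.2) x
    rwa [neg_one_smul, ← sub_eq_add_neg, ← neg_one_smul ℝ θ₀.1, DiffForm.d_smul, hcl, hθ₀,
      smul_zero, add_zero] at h1
  obtain ⟨x, hxN, β, σ, hβ, hσ, -, hd⟩ := hsub _ hzS hθ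
  -- The charts cover M, so the zeroth order parts of the jet already determine the form.
  have hβe : β = θ.1 - θ₀.1 := by
    funext p
    obtain ⟨i, hi⟩ := hb p trivial
    have hy := extChartAt_mem_chartPart (n := n) hi (W := ((⊤ : Opens M) : Set M)) trivial
    have h1 := (hβ.2 i 0 ⟨_, hy⟩).symm.trans ((hz θ).2 i 0 ⟨_, hy⟩)
    have h2 := congrArg (fun A => A 0) h1
    simp only [iteratedFDeriv_zero_apply] at h2
    rw [β.eq_inChart_compContinuousLinearMap hi, h2]
    exact ((θ.1 - θ₀.1 : DiffForm n (k + 1) M).eq_inChart_compContinuousLinearMap hi).symm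
  refine ⟨σ, hσ.1, fun p hp => ?_, fun i hi m hm y hy => ?_⟩
  · rw [hd p hp, hβe, DiffForm.pullback_sub]
    rfl
  · have h1 := hxN i hi m (Finset.mem_range.2 (by omega)) ⟨y, (hK i hi).2 hy⟩ hy
    rwa [hσ.2] at h1

end SmallPrimitives

/-! ### Alternating maps as functionals and bilinear forms -/

section Conversion

variable {E : Type*} [NormedAddCommGroup E] [NormedSpace ℝ E] [FiniteDimensional ℝ E]

/-- Alternating `1`-forms as linear functionals. -/
def alternatingToDual (E : Type*) [NormedAddCommGroup E] [NormedSpace ℝ E]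
    [FiniteDimensional ℝ E] : (E [⋀^Fin 1]→L[ℝ] ℝ) →L[ℝ] E →L[ℝ] ℝ :=
  LinearMap.toContinuousLinearMap
    { toFun := fun A => LinearMap.toContinuousLinearMap
        { toFun := fun v => A ![v]
          map_add' := fun v w => A.toAlternatingMap.map_vecCons_add _ v w
          map_smul' := fun r v => A.toAlternatingMap.map_vecCons_smul _ r v }
      map_add' := fun _ _ => rfl
      map_smul' := fun _ _ => rfl }

@[simp] lemma alternatingToDual_apply (A : E [⋀^Fin 1]→L[ℝ] ℝ) (v : E) :
    alternatingToDual E A v = A ![v] := rfl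

omit [FiniteDimensional ℝ E] in
lemma ContinuousAlternatingMap.apply_swap_two (A : E [⋀^Fin 2]→L[ℝ] ℝ) (v w : E) :
    A ![v, w] = -A ![w, v] := by
  have h := A.toAlternatingMap.map_swap ![w, v] (i := 0) (j := 1) (by simp)
  have h1 : ![w, v] ∘ Equiv.swap (0 : Fin 2) 1 = ![v, w] := by
    funext i
    fin_cases i <;> simp
  rw [h1] at h
  exact h

/-- Alternating `2`-forms as bilinear forms. -/
def alternatingToBilin (E : Type*) [NormedAddCommGroup E] [NormedSpace ℝ E]
    [FiniteDimensional ℝ E] : (E [⋀^Fin 2]→L[ℝ] ℝ) →L[ℝ] E →L[ℝ] E →L[ℝ] ℝ :=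
  LinearMap.toContinuousLinearMap
    { toFun := fun A => LinearMap.toContinuousLinearMap
        { toFun := fun v => LinearMap.toContinuousLinearMap
            { toFun := fun w => A ![v, w]
              map_add' := fun w w' => by
                rw [A.apply_swap_two, A.apply_swap_two v w, A.apply_swap_two v w', ← neg_add]
                exact congrArg _ (A.toAlternatingMap.map_vecCons_add _ w w')
              map_smul' := fun r w => by
                rw [A.apply_swap_two, A.apply_swap_two v w, smul_neg]
                exact congrArg _ (A.toAlternatingMap.map_vecCons_smul _ r w) }
          map_add' := fun v v' => by
            ext w
            exact A.toAlternatingMap.map_vecCons_add _ v v'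
          map_smul' := fun r v => by
            ext w
            exact A.toAlternatingMap.map_vecCons_smul _ r v }
      map_add' := fun _ _ => rfl
      map_smul' := fun _ _ => rfl }

@[simp] lemma alternatingToBilin_apply (A : E [⋀^Fin 2]→L[ℝ] ℝ) (v w : E) :
    alternatingToBilin E A v w = A ![v, w] := rfl

lemma vec_two_eq {E : Type*} (v : Fin 2 → E) : v = ![v 0, v 1] := by
  funext i; fin_cases i <;> rfl

lemma extDeriv_one_apply {t : E → E [⋀^Fin 1]→L[ℝ] ℝ} {y : E} (h : DifferentiableAt ℝ t y)
    (v w : E) :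
    extDeriv t y ![v, w] = extDerivOne (fun z => alternatingToDual E (t z)) y v w := by
  have h1 : fderiv ℝ (fun z => alternatingToDual E (t z)) y =
      (alternatingToDual E).comp (fderiv ℝ t y) :=
    ((alternatingToDual E).hasFDerivAt.comp y h.hasFDerivAt).fderiv
  have h2 : extDerivOne (fun z => alternatingToDual E (t z)) y v w =
      (fderiv ℝ t y v) ![w] - (fderiv ℝ t y w) ![v] := by
    rw [extDerivOne, h1]; rfl
  rw [h2, extDeriv, ContinuousAlternatingMap.alternatizeUncurryFin_apply, Fin.sum_univ_two]
  have e0 : (0 : Fin 2).removeNth ![v, w] = ![w] := by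
    funext i; fin_cases i; rfl
  have e1 : (1 : Fin 2).removeNth ![v, w] = ![v] := by
    funext i; fin_cases i; rfl
  simp [e0, e1, sub_eq_add_neg]

lemma extDeriv_two_apply {a : E → E [⋀^Fin 2]→L[ℝ] ℝ} {y : E} (h : DifferentiableAt ℝ a y)
    (u p q : E) :
    extDeriv a y ![u, p, q] = fderiv ℝ (fun z => alternatingToBilin E (a z)) y u p q +
      fderiv ℝ (fun z => alternatingToBilin E (a z)) y p q u +
      fderiv ℝ (fun z => alternatingToBilin E (a z)) y q u p := by
  have h1 : fderiv ℝ (fun z => alternatingToBilin E (a z)) y =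
      (alternatingToBilin E).comp (fderiv ℝ a y) :=
    ((alternatingToBilin E).hasFDerivAt.comp y h.hasFDerivAt).fderiv
  rw [h1, extDeriv, ContinuousAlternatingMap.alternatizeUncurryFin_apply, Fin.sum_univ_three]
  have e0 : (0 : Fin 3).removeNth ![u, p, q] = ![p, q] := by
    funext i; fin_cases i <;> rfl
  have e1 : (1 : Fin 3).removeNth ![u, p, q] = ![u, q] := by
    funext i; fin_cases i <;> rfl
  have e2 : (2 : Fin 3).removeNth ![u, p, q] = ![u, p] := by
    funext i; fin_cases i <;> rfl
  rw [e0, e1, e2]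
  simp only [ContinuousLinearMap.comp_apply, alternatingToBilin_apply]
  rw [(fderiv ℝ a y p).apply_swap_two q u]
  simp

end Conversion

/-! ### Extending compactly supported maps of a chart by the identity -/

section ChartExtension

variable {n : ℕ} {U : Type*} [TopologicalSpace U] [ChartedSpace (Model n) U]

open scoped Classical in
/-- The map of the manifold that is `φ` in the chart around `x₀` and the identity outside. -/
def chartExtension (x₀ : U) (φ : Model n → Model n) (x : U) : U :=
  if x ∈ (extChartAt 𝓘(ℝ, Model n) x₀).source then
    (extChartAt 𝓘(ℝ, Model n) x₀).symm (φ (extChartAt 𝓘(ℝ, Model n) x₀ x)) else x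

variable {x₀ : U} {K : Set (Model n)} {φ : Model n → Model n}

lemma chartExtension_of_mem {x : U} (hx : x ∈ (extChartAt 𝓘(ℝ, Model n) x₀).source) :
    chartExtension x₀ φ x =
      (extChartAt 𝓘(ℝ, Model n) x₀).symm (φ (extChartAt 𝓘(ℝ, Model n) x₀ x)) := if_pos hx

lemma extChartAt_mem_of_notMem_image {x : U} (hx : x ∈ (extChartAt 𝓘(ℝ, Model n) x₀).source)
    (h : x ∉ (extChartAt 𝓘(ℝ, Model n) x₀).symm '' K) : extChartAt 𝓘(ℝ, Model n) x₀ x ∉ K :=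
  fun hK => h ⟨_, hK, (extChartAt _ x₀).left_inv hx⟩

lemma chartExtension_of_notMem_image (hφ : ∀ y ∉ K, φ y = y) {x : U}
    (hx : x ∉ (extChartAt 𝓘(ℝ, Model n) x₀).symm '' K) : chartExtension x₀ φ x = x := by
  by_cases h : x ∈ (extChartAt 𝓘(ℝ, Model n) x₀).source
  · rw [chartExtension_of_mem h, hφ _ (extChartAt_mem_of_notMem_image h hx),
      (extChartAt _ x₀).left_inv h]
  · exact if_neg h

lemma mem_target_of_mapsTo (hKt : K ⊆ (extChartAt 𝓘(ℝ, Model n) x₀).target)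
    (hφ : ∀ y ∉ K, φ y = y) (hφK : MapsTo φ K K) {y : Model n}
    (hy : y ∈ (extChartAt 𝓘(ℝ, Model n) x₀).target) :
    φ y ∈ (extChartAt 𝓘(ℝ, Model n) x₀).target := by
  by_cases h : y ∈ K
  · exact hKt (hφK h)
  · rwa [hφ y h]

lemma chartExtension_comp (hKt : K ⊆ (extChartAt 𝓘(ℝ, Model n) x₀).target)
    (hφ : ∀ y ∉ K, φ y = y) (hφK : MapsTo φ K K) (ψ : Model n → Model n) (x : U) :
    chartExtension x₀ ψ (chartExtension x₀ φ x) = chartExtension x₀ (ψ ∘ φ) x := by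
  by_cases h : x ∈ (extChartAt 𝓘(ℝ, Model n) x₀).source
  · have h1 := mem_target_of_mapsTo hKt hφ hφK ((extChartAt _ x₀).map_source h)
    rw [chartExtension_of_mem h, chartExtension_of_mem ((extChartAt _ x₀).map_target h1),
      (extChartAt _ x₀).right_inv h1, chartExtension_of_mem h]
    rfl
  · have e : ∀ χ : Model n → Model n, chartExtension x₀ χ x = x := fun χ => if_neg h
    rw [e, e, e]

lemma chartExtension_id (x : U) : chartExtension x₀ (id : Model n → Model n) x = x :=
  chartExtension_of_notMem_image (K := ∅) (fun _ _ => rfl) (by simp)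

variable [T2Space U]

/-- This is where the Hausdorff property enters: the complement of the image is open, and on it the
extended map is the identity, which gives continuity and smoothness outside the chart. -/
lemma isClosed_extChartAt_symm_image (hK : IsCompact K)
    (hKt : K ⊆ (extChartAt 𝓘(ℝ, Model n) x₀).target) :
    IsClosed ((extChartAt 𝓘(ℝ, Model n) x₀).symm '' K) :=
  (hK.image_of_continuousOn ((continuousOn_extChartAt_symm x₀).mono hKt)).isClosed

lemma continuous_chartExtension (hK : IsCompact K)
    (hKt : K ⊆ (extChartAt 𝓘(ℝ, Model n) x₀).target) (hφ : ∀ y ∉ K, φ y = y)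
    (hφK : MapsTo φ K K) (hc : Continuous φ) : Continuous (chartExtension x₀ φ) := by
  rw [continuous_iff_continuousAt]
  intro x
  by_cases h : x ∈ (extChartAt 𝓘(ℝ, Model n) x₀).source
  · have h1 := mem_target_of_mapsTo hKt hφ hφK ((extChartAt _ x₀).map_source h)
    have h2 : ContinuousAt (fun x => (extChartAt 𝓘(ℝ, Model n) x₀).symm
        (φ (extChartAt 𝓘(ℝ, Model n) x₀ x))) x :=
      ContinuousAt.comp (f := fun x => φ (extChartAt 𝓘(ℝ, Model n) x₀ x))
        (continuousAt_extChartAt_symm'' h1)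
        (hc.continuousAt.comp (continuousAt_extChartAt' h))
    refine h2.congr ?_
    filter_upwards [(isOpen_extChartAt_source x₀).mem_nhds h] with z hz
    exact (chartExtension_of_mem hz).symm
  · refine continuousAt_id.congr ?_
    filter_upwards [(isClosed_extChartAt_symm_image hK hKt).isOpen_compl.mem_nhds
      (show x ∉ _ from fun ⟨y, hy, hyx⟩ => h (hyx ▸ (extChartAt _ x₀).map_target (hKt hy)))]
      with z hz
    exact (chartExtension_of_notMem_image hφ hz).symm

variable [IsManifold 𝓘(ℝ, Model n) ∞ U]

lemma contMDiff_chartExtension (hK : IsCompact K)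
    (hKt : K ⊆ (extChartAt 𝓘(ℝ, Model n) x₀).target) (hφ : ∀ y ∉ K, φ y = y)
    (hφK : MapsTo φ K K) (hs : ContDiff ℝ ∞ φ) :
    ContMDiff 𝓘(ℝ, Model n) 𝓘(ℝ, Model n) ∞ (chartExtension x₀ φ) := by
  intro x
  by_cases h : x ∈ (extChartAt 𝓘(ℝ, Model n) x₀).source
  · have h1 := mem_target_of_mapsTo hKt hφ hφK ((extChartAt _ x₀).map_source h)
    have h2 : ContMDiffAt 𝓘(ℝ, Model n) 𝓘(ℝ, Model n) ∞ (fun x =>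
        (extChartAt 𝓘(ℝ, Model n) x₀).symm (φ (extChartAt 𝓘(ℝ, Model n) x₀ x))) x := by
      refine ContMDiffAt.comp (g := (extChartAt 𝓘(ℝ, Model n) x₀).symm) x
        (contMDiffAt_extChartAt_symm_of_mem h1) ?_
      refine ContMDiffAt.comp (g := φ) x hs.contMDiff.contMDiffAt ?_
      rw [extChartAt_source] at h
      exact contMDiffAt_extChartAt' h
    refine h2.congr_of_eventuallyEq ?_
    filter_upwards [(isOpen_extChartAt_source x₀).mem_nhds h] with z hz
    exact chartExtension_of_mem hz
  · refine contMDiffAt_id.congr_of_eventuallyEq ?_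
    filter_upwards [(isClosed_extChartAt_symm_image hK hKt).isOpen_compl.mem_nhds
      (show x ∉ _ from fun ⟨y, hy, hyx⟩ => h (hyx ▸ (extChartAt _ x₀).map_target (hKt hy)))]
      with z hz
    exact chartExtension_of_notMem_image hφ hz

omit [IsManifold 𝓘(ℝ, Model n) ∞ U] in
-- A bijection that fixes each point of the complement of `K` cannot send a point of `K` there.
lemma Homeomorph.mapsTo_of_eq_self_off {X : Type*} [TopologicalSpace X] {K : Set X} (φ : X ≃ₜ X)
    (hφ : ∀ y ∉ K, φ y = y) : MapsTo φ K K ∧ MapsTo φ.symm K K ∧ ∀ y ∉ K, φ.symm y = y := by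
  have h3 : ∀ y ∉ K, φ.symm y = y := fun y hy => by
    rw [φ.symm_apply_eq, hφ y hy]
  refine ⟨fun y hy => ?_, fun y hy => ?_, h3⟩
  · by_contra h
    have h1 := h3 _ h
    rw [φ.symm_apply_apply] at h1
    exact h (h1 ▸ hy)
  · by_contra h
    have h1 := hφ _ h
    rw [φ.apply_symm_apply] at h1
    exact h (h1 ▸ hy)

/-- Homeomorphisms supported in a chart extend to the manifold. -/
def chartExtensionHomeomorph (x₀ : U) {K : Set (Model n)} (hK : IsCompact K)
    (hKt : K ⊆ (extChartAt 𝓘(ℝ, Model n) x₀).target) (φ : Model n ≃ₜ Model n)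
    (hφ : ∀ y ∉ K, φ y = y) : U ≃ₜ U where
  toFun := chartExtension x₀ φ
  invFun := chartExtension x₀ φ.symm
  left_inv x := by
    obtain ⟨h1, h2, h3⟩ := φ.mapsTo_of_eq_self_off hφ
    rw [chartExtension_comp hKt hφ h1, φ.symm_comp_self, chartExtension_id]
  right_inv x := by
    obtain ⟨h1, h2, h3⟩ := φ.mapsTo_of_eq_self_off hφ
    rw [chartExtension_comp hKt h3 h2, φ.self_comp_symm, chartExtension_id]
  continuous_toFun :=
    continuous_chartExtension hK hKt hφ (φ.mapsTo_of_eq_self_off hφ).1 φ.continuous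
  continuous_invFun := by
    obtain ⟨h1, h2, h3⟩ := φ.mapsTo_of_eq_self_off hφ
    exact continuous_chartExtension hK hKt h3 h2 φ.symm.continuous

end ChartExtension

/-! ### Moser's method in one chart of the manifold -/

section ChartMoser

variable {n : ℕ} {U : Type*} [TopologicalSpace U] [ChartedSpace (Model n) U]

/-- The derivatives up to order `m` of the coordinate expression of `θ` around `x₀` are bounded by
`δ` on `K`. -/
def DiffForm.JetLE {k : ℕ} (θ : DiffForm n k U) (x₀ : U) (K : Set (Model n)) (m : ℕ) (δ : ℝ) :
    Prop :=
  ∀ i ≤ m, ∀ y ∈ K, ‖iteratedFDeriv ℝ i (θ.inChart x₀) y‖ ≤ δ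

/-- Closeness to the identity is measured on the manifold by the change of one continuous function
`ρ`, so that no metric is needed and the changes add up under composition. It holds by uniform
continuity of `ρ` in the chart on `K`. -/
lemma exists_forall_dist_chartExtension_le {x₀ : U} {K : Set (Model n)} (hK : IsCompact K)
    (hKt : K ⊆ (extChartAt 𝓘(ℝ, Model n) x₀).target) {ρ : U → ℝ} (hρ : Continuous ρ) {ε : ℝ}
    (hε : 0 < ε) : ∃ r > 0, ∀ φ : Model n → Model n, (∀ y ∉ K, φ y = y) → MapsTo φ K K →
      (∀ y, ‖φ y - y‖ ≤ r) → ∀ x, |ρ (chartExtension x₀ φ x) - ρ x| ≤ ε := by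
  have h1 : UniformContinuousOn (ρ ∘ (extChartAt 𝓘(ℝ, Model n) x₀).symm) K :=
    hK.uniformContinuousOn_of_continuous
      (hρ.comp_continuousOn ((continuousOn_extChartAt_symm x₀).mono hKt))
  obtain ⟨r, hr, h⟩ := Metric.uniformContinuousOn_iff.1 h1 ε hε
  refine ⟨r / 2, half_pos hr, fun φ hφ hφK hφr x => ?_⟩
  by_cases hx : x ∈ (extChartAt 𝓘(ℝ, Model n) x₀).symm '' K
  · obtain ⟨y, hy, rfl⟩ := hx
    have h2 := h _ (hφK hy) _ hy (by
      rw [dist_eq_norm]; exact (hφr y).trans_lt (half_lt_self hr))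
    rw [chartExtension_of_mem ((extChartAt _ x₀).map_target (hKt hy)),
      (extChartAt _ x₀).right_inv (hKt hy)]
    rw [Real.dist_eq] at h2
    exact h2.le
  · rw [chartExtension_of_notMem_image hφ hx, sub_self, abs_zero]
    exact hε.le

lemma norm_fderiv_fderiv {E F : Type*} [NormedAddCommGroup E] [NormedSpace ℝ E]
    [NormedAddCommGroup F] [NormedSpace ℝ F] (f : E → F) (x : E) :
    ‖fderiv ℝ (fderiv ℝ f) x‖ = ‖iteratedFDeriv ℝ 2 f x‖ := by
  rw [← norm_iteratedFDeriv_one, norm_iteratedFDeriv_fderiv]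

variable [IsManifold 𝓘(ℝ, Model n) ∞ U] [T2Space U]

/-- Moser's method in one chart. -/
theorem exists_homeomorph_pullback_eq {η₀ : DiffForm n 2 U} (hη : IsSymplectic η₀) (x₀ : U)
    {K : Set (Model n)} (hK : IsCompact K) (hKt : K ⊆ (extChartAt 𝓘(ℝ, Model n) x₀).target)
    {ρ : U → ℝ} (hρ : Continuous ρ) {ε : ℝ} (hε : 0 < ε) :
    ∃ δ > 0, ∀ ζ : DiffForm n 2 U, ζ.SmoothOn univ → (∀ x, ζ.d x = 0) →
      DiffForm.JetLE (ζ - η₀) x₀ K 1 δ → ∀ τ : DiffForm n 1 U, τ.SmoothOn univ →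
      (∀ x ∉ (extChartAt 𝓘(ℝ, Model n) x₀).symm '' K, τ x = 0) → τ.JetLE x₀ K 2 δ →
      ∃ Φ : U ≃ₜ U, ContMDiff 𝓘(ℝ, Model n) 𝓘(ℝ, Model n) ∞ Φ ∧ (∀ x, |ρ (Φ x) - ρ x| ≤ ε) ∧
        DiffForm.pullback Φ (ζ + τ.d) = ζ := by
  set O := (extChartAt 𝓘(ℝ, Model n) x₀).target with hOdef
  have hO : IsOpen O := isOpen_extChartAt_target x₀
  have hpart : ∀ {y}, y ∈ O → y ∈ chartPart n x₀ (univ : Set U) := fun h => ⟨h, trivial⟩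
  have hsm : ∀ {k : ℕ} {β : DiffForm n k U}, β.SmoothOn univ → ∀ {y}, y ∈ O →
      ContDiffAt ℝ ∞ (β.inChart x₀) y := fun h _ hy => h.contDiffAt isOpen_univ (hpart hy)
  have hon : ∀ {k : ℕ} {β : DiffForm n k U}, β.SmoothOn univ → ContDiffOn ℝ ∞ (β.inChart x₀) O :=
    fun h _ hy => (hsm h hy).contDiffWithinAt
  have hbil : ∀ {β : DiffForm n 2 U}, β.SmoothOn univ →
      ContDiffOn ℝ ∞ (fun y => alternatingToBilin (Model n) (β.inChart x₀ y)) O := fun h =>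
    (alternatingToBilin (Model n)).contDiff.comp_contDiffOn (hon h)
  obtain ⟨r, hr, hrρ⟩ := exists_forall_dist_chartExtension_le hK hKt hρ hε
  obtain ⟨δ, hδ, H⟩ := exists_diffeo_pullback_eq hK hO hKt (hbil hη.smooth) (by
    intro y hy p hp
    set x := (extChartAt 𝓘(ℝ, Model n) x₀).symm y
    set A : Model n →L[ℝ] Model n :=
      mfderiv 𝓘(ℝ, Model n) 𝓘(ℝ, Model n) (extChartAt 𝓘(ℝ, Model n) x₀).symm y with hA
    have h1 : IsManifold 𝓘(ℝ, Model n) 1 U := .of_le (natCast_le_infty 1)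
    -- The inverse chart has an invertible differential, so nondegeneracy carries over to the
    -- coordinate expression.
    obtain ⟨B, hB1, hB2⟩ : ∃ B : Model n →L[ℝ] Model n, (∀ v, A (B v) = v) ∧ ∀ v, B (A v) = v := by
      have h2 := mfderivWithin_extChartAt_symm_comp_mfderiv_extChartAt (I := 𝓘(ℝ, Model n))
        (hKt hy)
      have h3 := mfderiv_extChartAt_comp_mfderivWithin_extChartAt_symm (I := 𝓘(ℝ, Model n))
        (hKt hy)
      rw [ModelWithCorners.range_eq_univ, mfderivWithin_univ] at h2 h3
      exact ⟨_, fun v => DFunLike.congr_fun h2 v, fun v => DFunLike.congr_fun h3 v⟩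
    have h2 : A p = 0 := by
      refine hη.nondegenerate x (A p) fun w => ?_
      have h3 := DFunLike.congr_fun hp (B w)
      change η₀ x (A ∘ ![p, B w]) = 0 at h3
      have h4 : A ∘ ![p, B w] = ![A p, w] := by
        funext i; fin_cases i
        · rfl
        · exact hB1 w
      exact (congrArg (fun v => η₀ x v) h4).symm.trans h3
    rw [← hB2 p, h2, map_zero]) hr
  -- Division by `C` compensates for the norms of the two conversion maps; the summand 1 keeps `C`
  -- positive.
  set C := ‖alternatingToBilin (Model n)‖ + ‖alternatingToDual (Model n)‖ + 1 with hC
  have hC0 : 0 < C := by positivity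
  have hCb : ‖alternatingToBilin (Model n)‖ * (δ / C) ≤ δ := by
    rw [mul_div_left_comm]
    refine mul_le_of_le_one_right hδ.le ((div_le_one hC0).2 ?_)
    rw [hC]; linarith [norm_nonneg (alternatingToDual (Model n))]
  have hCd : ‖alternatingToDual (Model n)‖ * (δ / C) ≤ δ := by
    rw [mul_div_left_comm]
    refine mul_le_of_le_one_right hδ.le ((div_le_one hC0).2 ?_)
    rw [hC]; linarith [norm_nonneg (alternatingToBilin (Model n))]
  refine ⟨δ / C, div_pos hδ hC0, fun ζ hζ hζd hζη τ hτ hτ0 hτb => ?_⟩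
  have hζ' : DiffForm.SmoothOn (ζ - η₀) univ := by
    have h2 := DiffForm.SmoothOn.add hζ (DiffForm.SmoothOn.smul (-1) hη.smooth)
    rwa [neg_one_smul, ← sub_eq_add_neg] at h2
  classical
  -- The coordinate expression of `τ` extended by zero; the extension is smooth because `τ` vanishes
  -- off the image of `K`.
  let θ : Model n → Model n →L[ℝ] ℝ := fun y =>
    if y ∈ O then alternatingToDual (Model n) (τ.inChart x₀ y) else 0
  have hθO : ∀ y ∈ O, θ =ᶠ[𝓝 y] fun z => alternatingToDual (Model n) (τ.inChart x₀ z) :=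
    fun y hy => Filter.eventually_of_mem (hO.mem_nhds hy) fun z hz => if_pos hz
  have hθK : ∀ y ∉ K, θ y = 0 := by
    intro y hy
    by_cases hyO : y ∈ O
    · have h1 : τ ((extChartAt 𝓘(ℝ, Model n) x₀).symm y) = 0 := by
        refine hτ0 _ ?_
        rintro ⟨z, hz, hzy⟩
        have : z = y := by
          rw [← (extChartAt 𝓘(ℝ, Model n) x₀).right_inv (hKt hz), hzy,
            (extChartAt 𝓘(ℝ, Model n) x₀).right_inv hyO]
        exact hy (this ▸ hz)
      have h2 : τ.inChart x₀ y = 0 := by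
        rw [DiffForm.inChart, h1]; rfl
      simp only [θ, if_pos hyO, h2, map_zero]
    · simp only [θ, if_neg hyO]
  have hdual : ∀ y ∈ O, ContDiffAt ℝ ∞ (fun z => alternatingToDual (Model n) (τ.inChart x₀ z)) y :=
    fun y hy => (alternatingToDual (Model n)).contDiff.contDiffAt.comp y (hsm hτ hy)
  have hθs : ContDiff ℝ ∞ θ := by
    rw [contDiff_iff_contDiffAt]
    intro y
    by_cases hy : y ∈ K
    · exact (hdual y (hKt hy)).congr_of_eventuallyEq (hθO y (hKt hy))
    · exact contDiffAt_const.congr_of_eventuallyEq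
        (Filter.eventually_of_mem (hK.isClosed.isOpen_compl.mem_nhds hy) hθK)
  have hθb : ∀ i ≤ 2, ∀ y ∈ K, ‖iteratedFDeriv ℝ i θ y‖ ≤ δ := by
    intro i hi y hy
    rw [((hθO y (hKt hy)).iteratedFDeriv ℝ i).self_of_nhds]
    exact (((alternatingToDual (Model n)).norm_iteratedFDeriv_comp_left (hsm hτ (hKt hy))
      (natCast_le_infty i)).trans (mul_le_mul_of_nonneg_left (hτb i hi y hy)
        (norm_nonneg _))).trans hCd
  have hab : ∀ i ≤ 1, ∀ y ∈ K, ‖iteratedFDeriv ℝ i (fun z =>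
      alternatingToBilin (Model n) (DiffForm.inChart x₀ (ζ - η₀) z)) y‖ ≤ δ := by
    intro i hi y hy
    exact (((alternatingToBilin (Model n)).norm_iteratedFDeriv_comp_left (hsm hζ' (hKt hy))
      (natCast_le_infty i)).trans (mul_le_mul_of_nonneg_left (hζη i hi y hy)
        (norm_nonneg _))).trans hCb
  have hsub : (fun z => alternatingToBilin (Model n) (DiffForm.inChart x₀ (ζ - η₀) z)) =
      fun z => alternatingToBilin (Model n) (ζ.inChart x₀ z) -
        alternatingToBilin (Model n) (η₀.inChart x₀ z) := by
    funext z
    rw [← map_sub]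
    rfl
  obtain ⟨φ, hφs, hφK, hφr, hφp⟩ := H (fun y => alternatingToBilin (Model n) (ζ.inChart x₀ y))
    (hbil hζ) (fun y _ p q => by
      simp only [alternatingToBilin_apply]
      exact (ζ.inChart x₀ y).apply_swap_two p q)
    (fun y hy u p q => by
      rw [← extDeriv_two_apply ((hsm hζ hy).differentiableAt (by simp)),
        ← DiffForm.inChart_d isOpen_univ hζ (hpart hy), DiffForm.inChart, hζd]
      rfl)
    (fun y hy => by
      constructor
      · have h1 := hab 0 (by norm_num) y hy
        rw [norm_iteratedFDeriv_zero] at h1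
        have h2 := congrFun hsub y
        rw [← h2]
        exact h1
      · have h1 := hab 1 le_rfl y hy
        rw [norm_iteratedFDeriv_one, hsub, fderiv_fun_sub] at h1
        · exact h1
        · exact ((hbil hζ).contDiffAt (hO.mem_nhds (hKt hy))).differentiableAt (by simp)
        · exact ((hbil hη.smooth).contDiffAt (hO.mem_nhds (hKt hy))).differentiableAt (by simp))
    θ hθs hθK (fun y hy => by
      refine ⟨?_, ?_, ?_⟩
      · rw [← norm_iteratedFDeriv_zero (𝕜 := ℝ)]; exact hθb 0 (by norm_num) y hy
      · rw [← norm_iteratedFDeriv_one]; exact hθb 1 (by norm_num) y hy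
      · rw [norm_fderiv_fderiv]; exact hθb 2 le_rfl y hy)
  obtain ⟨hm, -, -⟩ := φ.mapsTo_of_eq_self_off hφK
  have hΦs := contMDiff_chartExtension hK hKt hφK hm hφs
  refine ⟨chartExtensionHomeomorph x₀ hK hKt φ hφK, hΦs, hrρ φ hφK hm hφr, ?_⟩
  change DiffForm.pullback (chartExtension x₀ φ) (ζ + τ.d) = ζ
  funext x
  by_cases hx : x ∈ (extChartAt 𝓘(ℝ, Model n) x₀).source
  · have hy := (extChartAt 𝓘(ℝ, Model n) x₀).map_source hx
    set y := extChartAt 𝓘(ℝ, Model n) x₀ x with hydef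
    have hyx : (extChartAt 𝓘(ℝ, Model n) x₀).symm y = x := (extChartAt _ x₀).left_inv hx
    have hφy : φ y ∈ O := mem_target_of_mapsTo hKt hφK hm hy
    have hF : chartMap n (chartExtension x₀ φ) x₀ x₀ =ᶠ[𝓝 y] φ := by
      filter_upwards [hO.mem_nhds hy] with z hz
      simp only [chartMap, Function.comp_apply]
      rw [chartExtension_of_mem ((extChartAt _ x₀).map_target hz), (extChartAt _ x₀).right_inv hz,
        (extChartAt _ x₀).right_inv (mem_target_of_mapsTo hKt hφK hm hz)]
    have h1 := DiffForm.inChart_pullback (ζ + τ.d) (f := chartExtension x₀ φ) (x₀ := x₀) (x₁ := x₀)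
      hy (hΦs _) (by
        rw [hyx, chartExtension_of_mem hx]
        exact (extChartAt _ x₀).map_target hφy)
    rw [hF.fderiv_eq, hF.self_of_nhds, DiffForm.inChart_add, Pi.add_apply,
      DiffForm.inChart_d isOpen_univ hτ (hpart hφy)] at h1
    have h2 : (DiffForm.pullback (chartExtension x₀ φ) (ζ + τ.d)).inChart x₀ y =
        ζ.inChart x₀ y := by
      rw [h1]
      ext v
      rw [vec_two_eq v]
      have h3 := hφp y hy (v 0) (v 1)
      have h4 : extDerivOne θ (φ y) =
          extDerivOne (fun z => alternatingToDual (Model n) (τ.inChart x₀ z)) (φ y) := by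
        rw [extDerivOne, (hθO _ hφy).fderiv_eq, extDerivOne]
      rw [h4, ← extDeriv_one_apply ((hsm hτ hφy).differentiableAt (by simp))] at h3
      have h5 : (fderiv ℝ φ y : Model n → Model n) ∘ ![v 0, v 1] =
          ![fderiv ℝ φ y (v 0), fderiv ℝ φ y (v 1)] := by
        funext i; fin_cases i <;> rfl
      change (ζ.inChart x₀ (φ y) + extDeriv (τ.inChart x₀) (φ y))
        ((fderiv ℝ φ y : Model n → Model n) ∘ ![v 0, v 1]) = _
      rw [h5]
      exact h3
    rw [DiffForm.eq_inChart_compContinuousLinearMap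
      (DiffForm.pullback (chartExtension x₀ φ) (ζ + τ.d)) hx, h2]
    exact (ζ.eq_inChart_compContinuousLinearMap hx).symm
  -- Outside the chart, the map is the identity and `τ` vanishes near `x`.
  · have hxK : x ∉ (extChartAt 𝓘(ℝ, Model n) x₀).symm '' K := by
      rintro ⟨y, hy, rfl⟩
      exact hx ((extChartAt _ x₀).map_target (hKt hy))
    have hnhds := (isClosed_extChartAt_symm_image hK hKt).isOpen_compl.mem_nhds hxK
    have h1 : chartExtension x₀ φ =ᶠ[𝓝 x] id :=
      Filter.eventually_of_mem hnhds fun z hz => chartExtension_of_notMem_image hφK hz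
    have h2 : τ.d x = 0 := by
      rw [DiffForm.d_congr (τ := 0) (Filter.eventually_of_mem hnhds fun z hz => hτ0 z hz),
        DiffForm.d_zero]
    have h3 := DiffForm.compContinuousLinearMap_congr (ζ + τ.d) h1.self_of_nhds
      (A := mfderiv 𝓘(ℝ, Model n) 𝓘(ℝ, Model n) (chartExtension x₀ φ) x)
      (B := mfderiv 𝓘(ℝ, Model n) 𝓘(ℝ, Model n) id x) h1.mfderiv_eq
    have h4 := congrFun (DiffForm.pullback_id (ζ + τ.d)) x
    refine (h3.trans h4).trans ?_
    rw [Pi.add_apply, h2, add_zero]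

end ChartMoser

/-! ### Estimates for jets -/

section JetEstimates

variable {n k m : ℕ} {U : Type*} [TopologicalSpace U] [ChartedSpace (Model n) U]
  {x₀ : U} {K : Set (Model n)} {W : Set U} {θ τ : DiffForm n k U} {δ δ' : ℝ}

lemma DiffForm.JetLE.of_le (h : θ.JetLE x₀ K m δ) (hδ : δ ≤ δ') : θ.JetLE x₀ K m δ' :=
  fun i hi y hy => (h i hi y hy).trans hδ

lemma DiffForm.jetLE_zero (hδ : 0 ≤ δ) : DiffForm.JetLE (0 : DiffForm n k U) x₀ K m δ := by
  intro i _ y _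
  rw [DiffForm.inChart_zero]
  have h : iteratedFDeriv ℝ i (0 : Model n → Model n [⋀^Fin k]→L[ℝ] ℝ) y = 0 :=
    congrFun (iteratedFDeriv_fun_zero (𝕜 := ℝ) (n := i)) y
  rwa [h, norm_zero]

lemma DiffForm.JetLE.add (hW : IsOpen W) (hK : K ⊆ chartPart n x₀ W) (hθ : θ.SmoothOn W)
    (hτ : τ.SmoothOn W) (h : θ.JetLE x₀ K m δ) (h' : τ.JetLE x₀ K m δ') :
    DiffForm.JetLE (θ + τ) x₀ K m (δ + δ') := by
  intro i hi y hy
  rw [DiffForm.inChart_add, iteratedFDeriv_add_apply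
    ((hθ.contDiffAt hW (hK hy)).of_le (natCast_le_infty i))
    ((hτ.contDiffAt hW (hK hy)).of_le (natCast_le_infty i))]
  exact (norm_add_le _ _).trans (add_le_add (h i hi y hy) (h' i hi y hy))

lemma DiffForm.smoothOn_sum {ι : Type*} (s : Finset ι) {θ : ι → DiffForm n k U}
    (h : ∀ i ∈ s, (θ i).SmoothOn W) : DiffForm.SmoothOn (∑ i ∈ s, θ i) W := by
  classical
  induction s using Finset.induction_on with
  | empty => simpa using DiffForm.smoothOn_zero W
  | insert a s ha ih =>
    rw [Finset.sum_insert ha]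
    exact (h a (s.mem_insert_self a)).add (ih fun i hi => h i (Finset.mem_insert_of_mem hi))

lemma DiffForm.JetLE.sum {ι : Type*} (s : Finset ι) {θ : ι → DiffForm n k U} (hW : IsOpen W)
    (hK : K ⊆ chartPart n x₀ W) (hs : ∀ i ∈ s, (θ i).SmoothOn W)
    (h : ∀ i ∈ s, (θ i).JetLE x₀ K m δ) :
    DiffForm.JetLE (∑ i ∈ s, θ i) x₀ K m (s.card * δ) := by
  classical
  induction s using Finset.induction_on with
  | empty => simpa using DiffForm.jetLE_zero (n := n) (k := k) (x₀ := x₀) (K := K) le_rfl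
  | insert a s ha ih =>
    rw [Finset.sum_insert ha, Finset.card_insert_of_notMem ha]
    have h1 := DiffForm.JetLE.add hW hK (hs a (s.mem_insert_self a))
      (DiffForm.smoothOn_sum s fun i hi => hs i (Finset.mem_insert_of_mem hi))
      (h a (s.mem_insert_self a)) (ih (fun i hi => hs i (Finset.mem_insert_of_mem hi))
        fun i hi => h i (Finset.mem_insert_of_mem hi))
    refine h1.of_le (le_of_eq ?_)
    push_cast
    ring

lemma DiffForm.JetLE.d [IsManifold 𝓘(ℝ, Model n) ∞ U] (hW : IsOpen W)
    (hK : K ⊆ chartPart n x₀ W) (hθ : θ.SmoothOn W) (h : θ.JetLE x₀ K (m + 1) δ) :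
    θ.d.JetLE x₀ K m
      (‖ContinuousAlternatingMap.alternatizeUncurryFinCLM ℝ (Model n) ℝ (n := k)‖ * δ) := by
  intro i hi y hy
  have hev : θ.d.inChart x₀ =ᶠ[𝓝 y]
      ContinuousAlternatingMap.alternatizeUncurryFinCLM ℝ (Model n) ℝ ∘ fderiv ℝ (θ.inChart x₀) :=
    Filter.eventually_of_mem ((isOpen_chartPart x₀ hW).mem_nhds (hK hy))
      fun z hz => DiffForm.inChart_d hW hθ hz
  rw [(hev.iteratedFDeriv ℝ i).self_of_nhds]
  have h1 : ContDiffAt ℝ ∞ (fderiv ℝ (θ.inChart x₀)) y :=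
    (hθ.contDiffAt hW (hK hy)).fderiv_right (m := ∞) (by simp)
  refine (ContinuousLinearMap.norm_iteratedFDeriv_comp_left _ h1 (natCast_le_infty i)).trans ?_
  rw [norm_iteratedFDeriv_fderiv]
  exact mul_le_mul_of_nonneg_left (h (i + 1) (by omega) y hy) (norm_nonneg _)

lemma exists_jetLE_smulFun [IsManifold 𝓘(ℝ, Model n) ∞ U] (k m : ℕ) (hW : IsOpen W)
    (hKc : IsCompact K) (hK : K ⊆ chartPart n x₀ W) {χ : U → ℝ}
    (hχ : ContMDiff 𝓘(ℝ, Model n) 𝓘(ℝ, ℝ) ∞ χ) :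
    ∃ C : ℝ, 0 ≤ C ∧ ∀ θ : DiffForm n k U, θ.SmoothOn W → ∀ δ, θ.JetLE x₀ K m δ →
      (θ.smulFun χ).JetLE x₀ K m (C * δ) := by
  have hO := isOpen_chartPart (n := n) x₀ hW
  have hχs : ContDiffOn ℝ ∞ (fun y => χ ((extChartAt 𝓘(ℝ, Model n) x₀).symm y))
      (chartPart n x₀ W) := (contDiffOn_comp_extChartAt_symm hχ x₀).mono fun _ h => h.1
  have hb : ∀ i : ℕ, ∃ B, 0 ≤ B ∧ ∀ y ∈ K, ‖iteratedFDerivWithin ℝ i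
      (fun y => χ ((extChartAt 𝓘(ℝ, Model n) x₀).symm y)) (chartPart n x₀ W) y‖ ≤ B := fun i => by
    obtain ⟨B, hB⟩ := hKc.exists_bound_of_continuousOn
      ((hχs.continuousOn_iteratedFDerivWithin (natCast_le_infty i) hO.uniqueDiffOn).mono hK)
    exact ⟨max B 0, le_max_right _ _, fun y hy => (hB y hy).trans (le_max_left _ _)⟩
  choose B hB0 hB using hb
  -- Leibniz' rule: the binomial coefficients of order `i ≤ m` add up to at most `2 ^ m`, and each
  -- derivative of `χ` is bounded by the sum of all the bounds.
  refine ⟨2 ^ m * ∑ i ∈ Finset.range (m + 1), B i,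
    mul_nonneg (by positivity) (Finset.sum_nonneg fun i _ => hB0 i), fun θ hθ δ h i hi y hy => ?_⟩
  have hδ : 0 ≤ δ := (norm_nonneg _).trans (h i hi y hy)
  have h1 := norm_iteratedFDerivWithin_smul_le hχs (hθ x₀) hO.uniqueDiffOn (hK hy)
    (natCast_le_infty i)
  rw [iteratedFDerivWithin_of_isOpen i hO (hK hy)] at h1
  refine h1.trans ?_
  calc ∑ j ∈ Finset.range (i + 1), (i.choose j : ℝ) * ‖iteratedFDerivWithin ℝ j
        (fun y => χ ((extChartAt 𝓘(ℝ, Model n) x₀).symm y)) (chartPart n x₀ W) y‖ *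
        ‖iteratedFDerivWithin ℝ (i - j) (θ.inChart x₀) (chartPart n x₀ W) y‖
      ≤ ∑ j ∈ Finset.range (i + 1), (i.choose j : ℝ) * (∑ i ∈ Finset.range (m + 1), B i) * δ := by
        refine Finset.sum_le_sum fun j hj => ?_
        have h2 : B j ≤ ∑ i ∈ Finset.range (m + 1), B i :=
          Finset.single_le_sum (f := B) (fun i _ => hB0 i)
            (Finset.mem_range.2 (by have := Finset.mem_range.1 hj; omega))
        rw [iteratedFDerivWithin_of_isOpen (i - j) hO (hK hy)]
        have h3 := h (i - j) (by omega) y hy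
        have h4 := (hB j y hy).trans h2
        have h5 := (norm_nonneg _).trans h4
        gcongr
    _ = 2 ^ i * (∑ i ∈ Finset.range (m + 1), B i) * δ := by
        rw [← Finset.sum_mul, ← Finset.sum_mul, ← Nat.cast_sum, Nat.sum_range_choose]
        push_cast
        ring
    _ ≤ 2 ^ m * (∑ i ∈ Finset.range (m + 1), B i) * δ := by
        have h2 : 0 ≤ ∑ i ∈ Finset.range (m + 1), B i := Finset.sum_nonneg fun i _ => hB0 i
        have h3 : (2 : ℝ) ^ i ≤ 2 ^ m := pow_le_pow_right₀ (by norm_num) hi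
        gcongr

end JetEstimates

/-! ### Moser's method for sums of forms supported in charts -/

section Moser

variable {n : ℕ} {U : Type*} [TopologicalSpace U] [ChartedSpace (Model n) U]
  [IsManifold 𝓘(ℝ, Model n) ∞ U] [T2Space U]

/-- Moser's method: adding the exterior derivatives of finitely many small `1`-forms supported in
charts does not change a symplectic form, up to a small diffeomorphism. -/
theorem exists_homeomorph_pullback_add_d_sum_eq {η₀ : DiffForm n 2 U} (hη : IsSymplectic η₀)
    {ι : Type*} (c : ι → U) {K : ι → Set (Model n)} {ρ : U → ℝ} (hρ : Continuous ρ) (s : Finset ι)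
    (hK : ∀ i ∈ s, IsCompact (K i) ∧ K i ⊆ (extChartAt 𝓘(ℝ, Model n) (c i)).target) :
    ∀ ε > 0, ∃ δ > 0, ∀ τ : ι → DiffForm n 1 U, (∀ i ∈ s, (τ i).SmoothOn univ) →
      (∀ i ∈ s, ∀ x ∉ (extChartAt 𝓘(ℝ, Model n) (c i)).symm '' K i, τ i x = 0) →
      (∀ i ∈ s, ∀ j ∈ s, (τ i).JetLE (c j) (K j) 2 δ) →
      ∃ Φ : U ≃ₜ U, ContMDiff 𝓘(ℝ, Model n) 𝓘(ℝ, Model n) ∞ Φ ∧ (∀ x, |ρ (Φ x) - ρ x| ≤ ε) ∧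
        DiffForm.pullback Φ (η₀ + DiffForm.d (∑ i ∈ s, τ i)) = η₀ := by
  classical
  induction s using Finset.induction_on with
  | empty =>
    intro ε hε
    refine ⟨1, one_pos, fun τ _ _ _ => ⟨Homeomorph.refl U, contMDiff_id, fun x => by simpa using hε.le,
      ?_⟩⟩
    have h0 : DiffForm.d (0 : DiffForm n 1 U) = 0 := funext DiffForm.d_zero
    rw [Finset.sum_empty, h0, add_zero]
    exact DiffForm.pullback_id η₀
  | insert a s ha ih =>
    intro ε hε
    obtain ⟨δ₁, hδ₁, H₁⟩ := ih (fun i hi => hK i (Finset.mem_insert_of_mem hi)) (ε / 2)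
      (half_pos hε)
    obtain ⟨hKa, hKat⟩ := hK a (s.mem_insert_self a)
    obtain ⟨δ₂, hδ₂, H₂⟩ := exists_homeomorph_pullback_eq hη (c a) hKa hKat hρ (half_pos hε)
    set C := ‖ContinuousAlternatingMap.alternatizeUncurryFinCLM ℝ (Model n) ℝ (n := 1)‖ with hC
    have hC0 : 0 ≤ C := norm_nonneg _
    have hD : 0 < C * s.card + 1 := by positivity
    -- `δ₁` serves the induction hypothesis and `δ₂` the new form `τ a`; the quotient makes the
    -- derivative of the previous sum `δ₂`-small up to first order, since d loses one order and
    -- costs a factor `C`.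
    refine ⟨min δ₁ (min δ₂ (δ₂ / (C * s.card + 1))), lt_min hδ₁ (lt_min hδ₂ (div_pos hδ₂ hD)),
      fun τ hτ hτ0 hτb => ?_⟩
    have hins : ∀ {i}, i ∈ s → i ∈ insert a s := fun hi => Finset.mem_insert_of_mem hi
    have haa := s.mem_insert_self a
    obtain ⟨Φ, hΦ, hΦρ, hΦp⟩ := H₁ τ (fun i hi => hτ i (hins hi)) (fun i hi => hτ0 i (hins hi))
      (fun i hi j hj => (hτb i (hins hi) j (hins hj)).of_le (min_le_left _ _))
    have hss : DiffForm.SmoothOn (∑ i ∈ s, τ i) univ :=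
      DiffForm.smoothOn_sum s fun i hi => hτ i (hins hi)
    have hKp : K a ⊆ chartPart n (c a) (univ : Set U) := fun y hy => ⟨hKat hy, trivial⟩
    -- The base form is now `η₀` plus the earlier perturbations. For this reason the result in one
    -- chart is uniform over closed forms near `η₀`.
    obtain ⟨Ψ, hΨ, hΨρ, hΨp⟩ := H₂ (η₀ + DiffForm.d (∑ i ∈ s, τ i))
      (hη.smooth.add (hss.d isOpen_univ))
      (fun x => by
        rw [DiffForm.d_add isOpen_univ hη.smooth (hss.d isOpen_univ) trivial, hη.closed,
          DiffForm.d_d isOpen_univ hss trivial, add_zero])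
      (by
        rw [add_sub_cancel_left]
        refine (DiffForm.JetLE.d isOpen_univ hKp hss (DiffForm.JetLE.sum s isOpen_univ hKp
          (fun i hi => hτ i (hins hi)) fun i hi => hτb i (hins hi) a haa)).of_le ?_
        calc C * (s.card * min δ₁ (min δ₂ (δ₂ / (C * s.card + 1))))
            ≤ C * (s.card * (δ₂ / (C * s.card + 1))) := by
              have := (min_le_right δ₁ (min δ₂ (δ₂ / (C * s.card + 1)))).trans (min_le_right _ _)
              gcongr
          _ = (C * s.card / (C * s.card + 1)) * δ₂ := by ring
          _ ≤ δ₂ := mul_le_of_le_one_left hδ₂.le ((div_le_one hD).2 (by linarith)))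
      (τ a) (hτ a haa) (hτ0 a haa)
      ((hτb a haa a haa).of_le ((min_le_right _ _).trans (min_le_left _ _)))
    refine ⟨Φ.trans Ψ, hΨ.comp hΦ, fun x => ?_, ?_⟩
    · have h1 := abs_sub_le (ρ (Ψ (Φ x))) (ρ (Φ x)) (ρ x)
      have h2 := hΨρ (Φ x)
      have h3 := hΦρ x
      change |ρ (Ψ (Φ x)) - ρ x| ≤ ε
      linarith
    -- Pulling back by `Ψ` removes the last summand, then pulling back by `Φ` removes the earlier
    -- ones.
    · have h1 : η₀ + DiffForm.d (∑ i ∈ insert a s, τ i) =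
          η₀ + DiffForm.d (∑ i ∈ s, τ i) + (τ a).d := by
        funext x
        rw [Finset.sum_insert ha]
        simp only [Pi.add_apply]
        rw [DiffForm.d_add isOpen_univ (hτ a haa) hss trivial]
        abel
      rw [h1]
      funext x
      have h2 := DiffForm.pullback_comp (η₀ + DiffForm.d (∑ i ∈ s, τ i) + (τ a).d)
        (hΨ.mdifferentiable (by simp) (Φ x)) (hΦ.mdifferentiable (by simp) x)
      refine h2.trans ?_
      rw [hΨp, hΦp]

end Moser

/-! ### Neighbourhoods of compact sets and cutoffs -/

section Localization

open TopologicalSpace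

/-- Compact subsets of second countable spaces have countably many open neighbourhoods that are
cofinal. -/
theorem IsCompact.exists_countable_nhds_basis {X : Type*} [TopologicalSpace X]
    [SecondCountableTopology X] {V : Set X} (hV : IsCompact V) {W₀ : Set X} (hW₀ : IsOpen W₀)
    (hVW : V ⊆ W₀) : ∃ 𝒲 : Set (Opens X), 𝒲.Countable ∧
      (∀ W ∈ 𝒲, V ⊆ W ∧ (W : Set X) ⊆ W₀) ∧ ∀ O, IsOpen O → V ⊆ O → ∃ W ∈ 𝒲, (W : Set X) ⊆ O := by
  -- Finite unions of basic open sets, cut down to `W₀`. They are open already; the interior only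
  -- supplies the bundled form.
  let 𝒲' : Set (Opens X) := (fun F : Set (Set X) => (⟨interior (⋃₀ F ∩ W₀), isOpen_interior⟩ : Opens X)) ''
    {F | F.Finite ∧ F ⊆ countableBasis X}
  have h𝒲' : 𝒲'.Countable :=
    (countable_ofPred_finite_subset (countable_countableBasis X)).image _
  refine ⟨{W ∈ 𝒲' | V ⊆ W ∧ (W : Set X) ⊆ W₀}, h𝒲'.mono fun W h => h.1, fun W h => h.2,
    fun O hO hVO => ?_⟩
  have hb : ∀ x, ∃ b, x ∈ V → b ∈ countableBasis X ∧ x ∈ b ∧ b ⊆ O ∩ W₀ := fun x => by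
    by_cases hx : x ∈ V
    · obtain ⟨b, h⟩ := (isBasis_countableBasis X).exists_subset_of_mem_open
        (show x ∈ O ∩ W₀ from ⟨hVO hx, hVW hx⟩) (hO.inter hW₀)
      exact ⟨b, fun _ => h⟩
    · exact ⟨∅, fun h => absurd h hx⟩
  choose b hb using hb
  obtain ⟨t, ht, hVt⟩ := hV.elim_nhds_subcover b fun x hx =>
    ((isBasis_countableBasis X).isOpen (hb x hx).1).mem_nhds (hb x hx).2.1
  have hsub : ⋃₀ (b '' (t : Set X)) ⊆ O ∩ W₀ := by
    rintro y ⟨_, ⟨x, hx, rfl⟩, hy⟩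
    exact (hb x (ht x hx)).2.2 hy
  have hop : IsOpen (⋃₀ (b '' (t : Set X)) ∩ W₀) := by
    refine (isOpen_sUnion ?_).inter hW₀
    rintro _ ⟨x, hx, rfl⟩
    exact (isBasis_countableBasis X).isOpen (hb x (ht x hx)).1
  refine ⟨⟨interior (⋃₀ (b '' (t : Set X)) ∩ W₀), isOpen_interior⟩,
    ⟨⟨_, ⟨t.finite_toSet.image b, ?_⟩, rfl⟩, ?_, ?_⟩, ?_⟩
  · rintro _ ⟨x, hx, rfl⟩
    exact (hb x (ht x hx)).1
  · intro x hx
    change x ∈ interior _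
    rw [hop.interior_eq]
    obtain ⟨y, hy, hxy⟩ := mem_iUnion₂.1 (hVt hx)
    exact ⟨⟨_, ⟨y, hy, rfl⟩, hxy⟩, hVW hx⟩
  · exact interior_subset.trans inter_subset_right
  · exact interior_subset.trans (inter_subset_left.trans (hsub.trans inter_subset_left))

variable {n k : ℕ} {U : Type*} [TopologicalSpace U] [ChartedSpace (Model n) U]

lemma IsSymplectic.smul {η : DiffForm n 2 U} (hη : IsSymplectic η) {α : ℝ} (hα : α ≠ 0) :
    IsSymplectic (α • η) where
  smooth := hη.smooth.smul α
  closed x := by rw [DiffForm.d_smul, hη.closed, smul_zero]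
  nondegenerate x v h := by
    refine hη.nondegenerate x v fun w => ?_
    have h1 := h w
    change α * η x ![v, w] = 0 at h1
    exact (mul_eq_zero.1 h1).resolve_left hα

/-- Near a point outside `W` the function vanishes, so the values of `θ` there do not matter. -/
lemma DiffForm.smoothOn_univ_smulFun [IsManifold 𝓘(ℝ, Model n) ∞ U] {χ : U → ℝ}
    (hχ : ContMDiff 𝓘(ℝ, Model n) 𝓘(ℝ, ℝ) ∞ χ) {W : Set U} (hW : IsOpen W) (hsupp : tsupport χ ⊆ W)
    {θ : DiffForm n k U} (hθ : θ.SmoothOn W) : (θ.smulFun χ).SmoothOn univ := by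
  refine DiffForm.smoothOn_of_forall_exists fun x _ => ⟨x, mem_extChartAt_source x, ?_⟩
  by_cases hx : x ∈ W
  · exact (hθ.smulFun hχ).contDiffAt hW (extChartAt_mem_chartPart (mem_extChartAt_source x) hx)
  · have h1 : ∀ᶠ z in 𝓝 x, χ z = 0 := by
      filter_upwards [(isClosed_tsupport χ).isOpen_compl.mem_nhds fun h => hx (hsupp h)] with z hz
      exact image_eq_zero_of_notMem_tsupport hz
    have h2 := (continuousAt_extChartAt_symm (I := 𝓘(ℝ, Model n)) x).tendsto
    rw [extChartAt_to_inv] at h2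
    refine (contDiffAt_const (c := 0)).congr_of_eventuallyEq ?_
    filter_upwards [h2.eventually h1] with y hy
    rw [DiffForm.inChart_smulFun, hy, zero_smul]

/-- Closed forms near a set with vanishing cohomology are exact near it. -/
lemma exists_primitive_of_subsingleton {V : Set U} (hH : Subsingleton (deRhamCohomology n k V))
    {β : DiffForm n (k + 1) U} (hβ : β ∈ closedNear n (k + 1) V) : β ∈ exactNear n k V := by
  let Q := (exactNear n k V).submoduleOf (closedNear n (k + 1) V)
  have : Subsingleton (closedNear n (k + 1) V ⧸ Q) := hH
  have h1 : Q = ⊤ := Submodule.Quotient.subsingleton_iff.1 this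
  have h2 : (⟨β, hβ⟩ : closedNear n (k + 1) V) ∈ Q := by rw [h1]; trivial
  exact h2

end Localization

/-! ### Persistence of symplectic embeddings -/

section Stability

open TopologicalSpace

variable {n : ℕ} {U : Type*} [TopologicalSpace U] [ChartedSpace (Model n) U]
  [IsManifold 𝓘(ℝ, Model n) ∞ U] [T2Space U] [SecondCountableTopology U]

/-- Moser stability near a compact set: a symplectic form changes only by a diffeomorphism, close
to the identity, if one adds the exterior derivative of a small `1`-form defined near a compact
set, as far as the form near `V` is concerned. -/
theorem exists_homeomorph_pullback_add_d_eq {η₀ : DiffForm n 2 U} (hη : IsSymplectic η₀)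
    {ι : Type*} (c : ι → U) (hc : ∀ x, ∃ i, x ∈ (extChartAt 𝓘(ℝ, Model n) (c i)).source)
    {V W : Set U} (hV : IsCompact V) (hW : IsOpen W) (hVW : V ⊆ W) :
    ∃ (s : Finset ι) (K : ι → Set (Model n)),
      (∀ i ∈ s, IsCompact (K i) ∧ K i ⊆ chartPart n (c i) W) ∧ ∃ ε > 0,
      ∀ σ : DiffForm n 1 U, σ.SmoothOn W → (∀ i ∈ s, σ.JetLE (c i) (K i) 2 ε) →
      ∃ (Φ : U ≃ₜ U) (O : Set U), ContMDiff 𝓘(ℝ, Model n) 𝓘(ℝ, Model n) ∞ Φ ∧ IsOpen O ∧ V ⊆ O ∧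
        MapsTo Φ O W ∧ ∀ x ∈ O, DiffForm.pullback Φ (η₀ + σ.d) x = η₀ x := by
  classical
  have : LocallyCompactSpace U := ChartedSpace.locallyCompactSpace (Model n) U
  obtain ⟨L, hL, hVL, hLW⟩ := exists_compact_between hV hW hVW
  choose i hi using hc
  have hball : ∀ p : U, ∃ r : ℝ, 0 < r ∧ (p ∈ W → Metric.closedBall
      (extChartAt 𝓘(ℝ, Model n) (c (i p)) p) r ⊆ chartPart n (c (i p)) W) := fun p => by
    by_cases hp : p ∈ W
    · obtain ⟨r, hr, h⟩ := Metric.nhds_basis_closedBall.mem_iff.1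
        ((isOpen_chartPart (n := n) (c (i p)) hW).mem_nhds (extChartAt_mem_chartPart (hi p) hp))
      exact ⟨r, hr, fun _ => h⟩
    · exact ⟨1, one_pos, fun h => absurd h hp⟩
  choose r hr hrW using hball
  let B : U → Set (Model n) := fun p =>
    Metric.closedBall (extChartAt 𝓘(ℝ, Model n) (c (i p)) p) (r p)
  let G : U → Set U := fun p => (extChartAt 𝓘(ℝ, Model n) (c (i p))).source ∩
    extChartAt 𝓘(ℝ, Model n) (c (i p)) ⁻¹' Metric.ball (extChartAt 𝓘(ℝ, Model n) (c (i p)) p) (r p)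
  have hG : ∀ p, IsOpen (G p) := fun p =>
    (continuousOn_extChartAt (c (i p))).isOpen_inter_preimage (isOpen_extChartAt_source _)
      Metric.isOpen_ball
  have hpG : ∀ p, p ∈ G p := fun p => ⟨hi p, Metric.mem_ball_self (hr p)⟩
  have hGB : ∀ p, G p ⊆ (extChartAt 𝓘(ℝ, Model n) (c (i p))).symm '' B p := fun p x hx =>
    ⟨_, Metric.ball_subset_closedBall hx.2, (extChartAt _ (c (i p))).left_inv hx.1⟩
  obtain ⟨t, htL, hLt⟩ := hL.elim_nhds_subcover G fun p _ => (hG p).mem_nhds (hpG p)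
  have htW : ∀ p ∈ t, B p ⊆ chartPart n (c (i p)) W := fun p hp => hrW p (hLW (htL p hp))
  have hGW : ∀ p ∈ t, G p ⊆ W := fun p hp x hx => by
    obtain ⟨y, hy, rfl⟩ := hGB p hx
    exact (htW p hp hy).2
  -- The functions sum to 1 on `L` only; there the cut off pieces of `σ` add up to `σ`.
  obtain ⟨f, hf⟩ := SmoothPartitionOfUnity.exists_isSubordinate 𝓘(ℝ, Model n) hL.isClosed
    (fun p : t => G p) (fun p => hG p) (by
      intro x hx
      obtain ⟨p, hp, hxp⟩ := mem_iUnion₂.1 (hLt hx)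
      exact mem_iUnion.2 ⟨⟨p, hp⟩, hxp⟩)
  -- As `ρ` is 0 on `V` and 1 off the interior of `L`, a diffeomorphism that changes `ρ` by at most
  -- 1/2 maps `V` into the interior of `L`.
  obtain ⟨ρ, hρ0, hρ1, -⟩ := exists_continuous_zero_one_of_isCompact hV
    isOpen_interior.isClosed_compl (disjoint_compl_right_iff_subset.2 hVL)
  obtain ⟨δ, hδ, H⟩ := exists_homeomorph_pullback_add_d_sum_eq hη (fun p : t => c (i p))
    (K := fun p : t => B p) ρ.continuous Finset.univ
    (fun p _ => ⟨isCompact_closedBall _ _, fun y hy => (htW p p.2 hy).1⟩) (1 / 2) (by norm_num)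
  have hC : ∀ p q : t, ∃ C : ℝ, 0 ≤ C ∧ ∀ θ : DiffForm n 1 U, θ.SmoothOn W → ∀ δ,
      θ.JetLE (c (i q)) (B q) 2 δ → (θ.smulFun (f p)).JetLE (c (i q)) (B q) 2 (C * δ) := fun p q =>
    exists_jetLE_smulFun 1 2 hW (isCompact_closedBall _ _) (htW q q.2) (f p).contMDiff
  choose C hC0 hC using hC
  set D := ∑ p, ∑ q, C p q with hD
  have hCD : ∀ p q, C p q ≤ D := fun p q =>
    (Finset.single_le_sum (f := C p) (fun q _ => hC0 p q) (Finset.mem_univ q)).trans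
      (Finset.single_le_sum (f := fun p => ∑ q, C p q)
        (fun p _ => Finset.sum_nonneg fun q _ => hC0 p q) (Finset.mem_univ p))
  have hD0 : 0 ≤ D := Finset.sum_nonneg fun p _ => Finset.sum_nonneg fun q _ => hC0 p q
  -- Several balls may lie in the same chart, so their union is attached to its index. Division by
  -- `D + 1` absorbs the loss from multiplying with the cutoffs.
  refine ⟨t.image i, fun j => ⋃ p ∈ {p ∈ t | i p = j}, B p, fun j _ => ⟨?_, ?_⟩, δ / (D + 1),
    by positivity, fun σ hσ hσb => ?_⟩
  · exact Finset.isCompact_biUnion _ fun p _ => isCompact_closedBall _ _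
  · refine iUnion₂_subset fun p hp => ?_
    obtain ⟨hpt, rfl⟩ := Finset.mem_filter.1 hp
    exact htW p hpt
  have hσB : ∀ q : t, σ.JetLE (c (i q)) (B q) 2 (δ / (D + 1)) := fun q m hm y hy =>
    hσb (i q) (Finset.mem_image_of_mem i q.2) m hm y
      (mem_iUnion₂.2 ⟨q, Finset.mem_filter.2 ⟨q.2, rfl⟩, hy⟩)
  obtain ⟨Φ, hΦ, hΦρ, hΦp⟩ := H (fun p => σ.smulFun (f p))
    (fun p _ => DiffForm.smoothOn_univ_smulFun (f p).contMDiff hW ((hf p).trans (hGW p p.2)) hσ)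
    (fun p _ x hx => by
      have h1 : f p x = 0 := by
        by_contra h
        exact hx (hGB p (hf p (subset_tsupport _ h)))
      change f p x • σ x = 0
      rw [h1, zero_smul])
    (fun p _ q _ => (hC p q σ hσ _ (hσB q)).of_le (by
      calc C p q * (δ / (D + 1)) ≤ D * (δ / (D + 1)) := by gcongr; exact hCD p q
        _ = (D / (D + 1)) * δ := by ring
        _ ≤ δ := mul_le_of_le_one_left hδ.le ((div_le_one (by positivity)).2 (by linarith))))
  refine ⟨Φ, Φ ⁻¹' interior L, hΦ, isOpen_interior.preimage Φ.continuous, fun x hx => ?_,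
    fun x hx => hLW (interior_subset hx), fun x hx => ?_⟩
  · by_contra h
    have h1 : ρ (Φ x) = 1 := hρ1 h
    have h2 : ρ x = 0 := hρ0 hx
    have h3 := hΦρ x
    rw [h1, h2] at h3
    norm_num at h3
  -- In the interior of `L` the sum of the pieces agrees with `σ` near `Φ x`, hence so do the
  -- exterior derivatives.
  · have h1 : (σ.d) (Φ x) = DiffForm.d (∑ p : t, σ.smulFun (f p)) (Φ x) := by
      refine DiffForm.d_congr ?_
      filter_upwards [isOpen_interior.mem_nhds hx] with z hz
      have h2 := f.sum_eq_one (interior_subset hz)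
      rw [finsum_eq_sum_of_fintype] at h2
      have h3 : (∑ p : t, σ.smulFun (f p)) z = ∑ p : t, f p z • σ z := by
        rw [Finset.sum_apply]; rfl
      rw [h3, ← Finset.sum_smul, h2, one_smul]
    have h4 := congrFun hΦp x
    rw [← h4]
    simp only [DiffForm.pullback, Pi.add_apply, h1]

/-- Symplectic embeddings of a compact set without second cohomology persist under small
perturbations of the form on the target. -/
theorem SymplecticallyEmbeds.eventually {M : Type*} [TopologicalSpace M] [ChartedSpace (Model n) M]
    [IsManifold 𝓘(ℝ, Model n) ∞ M] [CompactSpace M] {η : DiffForm n 2 U} (hη : IsSymplectic η)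
    {V : Set U} (hV : IsCompact V) (hH : Subsingleton (deRhamCohomology n 1 V))
    {θ₀ : SmoothForm n 2 M} (hθ₀ : ∀ x, θ₀.1.d x = 0) (h : SymplecticallyEmbeds V η θ₀.1) :
    ∀ᶠ θ in 𝓝 θ₀, (∀ x, θ.1.d x = 0) → SymplecticallyEmbeds V η θ.1 := by
  obtain ⟨W₀, f, hW₀, hVW₀, hf, hfe, hfη⟩ := h
  obtain ⟨𝒲, h𝒲c, h𝒲, h𝒲O⟩ := hV.exists_countable_nhds_basis hW₀ hVW₀
  have : Countable 𝒲 := h𝒲c.to_subtype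
  obtain ⟨S, hS, hSU⟩ := countable_cover_nhds
    (f := fun x : U => (extChartAt 𝓘(ℝ, Model n) x).source) fun x => extChartAt_source_mem_nhds x
  have : Countable S := hS.to_subtype
  have hc : ∀ x : U, ∃ i : S, x ∈ (extChartAt 𝓘(ℝ, Model n) (i : U)).source := fun x => by
    have hx : x ∈ ⋃ x ∈ S, (extChartAt 𝓘(ℝ, Model n) x).source := by rw [hSU]; trivial
    obtain ⟨i, hi, hxi⟩ := mem_iUnion₂.1 hx
    exact ⟨⟨i, hi⟩, hxi⟩
  -- The neighbourhood `j` is fixed before the compact sets and `ε`, which the stability theorem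
  -- then chooses in terms of `j`.
  obtain ⟨j, hj⟩ := exists_small_primitive (k := 1) (fun i : S => (i : U)) hc
    (fun W : 𝒲 => (W : Opens U)) f fun β hβ hβd => by
      have h1 : β.pullback f ∈ closedNear n 2 V := by
        refine ⟨W₀, hW₀, hVW₀, hβ.pullback isOpen_univ hW₀ hf (mapsTo_univ _ _), fun x hx => ?_⟩
        rw [DiffForm.d_pullback isOpen_univ hβ hW₀ hf (mapsTo_univ _ _) hx]
        simp only [DiffForm.pullback, hβd]
        ext v
        simp
      obtain ⟨O, hO, hVO, σ, hσ, hσd⟩ := exists_primitive_of_subsingleton hH h1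
      obtain ⟨W, hW, hWO⟩ := h𝒲O O hO hVO
      exact ⟨⟨W, hW⟩, σ, hσ.mono hWO, fun x hx => hσd x (hWO hx)⟩
  obtain ⟨hVj, hjW₀⟩ := h𝒲 j j.2
  obtain ⟨s, K, hK, ε, hε, H⟩ := exists_homeomorph_pullback_add_d_eq hη (fun i : S => (i : U)) hc hV
    (j : Opens U).isOpen hVj
  filter_upwards [hj s K hK ε hε θ₀ hθ₀] with θ hθ hθd
  obtain ⟨σ, hσ, hσd, hσb⟩ := hθ hθd
  obtain ⟨Φ, O, hΦ, hO, hVO, hΦO, hΦp⟩ := H σ hσ fun i hi m hm y hy => hσb i hi m hm y hy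
  have hΦW₀ : MapsTo Φ O W₀ := fun x hx => hjW₀ (hΦO hx)
  refine ⟨O, f ∘ Φ, hO, hVO, hf.comp hΦ.contMDiffOn hΦW₀, ?_, fun x hx => ?_⟩
  · have h1 : IsEmbedding (fun x : O => (⟨Φ x, hΦW₀ x.2⟩ : W₀)) :=
      (Φ.isEmbedding.comp IsEmbedding.subtypeVal).codRestrict W₀ fun x => hΦW₀ x.2
    exact hfe.comp h1
  · have hfx : ContMDiffAt 𝓘(ℝ, Model n) 𝓘(ℝ, Model n) ∞ f (Φ x) :=
      hf.contMDiffAt (hW₀.mem_nhds (hΦW₀ hx))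
    rw [DiffForm.pullback_comp θ.1 (hfx.mdifferentiableAt (by simp))
      (hΦ.mdifferentiable (by simp) x), ← hΦp x hx]
    -- On the chosen neighbourhood f^*θ = f^*θ₀ + dσ = η + dσ, which `Φ` pulls back to `η`.
    have h2 : θ.1.pullback f (Φ x) = (η + σ.d) (Φ x) := by
      rw [Pi.add_apply, hσd _ (hΦO hx), hfη _ (hΦW₀ hx)]
      abel
    simp only [DiffForm.pullback] at h2 ⊢
    rw [h2]

/-- The packing constant is lower semicontinuous on any set of symplectic forms of volume `1`. -/
theorem lowerSemicontinuousOn_packingConstant {M : Type*} [TopologicalSpace M]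
    [ChartedSpace (Model n) M] [IsManifold 𝓘(ℝ, Model n) ∞ M] [CompactSpace M] [MeasurableSpace M]
    [MeasurableSpace U] {η : DiffForm n 2 U} (hη : IsSymplectic η) {V : Set U} (hV : IsCompact V)
    (hH : Subsingleton (deRhamCohomology n 1 V)) {A : Set (SmoothForm n 2 M)}
    (hA : ∀ θ ∈ A, IsSymplectic θ.1) (hA1 : ∀ θ ∈ A, symplecticVolume θ.1 univ = 1) :
    LowerSemicontinuousOn (fun θ : SmoothForm n 2 M => packingConstant θ.1 η V) A := by
  intro θ₀ hθ₀ y hy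
  -- With the volume of the target equal to 1, the form enters only through the set of admissible
  -- `α`.
  have hone : ∀ θ ∈ A, packingConstant θ.1 η V =
      ⨆ α ∈ {α : ℝ | 0 < α ∧ SymplecticallyEmbeds V (α • η) θ.1},
        (symplecticVolume (α • η) V : EReal) := fun θ hθ => by
    rw [packingConstant, hA1 θ hθ, EReal.coe_ennreal_one, div_eq_mul_inv, ← EReal.coe_one, ← EReal.coe_inv,
      inv_one, EReal.coe_one, mul_one]
  have hy' : y < packingConstant θ₀.1 η V := hy
  rw [hone θ₀ hθ₀, lt_iSup_iff] at hy'
  obtain ⟨α, hα⟩ := hy'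
  rw [lt_iSup_iff] at hα
  obtain ⟨⟨hα0, hαe⟩, hαy⟩ := hα
  -- A single `α` whose volume exceeds `y` stays admissible near `θ₀`; the embedding result is
  -- applied to the symplectic form `α • η`.
  filter_upwards [self_mem_nhdsWithin, mem_nhdsWithin_of_mem_nhds
    (SymplecticallyEmbeds.eventually (hη.smul hα0.ne') hV hH (hA θ₀ hθ₀).closed hαe)] with θ hθ hθe
  change y < packingConstant θ.1 η V
  rw [hone θ hθ]
  exact hαy.trans_le (le_iSup₂_of_le α ⟨hα0, hθe (hA θ hθ).closed⟩ le_rfl)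

end Stability

end

end

/-- Both classes consist of symplectic forms, so the semicontinuity on sets of symplectic forms of
volume 1 applies to each. -/
theorem mainTheorem11 (n : ℕ)
    (M : Type*) [TopologicalSpace M] [ChartedSpace (Model n) M] [IsManifold 𝓘(ℝ, Model n) ∞ M]
    [T2Space M] [CompactSpace M] [ConnectedSpace M] [MeasurableSpace M] [BorelSpace M]
    (U : Type*) [TopologicalSpace U] [ChartedSpace (Model n) U] [IsManifold 𝓘(ℝ, Model n) ∞ U]
    [T2Space U] [SecondCountableTopology U] [MeasurableSpace U] [BorelSpace U]
    (η : DiffForm n 2 U) (hη : IsSymplectic η)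
    (V : Set U) (hV : IsCompact V) (hH : Subsingleton (deRhamCohomology n 1 V)) :
    LowerSemicontinuousOn (fun θ : SmoothForm n 2 M => packingConstant θ.1 η V)
      {θ | IsKahlerForm θ.1 ∧ symplecticVolume θ.1 univ = 1} ∧
    LowerSemicontinuousOn (fun θ : SmoothForm n 2 M => packingConstant θ.1 η V)
      {θ | IsHyperkahlerForm θ.1 ∧ symplecticVolume θ.1 univ = 1} :=
  ⟨lowerSemicontinuousOn_packingConstant hη hV hH (fun _ h => h.1.1) fun _ h => h.2,
    lowerSemicontinuousOn_packingConstant hη hV hH (fun _ h => by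
      obtain ⟨J, Ω, hΩ, i, hi⟩ := h.1
      rw [hi]
      exact hΩ.symplectic i) fun _ h => h.2⟩
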